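/- Let $\Gamma$ be a countable group, $K$ a second countable compact (Hausdorff) abelian group and $\Lambda<K$ a countable dense subgroup. Assume that either $\Gamma$ is infinite and $K$ is non-trivial, or $\Gamma$ is trivial and $K$ is infinite. Let $X=K^\Gamma$ with the product of the normalized Haar measures, let $\Gamma\times\Lambda$ act on $X$ by $((g,s)\cdot x)_h=s\,x_{hg}$, and let $M=L^\infty(X)\rtimes(\Gamma\times\Lambda)$, with canonical unitaries $u_{(g,s)}$ and canonical trace $\tau$; write $u_s=u_{(e,s)}$ for $s\in\Lambda$. For a closed subgroup $K_1<K$, acting on $X$ by diagonal translation, put $\Lambda_1=\Lambda\cap K_1$, view $L^\infty(X/K_1)$ as the algebra of $K_1$-invariant functions in $L^\infty(X)$, and let $C(K_1)=L^\infty(X/K_1)\rtimes\Lambda_1$ be the von Neumann subalgebra of $M$ generated by $L^\infty(X/K_1)$ and $\{u_s : s\in\Lambda_1\}$. Let $K_1<K$ be a closed subgroup. 1. $C(K_1)'\cap M=C(\overline{\Lambda_1})$. 2. $C(K_1)$ is maximal abelian in $M$ if and only if $\Lambda\cap K_1$ is dense in $K_1$. 3. If $\Lambda\cap K_1$ is dense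 in $K_1$, then $C(K_1)$ is a Cartan subalgebra of the II$_1$ factor $M$, i.e. $M$ is a II$_1$ factor, $C(K_1)$ is maximal abelian in $M$, and the unitaries $u\in M$ with $uC(K_1)u^*=C(K_1)$ generate $M$ as a von Neumann algebra. Moreover, let $\widehat{\Lambda_1}$ be the compact dual of the discrete group $\Lambda_1$, let $Z=X/K_1\times\widehat{\Lambda_1}$ carry the product $\eta$ of the image of the measure of $X$ and the normalized Haar measure, and identify $L^\infty(Z,\eta)=C(K_1)$ by the trace preserving $*$-isomorphism $\theta$ (so $\tau\circ\theta=\int\cdot\,d\eta$) that sends $f\otimes 1$ to $f$ for $f \in L^\infty(X/K_1)$ and sends the function $(y,\chi)\mapsto\chi(s)$ to $u_s$ for $s\in\Lambda_1$. Then the equivalence relation $\mathcal R$ on $(Z,\eta)$ induced by the Cartan subalgebra $C(K_1)\subset M$ is the orbit relation of the product action of $(\Gamma\times\Lambda K_1/K_1)\times\widehat{K_1}$ on $X/K_1\times\widehat{\Lambda_1}$, where $\Gamma$ acts on $X/K_1$ by the quotient of the Bernoulli shift, $\Lambda K_1/K_1$ acts on $X/K_1$ by diagonal translation, and $\widehat{K_1}$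 acts on $\widehat{\Lambda_1}$ by restricting characters to $\Lambda_1$ and multiplying. Here the induced equivalence relation is the countable measurable equivalence relation, unique up to null sets, whose full group (the measure preserving automorphisms $\varphi$ of $(Z,\eta)$ with $\varphi(z)\sim z$ for a.e. $z$) consists exactly of the automorphisms $\varphi$ for which there is a unitary $u\in M$ normalizing $C(K_1)$ with $u\theta(f)u^*=\theta(f\circ\varphi^{-1})$ for all $f\in L^\infty(Z,\eta)$, every normalizing unitary giving such a $\varphi$. -/

import Mathlib

open MeasureTheory Set
open scoped ENNReal ComplexConjugate

noncomputable section

namespace CompactBernoulli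

/-! ### Von Neumann algebras: generation, maximal abelian subalgebras, Cartan subalgebras -/

section VonNeumann

variable {H : Type*} [NormedAddCommGroup H] [InnerProductSpace ℂ H] [CompleteSpace H]

/-- The von Neumann algebra generated by a set of operators: the double commutant of the set
together with its adjoints. -/
def generatedBy (S : Set (H →L[ℂ] H)) : VonNeumannAlgebra H where
  toStarSubalgebra :=
    StarSubalgebra.centralizer ℂ (StarSubalgebra.centralizer ℂ S : Set (H →L[ℂ] H))
  centralizer_centralizer' := by
    change Set.centralizer (Set.centralizer (Set.centralizer _)) = Set.centralizer _
    exact Set.centralizer_centralizer_centralizer _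

theorem coe_generatedBy (S : Set (H →L[ℂ] H)) :
    (generatedBy S : Set (H →L[ℂ] H)) = Set.centralizer (Set.centralizer (S ∪ star S)) := by
  change Set.centralizer ((StarSubalgebra.centralizer ℂ S : Set (H →L[ℂ] H)) ∪
    star (StarSubalgebra.centralizer ℂ S : Set (H →L[ℂ] H))) = _
  have h : star (StarSubalgebra.centralizer ℂ S : Set (H →L[ℂ] H)) =
      (StarSubalgebra.centralizer ℂ S : Set (H →L[ℂ] H)) := by
    ext x
    simp only [Set.mem_star, SetLike.mem_coe]
    exact star_mem_iff
  rw [h, Set.union_self, StarSubalgebra.coe_centralizer]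

theorem subset_generatedBy (S : Set (H →L[ℂ] H)) : S ⊆ generatedBy S := by
  rw [coe_generatedBy]
  exact Set.subset_union_left.trans Set.subset_centralizer_centralizer

/-- The relative commutant `A' ∩ M`. -/
def relativeCommutant (A M : VonNeumannAlgebra H) : Set (H →L[ℂ] H) :=
  {x | x ∈ M ∧ ∀ a ∈ A, a * x = x * a}

/-- `A` is an abelian von Neumann subalgebra of `M`, and maximal among these. -/
def IsMaximalAbelian (A M : VonNeumannAlgebra H) : Prop :=
  Maximal (fun B : VonNeumannAlgebra H => B ≤ M ∧ ∀ x ∈ B, ∀ y ∈ B, x * y = y * x) A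

/-- The group of unitaries `u ∈ M` such that `u A u* = A`, as a set of operators. -/
def normalizer (A M : VonNeumannAlgebra H) : Set (H →L[ℂ] H) :=
  {u | u ∈ M ∧ u ∈ unitary (H →L[ℂ] H) ∧
    (fun a => u * a * star u) '' (A : Set (H →L[ℂ] H)) = A}

/-- A factor of type II₁: an infinite dimensional von Neumann algebra with trivial center that is
finite, i.e. in which every isometry is a unitary. -/
structure IsTypeIIOneFactor (M : VonNeumannAlgebra H) : Prop where
  center_trivial : ∀ z ∈ M, (∀ x ∈ M, x * z = z * x) → ∃ c : ℂ, z = c • (1 : H →L[ℂ] H)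
  infinite_dimensional : ¬ FiniteDimensional ℂ M.toStarSubalgebra
  finite : ∀ v ∈ M, star v * v = 1 → v * star v = 1

/-- A Cartan subalgebra of a II₁ factor: a maximal abelian von Neumann subalgebra whose normalizer
generates the factor as a von Neumann algebra. -/
structure IsCartan (A M : VonNeumannAlgebra H) : Prop where
  factor : IsTypeIIOneFactor M
  maximalAbelian : IsMaximalAbelian A M
  regular : generatedBy (normalizer A M) = M

end VonNeumann

/-! ### Bounded measurable functions and multiplication operators -/

section Functions

/-- The `*`-algebra of bounded measurable functions on `Z`. Its quotient by the ideal of functions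
vanishing almost everywhere for a measure `η` is `L^∞(Z, η)`. -/
def BddMeas (Z : Type*) [MeasurableSpace Z] : StarSubalgebra ℂ (Z → ℂ) where
  carrier := {f | Measurable f ∧ ∃ C : ℝ, ∀ z, ‖f z‖ ≤ C}
  mul_mem' := by
    rintro f g ⟨hf, C, hC⟩ ⟨hg, D, hD⟩
    refine ⟨hf.mul hg, C * D, fun z => ?_⟩
    rw [Pi.mul_apply, norm_mul]
    exact mul_le_mul (hC z) (hD z) (norm_nonneg _) ((norm_nonneg _).trans (hC z))
  add_mem' := by
    rintro f g ⟨hf, C, hC⟩ ⟨hg, D, hD⟩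
    exact ⟨hf.add hg, C + D, fun z => (norm_add_le _ _).trans (add_le_add (hC z) (hD z))⟩
  algebraMap_mem' := fun c => ⟨measurable_const, ‖c‖, fun _ => le_rfl⟩
  star_mem' := by
    rintro f ⟨hf, C, hC⟩
    exact ⟨continuous_star.measurable.comp hf, C, fun z => (norm_star (f z)).trans_le (hC z)⟩

variable {Y Z : Type*} [MeasurableSpace Y] [MeasurableSpace Z]

/-- Composition `f ↦ f ∘ p` with a measurable map `p`. -/
def compMap (f : BddMeas Z) (p : Y → Z) (hp : Measurable p) : BddMeas Y :=
  ⟨fun y => f.1 (p y), f.2.1.comp hp, f.2.2.choose, fun y => f.2.2.choose_spec (p y)⟩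

theorem memLp_bddMeas (f : BddMeas Z) (η : Measure Z) : MemLp f.1 ∞ η :=
  memLp_top_of_bound f.2.1.aestronglyMeasurable f.2.2.choose
    (Filter.Eventually.of_forall f.2.2.choose_spec)

/-- The operator of multiplication by `f` on `L²(Z, η)`. -/
def mulOp (η : Measure Z) (f : BddMeas Z) : Lp ℂ 2 η →L[ℂ] Lp ℂ 2 η :=
  (ContinuousLinearMap.mul ℂ ℂ).holderL η ∞ 2 2 ((memLp_bddMeas f η).toLp f.1)

theorem coeFn_mulOp (η : Measure Z) (f : BddMeas Z) (ξ : Lp ℂ 2 η) :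
    mulOp η f ξ =ᵐ[η] fun z => f.1 z * ξ z := by
  have h := (ContinuousLinearMap.mul ℂ ℂ).coeFn_holder (r := 2) ((memLp_bddMeas f η).toLp f.1) ξ
  filter_upwards [h, (memLp_bddMeas f η).coeFn_toLp] with z hz hz'
  rw [hz'] at hz
  exact hz

end Functions

/-! ### The group measure space construction -/

section CrossedProduct

variable (G : Type*) [Group G] [Countable G] [MeasurableSpace G] [DiscreteMeasurableSpace G]
  (X : Type*) [MeasurableSpace X] (μ : Measure X) [SFinite μ] [MulAction G X]
  [MeasurableConstSMul G X] [SMulInvariantMeasure G X μ]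

/-- The Hilbert space `ℓ²(G) ⊗ L²(X, μ) = L²(G × X)`. -/
abbrev RegularSpace : Type _ := Lp ℂ 2 ((Measure.count : Measure G).prod μ)

variable {G X}

theorem measurePreserving_diag (g : G) :
    MeasurePreserving (fun p : G × X => (g⁻¹ * p.1, g⁻¹ • p.2))
      ((Measure.count : Measure G).prod μ) ((Measure.count : Measure G).prod μ) := by
  have h1 : MeasurePreserving (fun h : G => g⁻¹ * h) Measure.count Measure.count := by
    refine ⟨Measurable.of_discrete, ?_⟩
    ext s hs
    rw [Measure.map_apply Measurable.of_discrete hs,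
      Measure.count_apply (MeasurableSet.of_discrete), Measure.count_apply hs]
    rw [Set.encard_preimage_of_bijective (Group.mulLeft_bijective g⁻¹) s]
  exact h1.prod (measurePreserving_smul g⁻¹ μ)

/-- The unitary `u_g` on `L²(G × X)`: `(u_g ξ)(h, x) = ξ(g⁻¹ h, g⁻¹ x)`. -/
def groupUnitary (g : G) : RegularSpace G X μ →L[ℂ] RegularSpace G X μ :=
  (Lp.compMeasurePreservingₗᵢ ℂ (fun p : G × X => (g⁻¹ * p.1, g⁻¹ • p.2))
    (measurePreserving_diag μ g)).toContinuousLinearMap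

variable (G) in
/-- The operator on `L²(G × X)` representing `f ∈ L^∞(X)`: `(f ξ)(h, x) = f(x) ξ(h, x)`. -/
def functionOp (f : BddMeas X) : RegularSpace G X μ →L[ℂ] RegularSpace G X μ :=
  mulOp ((Measure.count : Measure G).prod μ) (compMap f Prod.snd measurable_snd)

variable (G X) in
/-- The crossed product `L^∞(X) ⋊ G`, acting on `L²(G × X)`. It is generated by `L^∞(X)` and the
unitaries `u_g`, which satisfy `u_g f u_g* = f(g⁻¹ ·)`. -/
def crossedProduct : VonNeumannAlgebra (RegularSpace G X μ) :=
  generatedBy (Set.range (functionOp G μ) ∪ Set.range (groupUnitary (G := G) μ))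

variable (G X) in
/-- The vector `δ_e ⊗ 1`, whose vector state is the canonical trace on the crossed product of a
probability measure preserving action. -/
def traceVector [IsFiniteMeasure μ] : RegularSpace G X μ :=
  indicatorConstLp 2 (s := ({1} : Set G) ×ˢ (Set.univ : Set X))
    ((MeasurableSet.of_discrete).prod MeasurableSet.univ)
    (by
      rw [Measure.prod_prod, Measure.count_singleton, one_mul]
      exact measure_ne_top μ _) (1 : ℂ)

end CrossedProduct

/-! ### The equivalence relation induced by an abelian subalgebra -/

section InducedRelation

variable {H : Type*} [NormedAddCommGroup H] [InnerProductSpace ℂ H] [CompleteSpace H]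
variable {Z : Type*} [MeasurableSpace Z]

/-- The full group of an equivalence relation on a probability space `(Z, η)`: the measure
preserving automorphisms `φ` of `(Z, η)` with `φ z ∼ z` for almost every `z`. -/
def fullGroup (η : Measure Z) (R : Setoid Z) : Set (Z ≃ᵐ Z) :=
  {φ | MeasurePreserving φ η η ∧ ∀ᵐ z ∂η, R (φ z) z}

/-- `θ` is (the lift to bounded measurable functions of) a `*`-isomorphism of `L^∞(Z, η)` onto `A`. -/
def IsLinftyIso (A : VonNeumannAlgebra H) (η : Measure Z) (θ : BddMeas Z →⋆ₐ[ℂ] (H →L[ℂ] H)) :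
    Prop :=
  (∀ f, θ f = 0 ↔ f.1 =ᵐ[η] 0) ∧ Set.range θ = A

/-- The automorphism `Ad u` of `A ≅ L^∞(Z, η)` is induced by the transformation `φ` of `Z`. -/
def Implements (θ : BddMeas Z →⋆ₐ[ℂ] (H →L[ℂ] H)) (u : H →L[ℂ] H) (φ : Z ≃ᵐ Z) : Prop :=
  ∀ f : BddMeas Z, u * θ f * star u = θ (compMap f φ.symm φ.symm.measurable)

/-- `R` is the countable measured equivalence relation on `(Z, η)` induced by the inclusion
`L^∞(Z, η) ≅ A ⊆ M` (the identification being `θ`): its full group consists precisely of the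
automorphisms of `(Z, η)` that come from the normalizer of `A` in `M`. As a countable measured
equivalence relation is determined by its full group up to a null set, this determines `R` up to a
null set. -/
structure IsInducedRelation (A M : VonNeumannAlgebra H) (η : Measure Z)
    (θ : BddMeas Z →⋆ₐ[ℂ] (H →L[ℂ] H)) (R : Setoid Z) : Prop where
  measurable : MeasurableSet {p : Z × Z | R p.1 p.2}
  countable : ∀ z, {w | R z w}.Countable
  normalizer_mem : ∀ u ∈ normalizer A M, ∃ φ ∈ fullGroup η R, Implements θ u φ
  fullGroup_mem : ∀ φ ∈ fullGroup η R, ∃ u ∈ normalizer A M, Implements θ u φ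

end InducedRelation

/-! ### Compact groups, Haar measure, duals -/

section Groups

/-- The normalized Haar measure of a compact group. -/
def haarProb (G : Type*) [Group G] [TopologicalSpace G] [IsTopologicalGroup G] [CompactSpace G]
    [MeasurableSpace G] [BorelSpace G] : Measure G :=
  Measure.haarMeasure ⊤

instance (G : Type*) [Group G] [TopologicalSpace G] [IsTopologicalGroup G] [CompactSpace G]
    [MeasurableSpace G] [BorelSpace G] : (haarProb G).IsHaarMeasure :=
  inferInstanceAs (Measure.haarMeasure (⊤ : TopologicalSpace.PositiveCompacts G)).IsHaarMeasure

instance (G : Type*) [Group G] [TopologicalSpace G] [IsTopologicalGroup G] [CompactSpace G]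
    [MeasurableSpace G] [BorelSpace G] : IsProbabilityMeasure (haarProb G) :=
  ⟨Measure.haarMeasure_self (K₀ := (⊤ : TopologicalSpace.PositiveCompacts G))⟩

/-- The group `A` equipped with the discrete topology. -/
def Discr (A : Type*) : Type _ := A

instance (A : Type*) [CommGroup A] : CommGroup (Discr A) := inferInstanceAs (CommGroup A)

instance (A : Type*) : TopologicalSpace (Discr A) := ⊥

instance (A : Type*) : DiscreteTopology (Discr A) := ⟨rfl⟩

/-- The compact dual group of all characters of a group `A` regarded as a discrete group. -/
abbrev DiscreteDual (A : Type*) [CommGroup A] : Type _ := PontryaginDual (Discr A)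

instance (A : Type*) [CommGroup A] : MeasurableSpace (DiscreteDual A) := borel _

instance (A : Type*) [CommGroup A] : BorelSpace (DiscreteDual A) := ⟨rfl⟩

/-- The evaluation of a character at `a`. -/
def evalChar {A : Type*} [CommGroup A] (a : A) (χ : DiscreteDual A) : ℂ :=
  (χ (show Discr A from a) : Circle)

theorem continuous_evalChar {A : Type*} [CommGroup A] (a : A) :
    Continuous (evalChar a) := by
  refine continuous_subtype_val.comp ?_
  exact (ContinuousEvalConst.continuous_eval_const (F := (Discr A →ₜ* Circle))
    (show Discr A from a))

/-- `a ∈ A` as a bounded measurable function on the dual of `A`. -/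
def evalFun {A : Type*} [CommGroup A] (a : A) : BddMeas (DiscreteDual A) :=
  ⟨evalChar a, (continuous_evalChar a).measurable, 1, fun χ => (Circle.norm_coe _).le⟩

end Groups

/-! ### The Bernoulli action, the factor `M` and the subalgebras `C(K₁)` -/

section Bernoulli

variable (Γ : Type*) [Group Γ] {K : Type*} [CommGroup K]

/-- The diagonal embedding of `K` into `K^Γ`. -/
def diagHom : K →* (Γ → K) := MonoidHom.pi fun _ => MonoidHom.id K

/-- `K₁` seen diagonally as a subgroup of `K^Γ`. -/
abbrev diag (K₁ : Subgroup K) : Subgroup (Γ → K) := K₁.map (diagHom Γ)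

/-- The quotient `X/K₁`, where `X = K^Γ`. -/
abbrev QuotX (K₁ : Subgroup K) : Type _ := (Γ → K) ⧸ diag Γ K₁

variable {Γ}

/-- The Bernoulli shift `(g · x)_h = x_{hg}` on `X = K^Γ`. -/
def shift (g : Γ) : (Γ → K) →* (Γ → K) where
  toFun x h := x (h * g)
  map_one' := rfl
  map_mul' _ _ := rfl

/-- The action of `Γ × Λ` on `X = K^Γ`: `((g, s) · x)_h = s x_{hg}`. -/
instance actionX (Λ : Subgroup K) : MulAction (Γ × Λ) (Γ → K) where
  smul p x := fun h => (p.2 : K) * x (h * p.1)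
  one_smul x := by
    funext h
    change ((1 : Λ) : K) * x (h * 1) = x h
    simp
  mul_smul p q x := by
    funext h
    change ((p.2 * q.2 : Λ) : K) * x (h * (p.1 * q.1)) = p.2 * (q.2 * x (h * p.1 * q.1))
    simp [mul_assoc]

theorem actionX_apply (Λ : Subgroup K) (p : Γ × Λ) (x : Γ → K) (h : Γ) :
    (p • x) h = (p.2 : K) * x (h * p.1) := rfl

variable (Γ) in
/-- The diagonal embedding of `K/K₁` into `X/K₁`. -/
def quotDiag (K₁ : Subgroup K) : K ⧸ K₁ →* QuotX Γ K₁ :=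
  QuotientGroup.map K₁ (diag Γ K₁) (diagHom Γ) (Subgroup.le_comap_map _ _)

/-- The Bernoulli shift on `X/K₁`. -/
def quotShift (K₁ : Subgroup K) (g : Γ) : QuotX Γ K₁ →* QuotX Γ K₁ :=
  QuotientGroup.map (diag Γ K₁) (diag Γ K₁) (shift g) (by
    rintro _ ⟨k, hk, rfl⟩
    exact ⟨k, hk, rfl⟩)

/-- The subgroup `ΛK₁/K₁` of `K/K₁`. -/
def quotΛ (Λ K₁ : Subgroup K) : Subgroup (K ⧸ K₁) := (Λ ⊔ K₁).map (QuotientGroup.mk' K₁)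

/-- The action of `Γ × ΛK₁/K₁` on `X/K₁`: the Bernoulli shift and diagonal translation. -/
instance actionQuotX (Λ K₁ : Subgroup K) : MulAction (Γ × quotΛ Λ K₁) (QuotX Γ K₁) where
  smul p y := quotDiag Γ K₁ p.2 * quotShift K₁ p.1 y
  one_smul y := by
    change quotDiag Γ K₁ ((1 : quotΛ Λ K₁) : K ⧸ K₁) * quotShift K₁ 1 y = y
    obtain ⟨x, rfl⟩ := QuotientGroup.mk_surjective y
    have : shift (1 : Γ) x = x := by
      funext h
      change x (h * 1) = x h
      rw [mul_one]
    simp [quotShift, this]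
  mul_smul p q y := by
    change quotDiag Γ K₁ ((p.2 * q.2 : quotΛ Λ K₁) : K ⧸ K₁) * quotShift K₁ (p.1 * q.1) y =
      quotDiag Γ K₁ p.2 * quotShift K₁ p.1 (quotDiag Γ K₁ q.2 * quotShift K₁ q.1 y)
    obtain ⟨x, rfl⟩ := QuotientGroup.mk_surjective y
    obtain ⟨k, hk⟩ := QuotientGroup.mk_surjective (q.2 : K ⧸ K₁)
    have h1 : shift (p.1 * q.1) x = shift p.1 (shift q.1 x) := by
      funext h
      change x (h * (p.1 * q.1)) = x (h * p.1 * q.1)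
      rw [mul_assoc]
    have h2 : quotShift K₁ p.1 (quotDiag Γ K₁ q.2) = quotDiag Γ K₁ q.2 := by
      rw [← hk]
      rfl
    rw [Subgroup.coe_mul, map_mul, map_mul, h2, mul_assoc]
    congr 2
    simp [quotShift, h1]

/-- The inclusion of `Λ₁ = Λ ∩ K₁`, with the discrete topology, into `K₁`. -/
def inclHom [TopologicalSpace K] (Λ K₁ : Subgroup K) : Discr ↥(Λ ⊓ K₁) →ₜ* K₁ where
  toMonoidHom := Subgroup.inclusion (inf_le_right : Λ ⊓ K₁ ≤ K₁)
  continuous_toFun := continuous_of_discreteTopology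

/-- The space `X/K₁ × Λ̂₁`, where `Λ₁ = Λ ∩ K₁`. -/
abbrev BaseSpace (Γ : Type*) [Group Γ] {K : Type*} [CommGroup K] (Λ K₁ : Subgroup K) : Type _ :=
  QuotX Γ K₁ × DiscreteDual ↥(Λ ⊓ K₁)

/-- The product action of `(Γ × ΛK₁/K₁) × K̂₁` on `X/K₁ × Λ̂₁`, where `K̂₁` acts on `Λ̂₁` by
restricting characters to `Λ₁` and multiplying. -/
instance actionBase [TopologicalSpace K] (Λ K₁ : Subgroup K) :
    MulAction ((Γ × quotΛ Λ K₁) × PontryaginDual K₁) (BaseSpace Γ Λ K₁) where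
  smul p z := (p.1 • z.1, PontryaginDual.map (inclHom Λ K₁) p.2 * z.2)
  one_smul z := by
    refine Prod.ext (one_smul (Γ × quotΛ Λ K₁) z.1) ?_
    change PontryaginDual.map (inclHom Λ K₁) 1 * z.2 = z.2
    rw [_root_.map_one, one_mul]
  mul_smul p q z := by
    refine Prod.ext (mul_smul p.1 q.1 z.1) ?_
    change PontryaginDual.map (inclHom Λ K₁) (p.2 * q.2) * z.2 =
      PontryaginDual.map (inclHom Λ K₁) p.2 * (PontryaginDual.map (inclHom Λ K₁) q.2 * z.2)
    rw [_root_.map_mul, mul_assoc]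

/-- The orbit equivalence relation of the product action. -/
def orbitRelation (Γ : Type*) [Group Γ] {K : Type*} [CommGroup K] [TopologicalSpace K]
    (Λ K₁ : Subgroup K) : Setoid (BaseSpace Γ Λ K₁) :=
  MulAction.orbitRel ((Γ × quotΛ Λ K₁) × PontryaginDual K₁) (BaseSpace Γ Λ K₁)

variable [TopologicalSpace K] [IsTopologicalGroup K] [CompactSpace K]
  [MeasurableSpace K] [BorelSpace K]

variable (Γ K) in
/-- The product of the Haar measures on `X = K^Γ`. -/
def measX : Measure (Γ → K) := Measure.infinitePi fun _ : Γ => haarProb K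

instance : IsProbabilityMeasure (measX Γ K) :=
  inferInstanceAs (IsProbabilityMeasure (Measure.infinitePi fun _ : Γ => haarProb K))

/-- The measure on `X/K₁ × Λ̂₁`: the product of the image of the measure of `X` and the normalized
Haar measure. -/
def measBase (Γ : Type*) [Group Γ] {K : Type*} [CommGroup K] [TopologicalSpace K]
    [IsTopologicalGroup K] [CompactSpace K] [MeasurableSpace K] [BorelSpace K]
    (Λ K₁ : Subgroup K) : Measure (BaseSpace Γ Λ K₁) :=
  ((measX Γ K).map (QuotientGroup.mk : (Γ → K) → QuotX Γ K₁)).prod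
    (haarProb (DiscreteDual ↥(Λ ⊓ K₁)))

instance (Λ : Subgroup K) : MeasurableConstSMul (Γ × Λ) (Γ → K) where
  measurable_const_smul p := by
    refine measurable_pi_lambda _ fun h => ?_
    change Measurable fun x : Γ → K => (p.2 : K) * x (h * p.1)
    exact (measurable_pi_apply _).const_mul _

instance (Λ : Subgroup K) : SMulInvariantMeasure (Γ × Λ) (Γ → K) (measX Γ K) := by
  refine ⟨fun p s hs => ?_⟩
  have hm : Measurable fun x : Γ → K => p • x := measurable_const_smul p
  rw [← Measure.map_apply hm hs]
  congr 1
  refine Measure.eq_infinitePi _ fun t u hu => ?_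
  have hset : (fun x : Γ → K => p • x) ⁻¹' (t : Set Γ).pi u =
      ((t.map (mulRightEmbedding p.1) : Finset Γ) : Set Γ).pi
        (fun k => (fun y : K => (p.2 : K) * y) ⁻¹' u (k * p.1⁻¹)) := by
    ext x
    simp only [Set.mem_preimage, Set.mem_pi, Finset.coe_map, Set.forall_mem_image,
      mulRightEmbedding_apply, mul_inv_cancel_right, actionX_apply]
  rw [Measure.map_apply hm (MeasurableSet.pi t.countable_toSet fun i _ => hu i), hset, measX,
    Measure.infinitePi_pi, Finset.prod_map]
  · refine Finset.prod_congr rfl fun i _ => ?_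
    simp only [mulRightEmbedding_apply, mul_inv_cancel_right]
    exact measure_preimage_mul _ _ _
  · intro k _
    exact (measurable_const_mul _) (hu _)

variable (Γ) in
/-- The factor `M = L^∞(K^Γ) ⋊ (Γ × Λ)`. -/
def algM [Countable Γ] [MeasurableSpace Γ] [DiscreteMeasurableSpace Γ]
    [MeasurableSingletonClass K] (Λ : Subgroup K) [Countable Λ] :
    VonNeumannAlgebra (RegularSpace (Γ × Λ) (Γ → K) (measX Γ K)) :=
  crossedProduct (Γ × Λ) (Γ → K) (measX Γ K)

/-- A function on `X/K₁` seen as a `K₁`-invariant function on `X`. -/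
def pullback (K₁ : Subgroup K) (f : BddMeas (QuotX Γ K₁)) : BddMeas (Γ → K) :=
  compMap f QuotientGroup.mk QuotientGroup.measurable_coe

variable (Γ) in
/-- The subalgebra `C(K₁) = L^∞(X/K₁) ⋊ Λ₁` of `M`, generated by `L^∞(X/K₁)` and by the unitaries
`u_s` with `s ∈ Λ₁ = Λ ∩ K₁`. -/
def algC [Countable Γ] [MeasurableSpace Γ] [DiscreteMeasurableSpace Γ]
    [MeasurableSingletonClass K] (Λ : Subgroup K) [Countable Λ] (K₁ : Subgroup K) :
    VonNeumannAlgebra (RegularSpace (Γ × Λ) (Γ → K) (measX Γ K)) :=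
  generatedBy
    (Set.range (fun f : BddMeas (QuotX Γ K₁) => functionOp (Γ × Λ) (measX Γ K) (pullback K₁ f)) ∪
      {u | ∃ s : Λ, (s : K) ∈ K₁ ∧ u = groupUnitary (measX Γ K) ((1, s) : Γ × Λ)})

/-- `θ` is the canonical identification `L^∞(X/K₁ × Λ̂₁) = L^∞(X/K₁) ⊗ L(Λ₁) = C(K₁)`: the
trace preserving `*`-isomorphism that sends `f ⊗ 1` to `f` and the character `χ ↦ χ(s)` of `Λ̂₁`
to `u_s`. -/
structure IsCanonicalIso [Countable Γ] [MeasurableSpace Γ] [DiscreteMeasurableSpace Γ]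
    [MeasurableSingletonClass K] (Λ : Subgroup K) [Countable Λ] (K₁ : Subgroup K)
    (θ : BddMeas (BaseSpace Γ Λ K₁) →⋆ₐ[ℂ]
      (RegularSpace (Γ × Λ) (Γ → K) (measX Γ K) →L[ℂ]
        RegularSpace (Γ × Λ) (Γ → K) (measX Γ K))) : Prop where
  iso : IsLinftyIso (algC Γ Λ K₁) (measBase Γ Λ K₁) θ
  map_function : ∀ f : BddMeas (QuotX Γ K₁),
    θ (compMap f Prod.fst measurable_fst) = functionOp (Γ × Λ) (measX Γ K) (pullback K₁ f)
  map_character : ∀ s : ↥(Λ ⊓ K₁),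
    θ (compMap (evalFun s) Prod.snd measurable_snd) =
      groupUnitary (measX Γ K) ((1, Subgroup.inclusion inf_le_left s) : Γ × Λ)
  trace : ∀ f : BddMeas (BaseSpace Γ Λ K₁),
    inner ℂ (traceVector (Γ × Λ) (Γ → K) (measX Γ K))
      (θ f (traceVector (Γ × Λ) (Γ → K) (measX Γ K))) = ∫ z, f.1 z ∂(measBase Γ Λ K₁)

end Bernoulli

end CompactBernoulli

end

set_option linter.unusedSectionVars false
set_option linter.style.haveILetI false

noncomputable section

namespace CompactBernoulli

/-! ### Double commutants and abelian von Neumann algebras -/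

section VonNeumannBasics

variable {H : Type*} [NormedAddCommGroup H] [InnerProductSpace ℂ H] [CompleteSpace H]

/-! Everything is read off from Fourier coefficients. Let `Ω` be the trace vector. The vectors `δ_p
⊗ χ`, with `p ∈ Γ × Λ` and `χ` a character of `X = K^Γ`, form an orthonormal basis
(`orthonormal_fourierVec`, `dense_span_fourierVec`), and `Ω` is separating and tracial for `M`
(`isTracialVector_traceVector`), so `x ∈ M` is determined by the coefficients of `xΩ`. Since `Ω`
intertwines `M` with explicit operators in its commutant, commutation of `x` with a character or
with `u_g` becomes an identity between coefficients (`inner_fourierVec_mul`,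
`inner_fourierVec_conj`).

Let `x` commute with `C(K₁)`. The characters `ω(x_a)/ω(x_1)` lie in `C(K₁)`; letting `a` run through
an infinite `Γ`, a nonzero coefficient at `((g, s), χ)` with `g ≠ 1` would recur in modulus
infinitely often, against Bessel's inequality. Characters trivial on `K₁` force `s ∈ K₁`, and the
unitaries `u_t`, `t ∈ Λ₁`, force `χ` to be trivial on `Λ₁`, hence on its closure `K₂`. So `xΩ` lies
in the closure of `C(K₂)Ω`. A bounded-vector argument for the abelian algebra `C(K₂)`
(`IsAbelianModel.exists_repr_vec_eq`) then gives `x ∈ C(K₂)`, which is statement 1. Statement 2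
follows because `C(K₂) = C(K₁)` only if `K₂ = K₁`: the translations by `K₁` detect the difference on
characters. Triviality of the center comes from the same coefficient calculus, and finiteness from
the trace.

For the equivalence relation, `C(K₁)` is identified with functions on `X/K₁ × Λ̂₁` by matching the
moments of two groups of characters. The unitaries `χ u_g` normalize `C(K₁)`, act on that space by
the elements of `(Γ × ΛK₁/K₁) × K̂₁`, and generate `M`. An abstract argument
(`IsImplementing.isInducedRelation`) finishes: the conditional expectations of `u W_j*` show that
any normalizing unitary `u` moves points along orbits, and conversely an automorphism along orbits
is implemented by cutting and pasting the `W_j`.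

The facts on characters are obtained from scratch: they separate points by Gelfand theory for the
algebra generated by the translations of `L²(G)`, and extension from closed subgroups follows by
Stone–Weierstrass and orthogonality. -/

theorem mem_generatedBy_iff {S : Set (H →L[ℂ] H)} {x : H →L[ℂ] H} :
    x ∈ generatedBy S ↔
      ∀ T : H →L[ℂ] H, (∀ a ∈ S, a * T = T * a) → (∀ a ∈ S, star a * T = T * star a) →
        T * x = x * T := by
  rw [← SetLike.mem_coe, coe_generatedBy]
  simp only [Set.mem_centralizer_iff, Set.mem_union]
  constructor
  · intro h T h1 h2
    refine h T ?_
    rintro a (ha | ha)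
    · exact h1 a ha
    · simpa using h2 _ ha
  · intro h T hT
    exact h T (fun a ha => hT a (Or.inl ha)) fun a ha => hT _ (Or.inr (by simpa using ha))

theorem generatedBy_le {S : Set (H →L[ℂ] H)} {M : VonNeumannAlgebra H}
    (h : S ⊆ (M : Set (H →L[ℂ] H))) : generatedBy S ≤ M := by
  intro x hx
  rw [← VonNeumannAlgebra.commutant_commutant M, VonNeumannAlgebra.mem_commutant_iff]
  intro T hT
  rw [VonNeumannAlgebra.mem_commutant_iff] at hT
  exact mem_generatedBy_iff.1 hx T (fun a ha => hT a (h ha))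
    fun a ha => hT _ (star_mem (h ha))

/-- The generators and their adjoints lie in the commutant of `S ∪ S*`, so `y` commutes with them;
thus `y` is itself in that commutant, and `x` commutes with `y`. -/
theorem commute_generatedBy {S : Set (H →L[ℂ] H)} (h : ∀ a ∈ S, ∀ b ∈ S, a * b = b * a)
    (h' : ∀ a ∈ S, ∀ b ∈ S, a * star b = star b * a) {x y : H →L[ℂ] H} (hx : x ∈ generatedBy S)
    (hy : y ∈ generatedBy S) : x * y = y * x := by
  refine (mem_generatedBy_iff.1 hx y (fun a ha => ?_) fun a ha => ?_).symm
  · exact mem_generatedBy_iff.1 hy a (fun b hb => h b hb a ha) fun b hb => (h' a ha b hb).symm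
  · refine mem_generatedBy_iff.1 hy _ (fun b hb => h' b hb a ha) fun b hb => ?_
    rw [← star_mul, ← star_mul, h b hb a ha]

theorem isClosed_vonNeumann (M : VonNeumannAlgebra H) :
    IsClosed (M.toStarSubalgebra : Set (H →L[ℂ] H)) := by
  have := M.centralizer_centralizer
  rw [VonNeumannAlgebra.coe_toStarSubalgebra, ← this]
  exact Set.isClosed_centralizer _

/-- An abelian von Neumann algebra is a commutative `C*`-algebra. -/
abbrev commCStarOfCommute (M : VonNeumannAlgebra H) (h : ∀ x ∈ M, ∀ y ∈ M, x * y = y * x) :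
    CommCStarAlgebra M.toStarSubalgebra :=
  haveI := isClosed_vonNeumann M
  { StarSubalgebra.cstarAlgebra M.toStarSubalgebra with
    mul_comm := fun x y => Subtype.ext (h x x.2 y y.2) }

end VonNeumannBasics

/-! ### Characters of compact abelian groups -/

section Characters

variable {G : Type*} [CommGroup G] [TopologicalSpace G] [IsTopologicalGroup G] [CompactSpace G]
  [T2Space G] [SecondCountableTopology G] [MeasurableSpace G] [BorelSpace G]

/-- The translation operator `(λ_k ξ)(x) = ξ(k x)` on `L²(G)`. -/
def translation (k : G) : Lp ℂ 2 (haarProb G) →L[ℂ] Lp ℂ 2 (haarProb G) :=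
  (Lp.compMeasurePreservingₗᵢ ℂ (fun x : G => k • x)
    (measurePreserving_smul k (haarProb G))).toContinuousLinearMap

theorem translation_eq_smul (k : G) (ξ : Lp ℂ 2 (haarProb G)) :
    translation k ξ = (DomMulAct.mk k) • ξ := rfl

theorem translation_mul (k l : G) : translation (k * l) = translation k * translation l := by
  ext1 ξ
  change _ = translation k (translation l ξ)
  simp only [translation_eq_smul, smul_smul]
  rw [← DomMulAct.mk_mul, mul_comm]

theorem translation_one : translation (1 : G) = 1 := by
  ext1 ξ
  rw [translation_eq_smul, DomMulAct.mk_one, one_smul]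
  rfl

theorem continuous_translation (ξ : Lp ℂ 2 (haarProb G)) :
    Continuous fun k : G => translation k ξ := by
  simp only [translation_eq_smul]
  haveI : Fact ((2 : ℝ≥0∞) ≠ ∞) := ⟨by simp⟩
  exact (DomMulAct.mkHomeomorph.continuous).smul continuous_const

theorem norm_translation (k : G) (ξ : Lp ℂ 2 (haarProb G)) : ‖translation k ξ‖ = ‖ξ‖ :=
  LinearIsometry.norm_map _ _

/-- An isometry has its adjoint as a left inverse, and the translation by `k⁻¹` is a right inverse;
the two must agree. -/
theorem star_translation (k : G) : star (translation k) = translation k⁻¹ := by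
  have h1 : star (translation k) * translation k = 1 := by
    rw [ContinuousLinearMap.star_eq_adjoint]
    exact (ContinuousLinearMap.norm_map_iff_adjoint_comp_self _).1 (norm_translation k)
  have h2 : translation k * translation k⁻¹ = 1 := by
    rw [← translation_mul, mul_inv_cancel, translation_one]
  exact left_inv_eq_right_inv h1 h2

/-- The convolution operator `∫ f(y) λ_y dy` on `L²(G)`. -/
def convolutionOp (f : C(G, ℂ)) : Lp ℂ 2 (haarProb G) →L[ℂ] Lp ℂ 2 (haarProb G) :=
  LinearMap.mkContinuous
    { toFun := fun ξ => ∫ y, f y • translation y ξ ∂(haarProb G)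
      map_add' := fun ξ ξ' => by
        simp only [map_add, smul_add]
        exact integral_add
          ((f.continuous.smul (continuous_translation ξ)).integrable_of_hasCompactSupport
            (HasCompactSupport.of_compactSpace _))
          ((f.continuous.smul (continuous_translation ξ')).integrable_of_hasCompactSupport
            (HasCompactSupport.of_compactSpace _))
      map_smul' := fun c ξ => by
        simp only [map_smul, RingHom.id_apply, smul_comm _ c]
        exact integral_smul c _ }
    ‖f‖ (fun ξ => by
      refine (norm_integral_le_of_norm_le_const (C := ‖f‖ * ‖ξ‖) ?_).trans (by simp)
      filter_upwards with y
      rw [norm_smul, norm_translation]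
      exact mul_le_mul_of_nonneg_right (f.norm_coe_le_norm y) (norm_nonneg _))

theorem convolutionOp_apply (f : C(G, ℂ)) (ξ : Lp ℂ 2 (haarProb G)) :
    convolutionOp f ξ = ∫ y, f y • translation y ξ ∂(haarProb G) := rfl

theorem integrable_smul_translation (f : C(G, ℂ)) (ξ : Lp ℂ 2 (haarProb G)) :
    Integrable (fun y => f y • translation y ξ) (haarProb G) :=
  (f.continuous.smul (continuous_translation ξ)).integrable_of_hasCompactSupport
    (HasCompactSupport.of_compactSpace _)

theorem norm_convolutionOp_sub_le (f g : C(G, ℂ)) :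
    ‖convolutionOp f - convolutionOp g‖ ≤ ‖f - g‖ := by
  have : convolutionOp f - convolutionOp g = convolutionOp (f - g) := by
    ext1 ξ
    rw [sub_apply, convolutionOp_apply, convolutionOp_apply,
      convolutionOp_apply, ← integral_sub (integrable_smul_translation f ξ)
        (integrable_smul_translation g ξ)]
    simp [sub_smul]
  rw [this]
  exact LinearMap.mkContinuous_norm_le _ (norm_nonneg _) _

/-- The translate `y ↦ f(k⁻¹ y)`. -/
def translateFun (k : G) (f : C(G, ℂ)) : C(G, ℂ) := ⟨fun y => f (k⁻¹ * y), by fun_prop⟩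

theorem continuous_translateFun (f : C(G, ℂ)) : Continuous fun k => translateFun k f :=
  ContinuousMap.continuous_of_continuous_uncurry _
    (by change Continuous fun p : G × G => f (p.1⁻¹ * p.2); fun_prop)

/-- The translations are only strongly continuous in `k`. Multiplied by a convolution operator they
become norm continuous, because the dependence on `k` moves into the continuous function. This is
what makes the characters found below continuous. -/
theorem translation_mul_convolutionOp (k : G) (f : C(G, ℂ)) :
    translation k * convolutionOp f = convolutionOp (translateFun k f) := by
  ext1 ξ
  change translation k (convolutionOp f ξ) = _
  rw [convolutionOp_apply, convolutionOp_apply,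
    ← ContinuousLinearMap.integral_comp_comm _ (integrable_smul_translation f ξ),
    ← integral_mul_left_eq_self (fun y => translateFun k f y • translation y ξ) k]
  refine integral_congr_ae (Filter.Eventually.of_forall fun y => ?_)
  change translation k (f y • translation y ξ) =
    f (k⁻¹ * (k * y)) • translation (k * y) ξ
  rw [inv_mul_cancel_left, map_smul, translation_mul]
  rfl

variable (G) in
/-- The von Neumann algebra generated by the translations. -/
def translationAlg : VonNeumannAlgebra (Lp ℂ 2 (haarProb G)) :=
  generatedBy (Set.range (translation (G := G)))

theorem translation_mem (k : G) : translation k ∈ translationAlg G :=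
  subset_generatedBy _ ⟨k, rfl⟩

theorem convolutionOp_mem (f : C(G, ℂ)) : convolutionOp f ∈ translationAlg G := by
  refine mem_generatedBy_iff.2 fun T hT _ => ?_
  ext1 ξ
  change T (convolutionOp f ξ) = convolutionOp f (T ξ)
  rw [convolutionOp_apply, convolutionOp_apply,
    ← ContinuousLinearMap.integral_comp_comm _ (integrable_smul_translation f ξ)]
  refine integral_congr_ae (Filter.Eventually.of_forall fun y => ?_)
  change T (f y • translation y ξ) = f y • translation y (T ξ)
  rw [map_smul]
  congr 1
  exact (congr($(hT _ ⟨y, rfl⟩) ξ)).symm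

theorem commute_translationAlg : ∀ x ∈ translationAlg G, ∀ y ∈ translationAlg G,
    x * y = y * x := by
  intro x hx y hy
  refine commute_generatedBy ?_ ?_ hx hy
  · rintro _ ⟨k, rfl⟩ _ ⟨l, rfl⟩
    rw [← translation_mul, ← translation_mul, mul_comm]
  · rintro _ ⟨k, rfl⟩ _ ⟨l, rfl⟩
    rw [star_translation, ← translation_mul, ← translation_mul, mul_comm]

theorem exists_translation_ne {k : G} (hk : k ≠ 1) :
    ∃ ξ : Lp ℂ 2 (haarProb G), translation k ξ ≠ ξ := by
  -- The translate of such an `f` takes the value `f k = 1` at the identity, where `f` vanishes.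
  obtain ⟨f, hf1, hf2⟩ : ∃ f : C(G, ℂ), f k = 1 ∧ f 1 = 0 := by
    obtain ⟨f, h0, h1, _⟩ := exists_continuous_zero_one_of_isClosed
      (isClosed_singleton (x := (1 : G))) (isClosed_singleton (x := k)) (by simpa using hk.symm)
    refine ⟨⟨fun x => (f x : ℂ), by fun_prop⟩, ?_, ?_⟩
    · simpa using h1 rfl
    · simpa using h0 rfl
  refine ⟨ContinuousMap.toLp 2 (haarProb G) ℂ f, fun h => ?_⟩
  have h1 : translation k (ContinuousMap.toLp 2 (haarProb G) ℂ f) =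
      ContinuousMap.toLp 2 (haarProb G) ℂ ⟨fun x => f (k * x), by fun_prop⟩ := by
    rw [translation_eq_smul]
    exact DomMulAct.mk_smul_toLp k (f := f) (MemLp.of_bound
      f.continuous.aestronglyMeasurable ‖f‖ (Filter.Eventually.of_forall f.norm_coe_le_norm))
  rw [h1] at h
  have h2 := congr($(ContinuousMap.toLp_injective (haarProb G) h) 1)
  simp [hf1, hf2] at h2

/-- Convolution with a bump function near `1` of integral `c` is an approximate identity: it moves
`ξ` to within `c ε / 4` of `c ξ`. If the translation by `k` fixed all convolution operators, it
would move `c ξ` by at most `c ε / 2`, whereas it moves it by `c ε > 0`. -/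
theorem exists_convolutionOp_ne {k : G} (hk : k ≠ 1) :
    ∃ f : C(G, ℂ), translation k * convolutionOp f ≠ convolutionOp f := by
  obtain ⟨ξ, hξ⟩ := exists_translation_ne hk
  by_contra! hcon
  set ε := ‖translation k ξ - ξ‖ with hε
  have hεpos : 0 < ε := norm_pos_iff.2 (sub_ne_zero.2 hξ)
  have hU : {y : G | ‖translation y ξ - ξ‖ < ε / 4} ∈ nhds (1 : G) := by
    refine IsOpen.mem_nhds (isOpen_lt (by have := continuous_translation ξ; fun_prop)
      continuous_const) ?_
    simp only [mem_ofPred_eq, translation_one, one_apply_eq_self, sub_self, norm_zero]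
    positivity
  obtain ⟨V, hVU, hVo, hV1⟩ := mem_nhds_iff.1 hU
  obtain ⟨g, h0, h1, hg⟩ := exists_continuous_zero_one_of_isClosed
      (hVo.isClosed_compl) (isClosed_singleton (x := (1 : G)))
      (by simpa using hV1)
  set c : ℝ := ∫ y, g y ∂(haarProb G) with hc
  have hgi : Integrable (fun y => g y) (haarProb G) :=
    g.continuous.integrable_of_hasCompactSupport (HasCompactSupport.of_compactSpace _)
  have hcpos : 0 < c :=
    g.continuous.integral_pos_of_hasCompactSupport_nonneg_nonzero
      (HasCompactSupport.of_compactSpace _) (fun x => (hg x).1) (x := 1)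
      (by rw [h1 rfl]; simp)
  let f : C(G, ℂ) := ⟨fun y => (g y : ℂ), by fun_prop⟩
  have key : ‖convolutionOp f ξ - (c : ℂ) • ξ‖ ≤ c * (ε / 4) := by
    have e1 : (c : ℂ) • ξ = ∫ y, f y • ξ ∂(haarProb G) := by
      rw [integral_smul_const]
      congr 1
      exact integral_complex_ofReal.symm
    have hfi : Integrable (fun y => f y • ξ) (haarProb G) :=
      ((f.continuous).smul continuous_const).integrable_of_hasCompactSupport
        (HasCompactSupport.of_compactSpace _)
    rw [e1, convolutionOp_apply, ← integral_sub (integrable_smul_translation f ξ) hfi]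
    calc ‖∫ y, (f y • translation y ξ - f y • ξ) ∂(haarProb G)‖
        ≤ ∫ y, g y * (ε / 4) ∂(haarProb G) := by
          refine norm_integral_le_of_norm_le (hgi.mul_const _) ?_
          filter_upwards with y
          rw [← smul_sub, norm_smul]
          have hfy : ‖f y‖ = g y := by
            change ‖(g y : ℂ)‖ = g y
            rw [Complex.norm_real, Real.norm_of_nonneg (hg y).1]
          rw [hfy]
          by_cases hy : y ∈ V
          · exact mul_le_mul_of_nonneg_left (hVU hy).le (hg y).1
          · rw [h0 hy]; simp
      _ = c * (ε / 4) := integral_mul_const _ _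
  have h2 : translation k (convolutionOp f ξ) = convolutionOp f ξ := congr($(hcon f) ξ)
  have h3 : ‖(c : ℂ) • (translation k ξ - ξ)‖ ≤ c * (ε / 4) + c * (ε / 4) := by
    have : (c : ℂ) • (translation k ξ - ξ) =
        (convolutionOp f ξ - (c : ℂ) • ξ) -
          translation k (convolutionOp f ξ - (c : ℂ) • ξ) := by
      rw [map_sub, h2, map_smul, smul_sub]
      abel
    rw [this]
    refine (norm_sub_le _ _).trans (add_le_add key ?_)
    rw [norm_translation]
    exact key
  rw [norm_smul, Complex.norm_real, Real.norm_of_nonneg hcpos.le, ← hε] at h3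
  nlinarith

/-- The Gelfand transform is injective, so some character `φ` of `A` separates `a k * b f` from `b
f`; then `φ (b f) ≠ 0` and `φ (a k) ≠ 1`. The multiplicative function `l ↦ φ (a l)` is continuous as
a quotient of `φ (b (translateFun l f))` by `φ (b f)`, and has modulus one because both `a l` and `a
l⁻¹` are contractions. -/
theorem exists_character_of_representation {A : Type*} [CommCStarAlgebra A] (a : G →* A)
    (hnorm_le : ∀ l, ‖a l‖ ≤ 1) {b : C(G, ℂ) → A} (hb : Continuous b)
    (hab : ∀ l f, a l * b f = b (translateFun l f)) {k : G} {f : C(G, ℂ)}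
    (hf : a k * b f ≠ b f) : ∃ ω : PontryaginDual G, ω k ≠ 1 := by
  have hne' := fun h => hf ((gelfandTransform_isometry A).injective h)
  obtain ⟨φ, hφ⟩ : ∃ φ : WeakDual.characterSpace ℂ A, φ (a k * b f) ≠ φ (b f) := by
    by_contra! h
    exact hne' (ContinuousMap.ext fun φ => h φ)
  have hbf : φ (b f) ≠ 0 := by
    intro h
    rw [map_mul, h, mul_zero] at hφ
    exact hφ rfl
  have ha : ∀ l m, φ (a (l * m)) = φ (a l) * φ (a m) := fun l m => by
    rw [map_mul, map_mul]
  have ha1 : φ (a 1) = 1 := by rw [map_one, map_one]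
  have hnorm : ∀ l, ‖φ (a l)‖ ≤ 1 := by
    intro l
    refine (AlgHom.norm_apply_le_self_mul_norm_one φ (a l)).trans ?_
    have h2 : ‖(1 : A)‖ ≤ 1 := by
      rw [← map_one a]
      exact hnorm_le 1
    exact mul_le_one₀ (hnorm_le l) (norm_nonneg _) h2
  have hnorm1 : ∀ l, ‖φ (a l)‖ = 1 := by
    intro l
    refine le_antisymm (hnorm l) ?_
    have : ‖φ (a l)‖ * ‖φ (a l⁻¹)‖ = 1 := by
      rw [← norm_mul, ← ha, mul_inv_cancel, ha1, norm_one]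
    nlinarith [hnorm l⁻¹, norm_nonneg (φ (a l)), norm_nonneg (φ (a l⁻¹))]
  have hcont : Continuous fun l => φ (a l) := by
    have e : (fun l => φ (a l)) = fun l => φ (b (translateFun l f)) / φ (b f) := by
      funext l
      rw [eq_div_iff hbf, ← map_mul, hab]
    rw [e]
    exact ((map_continuous φ).comp (hb.comp (continuous_translateFun f))).div_const _
  refine ⟨(⟨⟨⟨fun l => ⟨φ (a l), mem_sphere_zero_iff_norm.2 (hnorm1 l)⟩, Subtype.ext ha1⟩,
    fun l m => Subtype.ext (ha l m)⟩, hcont.subtype_mk _⟩ : G →ₜ* Circle), fun h => hφ ?_⟩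
  have h1 : φ (a k) = 1 := congrArg Subtype.val h
  rw [map_mul, h1, one_mul]

/-- The characters of a compact abelian group separate its points. -/
theorem exists_character_ne_one {k : G} (hk : k ≠ 1) : ∃ ω : PontryaginDual G, ω k ≠ 1 := by
  obtain ⟨f, hf⟩ := exists_convolutionOp_ne hk
  letI := commCStarOfCommute (translationAlg G) commute_translationAlg
  refine exists_character_of_representation (A := (translationAlg G).toStarSubalgebra)
    { toFun := fun l => ⟨translation l, translation_mem l⟩
      map_one' := Subtype.ext translation_one
      map_mul' := fun l m => Subtype.ext (translation_mul l m) }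
    (fun l => LinearIsometry.norm_toContinuousLinearMap_le _)
    (b := fun g => ⟨convolutionOp g, convolutionOp_mem g⟩) (k := k) (f := f) ?_
    (fun l f => Subtype.ext (translation_mul_convolutionOp l f))
    fun h => hf (congrArg Subtype.val h)
  refine Continuous.subtype_mk ?_ _
  exact (LipschitzWith.of_dist_le_mul (K := 1) fun g g' => by
    rw [dist_eq_norm, dist_eq_norm, NNReal.coe_one, one_mul]
    exact norm_convolutionOp_sub_le g g').continuous

end Characters

/-! ### Bounded functions inside `L²` -/

section BoundedFunctions

variable {Z : Type*} [MeasurableSpace Z] (η : Measure Z) [IsFiniteMeasure η]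

theorem memLp_two_bddMeas (f : BddMeas Z) : MemLp f.1 2 η :=
  (memLp_bddMeas f η).mono_exponent le_top

/-- The class in `L²` of a bounded measurable function. -/
def toL2 : BddMeas Z →ₗ[ℂ] Lp ℂ 2 η where
  toFun f := (memLp_two_bddMeas η f).toLp f.1
  map_add' _ _ := rfl
  map_smul' _ _ := rfl

theorem coeFn_toL2 (f : BddMeas Z) : toL2 η f =ᵐ[η] f.1 :=
  MemLp.coeFn_toLp (memLp_two_bddMeas η f)

theorem toL2_eq_iff {f g : BddMeas Z} : toL2 η f = toL2 η g ↔ f.1 =ᵐ[η] g.1 :=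
  MemLp.toLp_eq_toLp_iff (memLp_two_bddMeas η f) (memLp_two_bddMeas η g)

theorem inner_toL2 (f : BddMeas Z) (ξ : Lp ℂ 2 η) :
    inner ℂ (toL2 η f) ξ = ∫ z, conj (f.1 z) * ξ z ∂η := by
  rw [L2.inner_def]
  refine integral_congr_ae ?_
  filter_upwards [coeFn_toL2 η f] with z hz
  rw [hz, RCLike.inner_apply, mul_comm]

theorem inner_toL2_toL2 (f g : BddMeas Z) :
    inner ℂ (toL2 η f) (toL2 η g) = ∫ z, (star f * g).1 z ∂η := by
  rw [inner_toL2]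
  refine integral_congr_ae ?_
  filter_upwards [coeFn_toL2 η g] with z hz
  rw [hz]
  rfl

theorem mulOp_toL2 (f g : BddMeas Z) : mulOp η f (toL2 η g) = toL2 η (f * g) := by
  refine Lp.ext ?_
  filter_upwards [coeFn_mulOp η f (toL2 η g), coeFn_toL2 η g, coeFn_toL2 η (f * g)]
    with z h1 h2 h3
  rw [h1, h2, h3]
  rfl

theorem denseRange_toL2 : DenseRange (toL2 η) := by
  refine (Lp.simpleFunc.denseRange (E := ℂ) (μ := η) (p := 2) (by simp)).mono ?_
  rintro _ ⟨f, rfl⟩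
  obtain ⟨C, hC⟩ := (Lp.simpleFunc.toSimpleFunc f).exists_forall_norm_le
  refine ⟨⟨Lp.simpleFunc.toSimpleFunc f, (Lp.simpleFunc.toSimpleFunc f).measurable, C, hC⟩, ?_⟩
  refine Lp.ext ((coeFn_toL2 η _).trans ?_)
  exact Lp.simpleFunc.toSimpleFunc_eq_toFun f

/-- The indicator function of a measurable set. -/
def indFun (s : Set Z) (hs : MeasurableSet s) : BddMeas Z :=
  ⟨s.indicator fun _ => 1, measurable_const.indicator hs, 1, fun z => by
    refine (norm_indicator_le_norm_self _ _).trans ?_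
    simp⟩

/-- A map that is bounded in the `L²` norm factors through `L²`, where vanishing on a total family
suffices. Identities between operators attached to bounded functions are reduced in this way to
characters, without any weak continuity argument. -/
theorem eq_zero_of_norm_le_toL2 {Z I V : Type*} [MeasurableSpace Z] {η : Measure Z}
    [IsFiniteMeasure η] {e : I → BddMeas Z}
    (he : Dense (Submodule.span ℂ (Set.range fun i => toL2 η (e i)) : Set (Lp ℂ 2 η)))
    [NormedAddCommGroup V] [NormedSpace ℂ V] [CompleteSpace V]
    (Φ : BddMeas Z →ₗ[ℂ] V) (C : ℝ) (hC : ∀ F, ‖Φ F‖ ≤ C * ‖toL2 η F‖)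
    (h0 : ∀ i, Φ (e i) = 0) (F : BddMeas Z) : Φ F = 0 := by
  have hE : ∀ F, Φ.extendOfNorm (toL2 η) (toL2 η F) = Φ F :=
    LinearMap.extendOfNorm_eq (denseRange_toL2 η) ⟨C, hC⟩
  have : Φ.extendOfNorm (toL2 η) = 0 := by
    refine ContinuousLinearMap.ext_on he ?_
    rintro _ ⟨i, rfl⟩
    change Φ.extendOfNorm (toL2 η) (toL2 η (e i)) = 0
    rw [hE, h0]
  rw [← hE, this]
  rfl

theorem norm_toL2_sq (f : BddMeas Z) : ‖toL2 η f‖ ^ 2 = ∫ z, ‖f.1 z‖ ^ 2 ∂η := by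
  have h := inner_self_eq_norm_sq_to_K (𝕜 := ℂ) (toL2 η f)
  rw [inner_toL2_toL2] at h
  have h2 : ∫ z, (star f * f).1 z ∂η = ((∫ z, ‖f.1 z‖ ^ 2 ∂η : ℝ) : ℂ) := by
    rw [← integral_complex_ofReal]
    refine integral_congr_ae (Filter.Eventually.of_forall fun z => ?_)
    change conj (f.1 z) * f.1 z = _
    rw [RCLike.conj_mul]
    push_cast
    rfl
  rw [h2] at h
  exact Complex.ofReal_injective (by push_cast at h ⊢; exact h.symm)

theorem norm_toL2_star (f : BddMeas Z) : ‖toL2 η (star f)‖ = ‖toL2 η f‖ := by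
  have : ‖toL2 η (star f)‖ ^ 2 = ‖toL2 η f‖ ^ 2 := by
    rw [norm_toL2_sq, norm_toL2_sq]
    refine integral_congr_ae (Filter.Eventually.of_forall fun z => ?_)
    change ‖conj (f.1 z)‖ ^ 2 = _
    rw [RCLike.norm_conj]
  exact (sq_eq_sq₀ (norm_nonneg _) (norm_nonneg _)).1 this

theorem compMap_val {Y : Type*} [MeasurableSpace Y] (f : BddMeas Z) (p : Y → Z)
    (hp : Measurable p) (y : Y) : (compMap f p hp).1 y = f.1 (p y) := rfl

end BoundedFunctions

/-! ### Total groups of continuous functions -/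

section StoneWeierstrass

variable {Y : Type*} [TopologicalSpace Y] [CompactSpace Y] [T2Space Y]
  [SecondCountableTopology Y] [MeasurableSpace Y] [BorelSpace Y]
  (ν : Measure Y) [IsFiniteMeasure ν]

/-- A group of continuous functions that separates the points of a compact space and in which
complex conjugation is the inverse is total in `L²`. -/
theorem dense_span_toL2 {I : Type*} [Group I] (e : I →* BddMeas Y)
    (hcont : ∀ i, Continuous (e i).1) (hstar : ∀ i, e i⁻¹ = star (e i))
    (hsep : ∀ x y : Y, x ≠ y → ∃ i, (e i).1 x ≠ (e i).1 y) :
    Dense (Submodule.span ℂ (Set.range fun i => toL2 ν (e i)) : Set (Lp ℂ 2 ν)) := by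
  let c : I → C(Y, ℂ) := fun i => ⟨(e i).1, hcont i⟩
  have hc1 : c 1 = 1 := by
    ext y
    change (e 1).1 y = 1
    rw [map_one]
    rfl
  have hcm : ∀ i j, c i * c j = c (i * j) := by
    intro i j
    ext y
    change (e i).1 y * (e j).1 y = (e (i * j)).1 y
    rw [map_mul]
    rfl
  have hcs : ∀ i, star (c i) = c i⁻¹ := by
    intro i
    ext y
    change star ((e i).1 y) = (e i⁻¹).1 y
    rw [hstar]
    rfl
  let S : Submonoid C(Y, ℂ) :=
    { carrier := Set.range c
      mul_mem' := by
        rintro _ _ ⟨i, rfl⟩ ⟨j, rfl⟩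
        exact ⟨i * j, (hcm i j).symm⟩
      one_mem' := ⟨1, hc1⟩ }
  let A : StarSubalgebra ℂ C(Y, ℂ) :=
    { Algebra.adjoin ℂ (Set.range c) with
      star_mem' := by
        intro f hf
        change star f ∈ Algebra.adjoin ℂ (Set.range c)
        induction hf using Algebra.adjoin_induction with
        | mem x hx =>
          obtain ⟨i, rfl⟩ := hx
          rw [hcs]
          exact Algebra.subset_adjoin ⟨_, rfl⟩
        | algebraMap r =>
          rw [← algebraMap_star_comm]
          exact Subalgebra.algebraMap_mem _ _
        | add x y _ _ hx hy => rw [star_add]; exact add_mem hx hy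
        | mul x y _ _ hx hy => rw [star_mul]; exact mul_mem hy hx }
  have hA : A.topologicalClosure = ⊤ := by
    refine ContinuousMap.starSubalgebra_topologicalClosure_eq_top_of_separatesPoints A ?_
    intro x y hxy
    obtain ⟨i, hi⟩ := hsep x y hxy
    exact ⟨_, ⟨c i, Algebra.subset_adjoin ⟨i, rfl⟩, rfl⟩, hi⟩
  have hAs : (A : Set C(Y, ℂ)) = Submodule.span ℂ (Set.range c) := by
    change ((Algebra.adjoin ℂ (Set.range c) : Subalgebra ℂ C(Y, ℂ)) : Set C(Y, ℂ)) = _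
    -- The range of `c` is already closed under products, so the algebra it generates is its linear
    -- span.
    have := Algebra.adjoin_eq_span (R := ℂ) (Set.range c)
    rw [show Submonoid.closure (Set.range c) = S from Submonoid.closure_eq S] at this
    exact congrArg (fun s : Submodule ℂ C(Y, ℂ) => (s : Set C(Y, ℂ))) this
  have hdense : Dense (Submodule.span ℂ (Set.range c) : Set C(Y, ℂ)) := by
    rw [← hAs]
    intro f
    have : f ∈ A.topologicalClosure := by rw [hA]; trivial
    exact this
  have h2 := (ContinuousMap.toLp_denseRange (p := 2) ℂ ν ℂ (by simp)).dense_image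
    (ContinuousLinearMap.continuous _) hdense
  refine h2.mono ?_
  rintro _ ⟨f, hf, rfl⟩
  refine Submodule.span_induction (p := fun f _ => ContinuousMap.toLp 2 ν ℂ f ∈
    Submodule.span ℂ (Set.range fun i => toL2 ν (e i))) ?_ ?_ ?_ ?_ hf
  · rintro _ ⟨i, rfl⟩
    exact Submodule.subset_span ⟨i, rfl⟩
  · rw [map_zero]; exact zero_mem _
  · intro x y _ _ hx hy
    rw [map_add]; exact add_mem hx hy
  · intro a x _ hx
    rw [map_smul]; exact Submodule.smul_mem _ _ hx

end StoneWeierstrass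

/-! ### Orthogonality, separation and extension of characters -/

section DualGroup

variable {G : Type*} [CommGroup G] [TopologicalSpace G] [MeasurableSpace G] [BorelSpace G]

/-- A character as a bounded measurable function. -/
def charFun : PontryaginDual G →* BddMeas G where
  toFun χ := ⟨fun x => (χ x : ℂ), (continuous_subtype_val.comp (map_continuous χ)).measurable, 1,
    fun _ => (Circle.norm_coe _).le⟩
  map_one' := rfl
  map_mul' _ _ := rfl

theorem charFun_inv (χ : PontryaginDual G) : charFun χ⁻¹ = star (charFun χ) := by
  refine Subtype.ext (funext fun x => ?_)
  change ((χ⁻¹ x : Circle) : ℂ) = conj (χ x : ℂ)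
  rw [show χ⁻¹ x = (χ x)⁻¹ from rfl, Circle.coe_inv_eq_conj]

theorem continuous_charFun (χ : PontryaginDual G) : Continuous (charFun χ).1 :=
  continuous_subtype_val.comp (map_continuous χ)

/-- The dual of a compact group is discrete, and it is second countable as a subspace of the
continuous maps from `G` to the circle; a separable discrete space is countable. -/
instance countable_dual [IsTopologicalGroup G] [CompactSpace G] [SecondCountableTopology G] :
    Countable (PontryaginDual G) := by
  haveI : SecondCountableTopology (PontryaginDual G) :=
    (ContinuousMonoidHom.isEmbedding_toContinuousMap G Circle).toIsInducing.secondCountableTopology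
  exact TopologicalSpace.separableSpace_iff_countable.1 inferInstance

/-- Translating by `y` with `χ y ≠ 1` leaves the integral unchanged but multiplies it by `χ y`. -/
theorem integral_charFun_eq_zero (ν : Measure G)
    (hν : ∀ y, MeasurePreserving (fun x => y * x) ν ν) {χ : PontryaginDual G} (hχ : χ ≠ 1) :
    ∫ x, (charFun χ).1 x ∂ν = 0 := by
  obtain ⟨y, hy⟩ : ∃ y, χ y ≠ 1 := by
    by_contra! h
    exact hχ (PontryaginDual.ext h)
  have h1 : ∫ x, (charFun χ).1 x ∂ν = (χ y : ℂ) * ∫ x, (charFun χ).1 x ∂ν := by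
    rw [← integral_const_mul]
    conv_lhs => rw [← (hν y).map_eq]
    rw [integral_map (hν y).measurable.aemeasurable
      (charFun χ).2.1.aestronglyMeasurable]
    refine integral_congr_ae (Filter.Eventually.of_forall fun x => ?_)
    change ((χ (y * x) : Circle) : ℂ) = (χ y : ℂ) * (χ x : ℂ)
    rw [map_mul]
    rfl
  by_contra h0
  have h2 : (χ y : ℂ) = 1 := mul_right_cancel₀ h0 (by rw [← h1, one_mul])
  exact hy (Subtype.ext h2)

theorem integral_charFun (ν : Measure G) [IsProbabilityMeasure ν]
    (hν : ∀ y, MeasurePreserving (fun x => y * x) ν ν) (χ : PontryaginDual G)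
    [Decidable (χ = 1)] : ∫ x, (charFun χ).1 x ∂ν = if χ = 1 then 1 else 0 := by
  split_ifs with h
  · subst h
    simp
  · exact integral_charFun_eq_zero ν hν h

variable [IsTopologicalGroup G] [CompactSpace G] [T2Space G] [SecondCountableTopology G]

theorem measurePreserving_mul_haarProb (y : G) :
    MeasurePreserving (fun x => y * x) (haarProb G) (haarProb G) :=
  measurePreserving_mul_left _ y

theorem dense_span_charFun (ν : Measure G) [IsFiniteMeasure ν] (D : Subgroup (PontryaginDual G))
    (hD : ∀ x : G, x ≠ 1 → ∃ χ ∈ D, χ x ≠ 1) :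
    Dense (Submodule.span ℂ (Set.range fun χ : D => toL2 ν (charFun (χ : PontryaginDual G))) :
      Set (Lp ℂ 2 ν)) := by
  refine dense_span_toL2 ν (charFun.comp D.subtype) (fun i => continuous_charFun _)
    (fun i => charFun_inv _) ?_
  intro x y hxy
  obtain ⟨χ, hχ, h⟩ := hD (x * y⁻¹) (by rwa [Ne, mul_inv_eq_one])
  refine ⟨⟨χ, hχ⟩, fun h' => h ?_⟩
  have h'' : χ x = χ y := Subtype.ext h'
  rw [map_mul, map_inv, h'', mul_inv_cancel]

theorem dense_span_charFun_top (ν : Measure G) [IsFiniteMeasure ν] :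
    Dense (Submodule.span ℂ (Set.range fun χ : PontryaginDual G => toL2 ν (charFun χ)) :
      Set (Lp ℂ 2 ν)) :=
  dense_span_toL2 ν charFun continuous_charFun charFun_inv fun x y hxy => by
    obtain ⟨χ, h⟩ := exists_character_ne_one (k := x * y⁻¹) (by rwa [Ne, mul_inv_eq_one])
    refine ⟨χ, fun h' => h ?_⟩
    have h'' : χ x = χ y := Subtype.ext h'
    rw [map_mul, map_inv, h'', mul_inv_cancel]

/-- A group of characters that separates points contains all characters. -/
theorem mem_of_separating (D : Subgroup (PontryaginDual G))
    (hD : ∀ x : G, x ≠ 1 → ∃ χ ∈ D, χ x ≠ 1) (ω : PontryaginDual G) : ω ∈ D := by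
  classical
  by_contra hω
  -- A character outside `D` is orthogonal to all of `D`, whose span is dense by Stone–Weierstrass;
  -- yet characters have norm one.
  have h0 : toL2 (haarProb G) (charFun ω) = 0 := by
    refine Dense.eq_zero_of_mem_orthogonal (𝕜 := ℂ) (dense_span_charFun (haarProb G) D hD) ?_
    rw [Submodule.mem_orthogonal]
    intro u hu
    induction hu using Submodule.span_induction with
    | mem x hx =>
      obtain ⟨χ, rfl⟩ := hx
      rw [inner_toL2_toL2, ← charFun_inv, ← map_mul]
      refine integral_charFun_eq_zero _ measurePreserving_mul_haarProb fun h => hω ?_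
      rw [inv_mul_eq_one] at h
      rw [← h]
      exact χ.2
    | zero => exact inner_zero_left _
    | add x y _ _ hx hy => rw [inner_add_left, hx, hy, add_zero]
    | smul a x _ hx => rw [inner_smul_left, hx, mul_zero]
  have h1 := inner_toL2_toL2 (haarProb G) (charFun ω) (charFun ω)
  rw [← charFun_inv, ← map_mul, inv_mul_cancel,
    integral_charFun _ measurePreserving_mul_haarProb, if_pos rfl, h0, inner_zero_left] at h1
  exact zero_ne_one h1

/-- Characters of closed subgroups extend. -/
theorem exists_character_extension (K₁ : Subgroup G) (hK₁ : IsClosed (K₁ : Set G))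
    (ω : PontryaginDual K₁) : ∃ χ : PontryaginDual G, ∀ k : K₁, χ k = ω k := by
  haveI : CompactSpace K₁ := isCompact_iff_compactSpace.1 hK₁.isCompact
  haveI : SecondCountableTopology K₁ := TopologicalSpace.Subtype.secondCountableTopology _
  let res : PontryaginDual G →* PontryaginDual K₁ :=
    (PontryaginDual.map (⟨K₁.subtype, continuous_subtype_val⟩ : K₁ →ₜ* G)).toMonoidHom
  -- The restrictions of characters of `G` form a group of characters of `K₁` that separates points,
  -- so it is the whole dual.
  obtain ⟨χ, hχ⟩ := mem_of_separating res.range (fun x hx => by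
    obtain ⟨χ, h⟩ := exists_character_ne_one (k := (x : G)) (by simpa using hx)
    exact ⟨res χ, ⟨χ, rfl⟩, h⟩) ω
  exact ⟨χ, fun k => by rw [← hχ]; rfl⟩

/-- The characters that vanish on a closed subgroup separate it from the other points. -/
theorem exists_character_of_notMem (K₁ : Subgroup G) (hK₁ : IsClosed (K₁ : Set G)) {x : G}
    (hx : x ∉ K₁) : ∃ χ : PontryaginDual G, (∀ k ∈ K₁, χ k = 1) ∧ χ x ≠ 1 := by
  haveI := hK₁
  letI : MeasurableSpace (G ⧸ K₁) := borel _
  haveI : BorelSpace (G ⧸ K₁) := ⟨rfl⟩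
  obtain ⟨χ, h⟩ := exists_character_ne_one (k := (x : G ⧸ K₁))
    (by rwa [Ne, QuotientGroup.eq_one_iff])
  refine ⟨PontryaginDual.map
    (⟨QuotientGroup.mk' K₁, QuotientGroup.continuous_mk⟩ : G →ₜ* G ⧸ K₁) χ, fun k hk => ?_, h⟩
  change χ (k : G ⧸ K₁) = 1
  rw [(QuotientGroup.eq_one_iff k).2 hk, map_one]

end DualGroup

/-! ### Isometries from equal Gram matrices -/

section HilbertGeneral

/-- Equal Gram matrices give finite linear combinations equal norms, so sending `u i` to `v i` is
isometric on a dense subspace and extends. -/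
theorem exists_linearIsometry_of_gram {I V H : Type*} [NormedAddCommGroup V]
    [InnerProductSpace ℂ V] [NormedAddCommGroup H] [InnerProductSpace ℂ H] [CompleteSpace H]
    (u : I → V) (v : I → H) (hu : Dense (Submodule.span ℂ (Set.range u) : Set V))
    (hg : ∀ i j, inner ℂ (u i) (u j) = inner ℂ (v i) (v j)) :
    ∃ E : V →ₗᵢ[ℂ] H, ∀ i, E (u i) = v i := by
  let U := Finsupp.linearCombination ℂ u
  let T := Finsupp.linearCombination ℂ v
  have hinner : ∀ c, ‖T c‖ = ‖U c‖ := by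
    intro c
    have h1 : inner ℂ (T c) (T c) = inner ℂ (U c) (U c) := by
      simp only [T, U, Finsupp.linearCombination_apply, Finsupp.sum, sum_inner, inner_sum,
        inner_smul_left, inner_smul_right, hg]
    rw [inner_self_eq_norm_sq_to_K, inner_self_eq_norm_sq_to_K] at h1
    have h2 : ‖T c‖ ^ 2 = ‖U c‖ ^ 2 := by exact_mod_cast h1
    exact (sq_eq_sq₀ (norm_nonneg _) (norm_nonneg _)).1 h2
  have hd : DenseRange U := by
    have : Set.range U = (Submodule.span ℂ (Set.range u) : Set V) := by
      rw [← Finsupp.range_linearCombination]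
      rfl
    rw [DenseRange, this]
    exact hu
  have hb : ∃ C, ∀ c, ‖T c‖ ≤ C * ‖U c‖ := ⟨1, fun c => by rw [one_mul, hinner]⟩
  have hE : ∀ c, T.extendOfNorm U (U c) = T c := LinearMap.extendOfNorm_eq hd hb
  refine ⟨⟨(T.extendOfNorm U).toLinearMap, fun x => ?_⟩, fun i => ?_⟩
  · refine hd.induction_on (p := fun x => ‖T.extendOfNorm U x‖ = ‖x‖) x
      (isClosed_eq (by fun_prop) (by fun_prop)) fun c => ?_
    rw [hE, hinner]
  · have := hE (Finsupp.single i 1)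
    simpa [U, T] using this

theorem ext_of_dense_inner {V : Type*} [NormedAddCommGroup V] [InnerProductSpace ℂ V] {s : Set V}
    (hs : Dense s) {x y : V} (hxy : ∀ v ∈ s, inner ℂ v x = inner ℂ v y) : x = y := by
  refine ext_inner_left ℂ fun v => ?_
  exact closure_minimal hxy (isClosed_eq (by fun_prop) (by fun_prop)) (hs v)

end HilbertGeneral

/-! ### Multiplication operators and bounded vectors -/

section Multiplication

variable {Z : Type*} [MeasurableSpace Z] (η : Measure Z) [IsFiniteMeasure η]

theorem inner_mulOp_left (f : BddMeas Z) (ξ ζ : Lp ℂ 2 η) :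
    inner ℂ (mulOp η f ξ) ζ = inner ℂ ξ (mulOp η (star f) ζ) := by
  rw [L2.inner_def, L2.inner_def]
  refine integral_congr_ae ?_
  filter_upwards [coeFn_mulOp η f ξ, coeFn_mulOp η (star f) ζ] with z h1 h2
  rw [h1, h2, RCLike.inner_apply, RCLike.inner_apply, map_mul]
  change _ = conj (f.1 z) * ζ z * conj (ξ z)
  ring

theorem inner_mulOp_right (f : BddMeas Z) (ξ ζ : Lp ℂ 2 η) :
    inner ℂ ξ (mulOp η f ζ) = inner ℂ (mulOp η (star f) ξ) ζ := by
  rw [inner_mulOp_left, star_star]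

/-- Testing on indicator functions gives `∫ |ξ|² ≤ ∫ c²` over every measurable set. -/
theorem ae_norm_le_of_mulOp_le (ξ : Lp ℂ 2 η) {c : ℝ} (hc : 0 ≤ c)
    (h : ∀ G : BddMeas Z, ‖mulOp η G ξ‖ ≤ c * ‖toL2 η G‖) : ∀ᵐ z ∂η, ‖ξ z‖ ≤ c := by
  have hint : Integrable (fun z => ‖ξ z‖ ^ 2) η := (Lp.memLp ξ).integrable_norm_pow (by simp)
  have h1 : (fun z => ‖ξ z‖ ^ 2) ≤ᵐ[η] fun _ => c ^ 2 := by
    refine ae_le_of_forall_setIntegral_le hint (integrable_const _) fun s hs _ => ?_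
    have h2 := pow_le_pow_left₀ (norm_nonneg _) (h (indFun s hs)) 2
    rw [mul_pow, norm_toL2_sq] at h2
    have h3 : ‖mulOp η (indFun s hs) ξ‖ ^ 2 = ∫ z in s, ‖ξ z‖ ^ 2 ∂η := by
      have h := inner_self_eq_norm_sq_to_K (𝕜 := ℂ) (mulOp η (indFun s hs) ξ)
      rw [L2.inner_def] at h
      have e : ∫ z, inner ℂ (mulOp η (indFun s hs) ξ z) (mulOp η (indFun s hs) ξ z) ∂η =
          ((∫ z in s, ‖ξ z‖ ^ 2 ∂η : ℝ) : ℂ) := by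
        rw [← integral_indicator hs, ← integral_complex_ofReal]
        refine integral_congr_ae ?_
        filter_upwards [coeFn_mulOp η (indFun s hs) ξ] with z hz
        rw [hz, inner_self_eq_norm_sq_to_K, norm_mul]
        by_cases hzs : z ∈ s <;> simp [indFun, hzs]
      rw [e] at h
      exact Complex.ofReal_injective (by push_cast at h ⊢; exact h.symm)
    have h4 : ∫ z, ‖(indFun s hs).1 z‖ ^ 2 ∂η = ∫ _z in s, (1 : ℝ) ∂η := by
      rw [← integral_indicator hs]
      refine integral_congr_ae (Filter.Eventually.of_forall fun z => ?_)
      by_cases hzs : z ∈ s <;> simp [indFun, hzs]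
    rw [h3, h4] at h2
    refine h2.trans_eq ?_
    rw [← integral_const_mul]
    simp
  filter_upwards [h1] with z hz
  exact (pow_le_pow_iff_left₀ (norm_nonneg _) hc two_ne_zero).1 hz

end Multiplication

/-! ### Abelian algebras as function algebras, from their moments -/

section Model

variable {H : Type*} [NormedAddCommGroup H] [InnerProductSpace ℂ H] [CompleteSpace H]
  {Z : Type*} [MeasurableSpace Z] {I : Type*} [Group I]

/-- A group of unitaries `W` in an abelian von Neumann algebra `A` whose moments in the vector state
of `Ω` are those of a total group `e` of functions on a measure space. -/
structure IsAbelianModel (A : VonNeumannAlgebra H) (Ω : H) (η : Measure Z) [IsFiniteMeasure η]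
    (e : I →* BddMeas Z) (W : I →* (H →L[ℂ] H)) : Prop where
  comm : ∀ x ∈ A, ∀ y ∈ A, x * y = y * x
  cyclic : Dense {ξ | ∃ y ∈ A.commutant, ξ = y Ω}
  total : Dense (Submodule.span ℂ (Set.range fun i => toL2 η (e i)) : Set (Lp ℂ 2 η))
  star_e : ∀ i, e i⁻¹ = star (e i)
  star_W : ∀ i, W i⁻¹ = star (W i)
  mem : ∀ i, W i ∈ A
  moment : ∀ i, inner ℂ Ω (W i Ω) = ∫ z, (e i).1 z ∂η

namespace IsAbelianModel

variable {A : VonNeumannAlgebra H} {Ω : H} {η : Measure Z} [IsFiniteMeasure η]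
  {e : I →* BddMeas Z} {W : I →* (H →L[ℂ] H)} (h : IsAbelianModel A Ω η e W)

include h

/-- Since `(W i)* W j = W (i⁻¹ j)`, and likewise for `e`, both Gram matrices consist of moments,
which agree. -/
theorem exists_isometry :
    ∃ E : Lp ℂ 2 η →ₗᵢ[ℂ] H, ∀ i, E (toL2 η (e i)) = W i Ω := by
  refine exists_linearIsometry_of_gram (fun i => toL2 η (e i)) (fun i => W i Ω) h.total
    fun i j => ?_
  have h1 : star (e i) * e j = e (i⁻¹ * j) := by rw [_root_.map_mul e, h.star_e]
  have h2 : W (i⁻¹ * j) = star (W i) * W j := by rw [_root_.map_mul W, h.star_W]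
  rw [inner_toL2_toL2, h1, ← h.moment, h2, ContinuousLinearMap.star_eq_adjoint,
    mul_apply_eq_comp, ContinuousLinearMap.adjoint_inner_right]

/-- The isometry `L²(Z, η) → H` given by the model. -/
def isom : Lp ℂ 2 η →ₗᵢ[ℂ] H := h.exists_isometry.choose

theorem isom_e (i : I) : h.isom (toL2 η (e i)) = W i Ω := h.exists_isometry.choose_spec i

theorem isom_one : h.isom (toL2 η 1) = Ω := by
  have := h.isom_e 1
  rwa [_root_.map_one e, _root_.map_one W] at this

theorem eq_zero_of_bound {V : Type*} [NormedAddCommGroup V] [NormedSpace ℂ V] [CompleteSpace V]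
    (Φ : BddMeas Z →ₗ[ℂ] V) (C : ℝ) (hC : ∀ F, ‖Φ F‖ ≤ C * ‖toL2 η F‖)
    (h0 : ∀ i, Φ (e i) = 0) (F : BddMeas Z) : Φ F = 0 :=
  eq_zero_of_norm_le_toL2 h.total Φ C hC h0 F

theorem W_isom (i : I) (ξ : Lp ℂ 2 η) : W i (h.isom ξ) = h.isom (mulOp η (e i) ξ) := by
  have : (W i).comp h.isom.toContinuousLinearMap =
      h.isom.toContinuousLinearMap.comp (mulOp η (e i)) := by
    refine ContinuousLinearMap.ext_on h.total ?_
    rintro _ ⟨j, rfl⟩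
    change W i (h.isom (toL2 η (e j))) = h.isom (mulOp η (e i) (toL2 η (e j)))
    rw [mulOp_toL2, ← map_mul, isom_e, isom_e, map_mul]
    rfl
  exact congr($this ξ)

/-- Between bounded functions, the matrix coefficients of the commutator of `T` with multiplication
by `F` are linear in `F` and bounded by its `L²` norm. They vanish on the total family `e`, hence
for all `F`. -/
theorem commute_mulOp (T : Lp ℂ 2 η →L[ℂ] Lp ℂ 2 η)
    (hT : ∀ i ξ, T (mulOp η (e i) ξ) = mulOp η (e i) (T ξ)) (F : BddMeas Z) (ξ : Lp ℂ 2 η) :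
    T (mulOp η F ξ) = mulOp η F (T ξ) := by
  have key : ∀ F G₁ G₂ : BddMeas Z, inner ℂ (toL2 η G₁) (T (mulOp η F (toL2 η G₂))) =
      inner ℂ (toL2 η G₁) (mulOp η F (T (toL2 η G₂))) := by
    intro F G₁ G₂
    let Φ : BddMeas Z →ₗ[ℂ] ℂ :=
      { toFun := fun F => inner ℂ (toL2 η G₁) (T (toL2 η (G₂ * F))) -
          inner ℂ (toL2 η (star F * G₁)) (T (toL2 η G₂))
        map_add' := fun F F' => by
          simp only [mul_add, add_mul, star_add, map_add, inner_add_left, inner_add_right]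
          ring
        map_smul' := fun c F => by
          simp only [mul_smul_comm, smul_mul_assoc, star_smul, map_smul, inner_smul_left,
            inner_smul_right, RingHom.id_apply, smul_eq_mul, RCLike.star_def, Complex.conj_conj]
          ring }
    have hΦ : Φ F = 0 := by
      refine h.eq_zero_of_bound Φ
        (‖toL2 η G₁‖ * (‖T‖ * ‖mulOp η G₂‖) + ‖mulOp η G₁‖ * ‖T (toL2 η G₂)‖) (fun F => ?_)
        (fun i => ?_) F
      · refine (norm_sub_le _ _).trans ?_
        rw [add_mul]
        refine add_le_add ?_ ?_
        · refine (norm_inner_le_norm _ _).trans ?_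
          rw [← mulOp_toL2, mul_assoc, mul_assoc]
          gcongr
          refine (T.le_opNorm _).trans ?_
          gcongr
          exact (mulOp η G₂).le_opNorm _
        · refine (norm_inner_le_norm _ _).trans ?_
          rw [mul_comm (star F), ← mulOp_toL2, mul_right_comm]
          gcongr
          refine ((mulOp η G₁).le_opNorm _).trans ?_
          rw [norm_toL2_star]
      · change inner ℂ (toL2 η G₁) (T (toL2 η (G₂ * e i))) -
          inner ℂ (toL2 η (star (e i) * G₁)) (T (toL2 η G₂)) = 0
        rw [mul_comm G₂, ← mulOp_toL2, ← mulOp_toL2, hT, inner_mulOp_right, sub_self]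
    have h2 := sub_eq_zero.1 hΦ
    rw [mulOp_toL2, inner_mulOp_right, mulOp_toL2, mul_comm F G₂]
    exact h2
  have key2 : ∀ F G : BddMeas Z, T (mulOp η F (toL2 η G)) = mulOp η F (T (toL2 η G)) := by
    intro F G
    refine ext_of_dense_inner (denseRange_toL2 η) ?_
    rintro _ ⟨G₁, rfl⟩
    exact key F G₁ G
  refine (denseRange_toL2 η).induction_on (p := fun ξ => T (mulOp η F ξ) = mulOp η F (T ξ)) ξ
    (isClosed_eq (T.continuous.comp (mulOp η F).continuous)
      ((mulOp η F).continuous.comp T.continuous)) (key2 F)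

/-- With `B` the composition of `y` and the isometry, `B*B` commutes with multiplication by the `e
i`, hence with all bounded functions, and `‖B G‖²` depends linearly on `|G|²`. Completing `|F|²` to
the constant `C²` by a second square bounds `‖B F‖²` by `C² ‖B 1‖² = C² ‖yΩ‖²`. This is the estimate
by which a bounded function defines a bounded operator on `H`. -/
theorem norm_apply_isom_le {y : H →L[ℂ] H} (hy : y ∈ A.commutant) (F : BddMeas Z) {C : ℝ}
    (hC : ∀ z, ‖F.1 z‖ ≤ C) (hC0 : 0 ≤ C) : ‖y (h.isom (toL2 η F))‖ ≤ C * ‖y Ω‖ := by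
  rw [VonNeumannAlgebra.mem_commutant_iff] at hy
  let B : Lp ℂ 2 η →L[ℂ] H := y.comp h.isom.toContinuousLinearMap
  have hB : ∀ i ξ, B (mulOp η (e i) ξ) = W i (B ξ) := by
    intro i ξ
    change y (h.isom (mulOp η (e i) ξ)) = W i (y (h.isom ξ))
    rw [← h.W_isom]
    exact congr($(hy _ (h.mem i)) (h.isom ξ)).symm
  have hBs : ∀ i ζ, (ContinuousLinearMap.adjoint B) (W i ζ) =
      mulOp η (e i) (ContinuousLinearMap.adjoint B ζ) := by
    intro i ζ
    refine ext_inner_left ℂ fun ξ => ?_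
    rw [ContinuousLinearMap.adjoint_inner_right, inner_mulOp_right,
      ContinuousLinearMap.adjoint_inner_right, ← h.star_e, hB, h.star_W,
      ContinuousLinearMap.star_eq_adjoint, ContinuousLinearMap.adjoint_inner_left]
  let T := (ContinuousLinearMap.adjoint B).comp B
  have hT := h.commute_mulOp T fun i ξ => by
    change ContinuousLinearMap.adjoint B (B (mulOp η (e i) ξ)) = _
    rw [hB, hBs]
    rfl
  have hsq : ∀ G : BddMeas Z, inner ℂ (toL2 η 1) (T (toL2 η (star G * G))) =
      ((‖B (toL2 η G)‖ ^ 2 : ℝ) : ℂ) := by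
    intro G
    rw [← mulOp_toL2, hT, inner_mulOp_right, star_star, mulOp_toL2, mul_one]
    change inner ℂ _ (ContinuousLinearMap.adjoint B (B _)) = _
    rw [ContinuousLinearMap.adjoint_inner_right, inner_self_eq_norm_sq_to_K]
    push_cast
    rfl
  -- Chosen so that `|F|² + |g|² = C²` at every point.
  let g : BddMeas Z := ⟨fun z => (Real.sqrt (C ^ 2 - ‖F.1 z‖ ^ 2) : ℂ),
    Complex.measurable_ofReal.comp ((measurable_const.sub (F.2.1.norm.pow_const 2)).sqrt), C,
    fun z => by
      rw [Complex.norm_real, Real.norm_of_nonneg (Real.sqrt_nonneg _)]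
      refine Real.sqrt_le_iff.2 ⟨hC0, ?_⟩
      nlinarith [sq_nonneg ‖F.1 z‖]⟩
  have hsum : star F * F + star g * g = ((C ^ 2 : ℝ) : ℂ) • (1 : BddMeas Z) := by
    refine Subtype.ext (funext fun z => ?_)
    change conj (F.1 z) * F.1 z +
      conj ((Real.sqrt (C ^ 2 - ‖F.1 z‖ ^ 2) : ℝ) : ℂ) *
        ((Real.sqrt (C ^ 2 - ‖F.1 z‖ ^ 2) : ℝ) : ℂ) = ((C ^ 2 : ℝ) : ℂ) * 1
    rw [Complex.conj_ofReal, ← Complex.ofReal_mul, Real.mul_self_sqrt, RCLike.conj_mul]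
    · push_cast
      simp
    · have := hC z
      have := norm_nonneg (F.1 z)
      nlinarith
  have hone : star (1 : BddMeas Z) * 1 = 1 := by rw [star_one, one_mul]
  have hreal : ‖B (toL2 η F)‖ ^ 2 + ‖B (toL2 η g)‖ ^ 2 = C ^ 2 * ‖B (toL2 η 1)‖ ^ 2 := by
    have h3 : ((‖B (toL2 η F)‖ ^ 2 : ℝ) : ℂ) + ((‖B (toL2 η g)‖ ^ 2 : ℝ) : ℂ) =
        ((C ^ 2 : ℝ) : ℂ) * ((‖B (toL2 η 1)‖ ^ 2 : ℝ) : ℂ) := by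
      rw [← hsq, ← hsq, ← hsq, ← inner_add_right, ← map_add, ← map_add, hsum, hone, map_smul,
        map_smul, inner_smul_right]
    exact_mod_cast h3
  have h1 : B (toL2 η 1) = y Ω := by
    change y (h.isom (toL2 η 1)) = _
    rw [h.isom_one]
  rw [h1] at hreal
  have hfin : ‖B (toL2 η F)‖ ^ 2 ≤ (C * ‖y Ω‖) ^ 2 := by
    nlinarith [sq_nonneg ‖B (toL2 η g)‖]
  exact (pow_le_pow_iff_left₀ (norm_nonneg _) (by positivity) two_ne_zero).1 hfin

/-- Evaluation of the commutant at a vector. -/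
def evalCommutant (_ : IsAbelianModel A Ω η e W) (ξ : H) :
    A.commutant.toStarSubalgebra →ₗ[ℂ] H where
  toFun y := (y : H →L[ℂ] H) ξ
  map_add' _ _ := rfl
  map_smul' _ _ := rfl

theorem denseRange_evalCommutant : DenseRange (h.evalCommutant Ω) := by
  refine h.cyclic.mono ?_
  rintro _ ⟨y, hy, rfl⟩
  exact ⟨⟨y, hy⟩, rfl⟩

/-- The operator in `A` that represents a bounded function. -/
def op (F : BddMeas Z) : H →L[ℂ] H :=
  (h.evalCommutant (h.isom (toL2 η F))).extendOfNorm (h.evalCommutant Ω)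

theorem op_apply (F : BddMeas Z) {y : H →L[ℂ] H} (hy : y ∈ A.commutant) :
    h.op F (y Ω) = y (h.isom (toL2 η F)) := by
  refine LinearMap.extendOfNorm_eq (f := h.evalCommutant (h.isom (toL2 η F)))
    -- The maximum with `0` is needed only when `Z` is empty, where the chosen bound could be
    -- negative.
    h.denseRange_evalCommutant ⟨max F.2.2.choose 0, fun y => ?_⟩ ⟨y, hy⟩
  exact h.norm_apply_isom_le y.2 F
    (fun z => (F.2.2.choose_spec z).trans (le_max_left _ _)) (le_max_right _ _)

theorem eq_of_commutant {S T : H →L[ℂ] H} (hST : ∀ y ∈ A.commutant, S (y Ω) = T (y Ω)) :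
    S = T := by
  ext ξ
  refine h.denseRange_evalCommutant.induction_on (p := fun ξ => S ξ = T ξ) ξ
    (isClosed_eq S.continuous T.continuous) fun y => hST _ y.2

/-- A vector that is cyclic for the commutant is separating for the algebra. -/
theorem eq_of_apply {S T : H →L[ℂ] H} (hS : S ∈ A) (hT : T ∈ A) (hST : S Ω = T Ω) : S = T := by
  refine h.eq_of_commutant fun y hy => ?_
  rw [VonNeumannAlgebra.mem_commutant_iff] at hy
  have h1 : S (y Ω) = y (S Ω) := congr($(hy S hS) Ω)
  have h2 : T (y Ω) = y (T Ω) := congr($(hy T hT) Ω)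
  rw [h1, h2, hST]

/-- On the dense set of vectors `y' Ω` the operator is defined by applying `y'` to a fixed vector,
which is compatible with left multiplication by the commutant; the double commutant theorem does the
rest. -/
theorem op_mem (F : BddMeas Z) : h.op F ∈ A := by
  have hA : h.op F ∈ A.commutant.commutant ↔ h.op F ∈ A := by rw [A.commutant_commutant]
  rw [← hA, VonNeumannAlgebra.mem_commutant_iff]
  intro y hy
  refine h.eq_of_commutant fun y' hy' => ?_
  change y (h.op F (y' Ω)) = h.op F ((y * y') Ω)
  rw [h.op_apply F hy', h.op_apply F (mul_mem hy hy')]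
  rfl

theorem op_vec (F : BddMeas Z) : h.op F Ω = h.isom (toL2 η F) :=
  h.op_apply F (one_mem _)

theorem op_e (i : I) : h.op (e i) = W i :=
  h.eq_of_apply (h.op_mem _) (h.mem i) (by rw [h.op_vec, h.isom_e])

theorem op_isom (F : BddMeas Z) (ξ : Lp ℂ 2 η) : h.op F (h.isom ξ) = h.isom (mulOp η F ξ) := by
  have : (h.op F).comp h.isom.toContinuousLinearMap =
      h.isom.toContinuousLinearMap.comp (mulOp η F) := by
    refine ContinuousLinearMap.ext_on h.total ?_
    rintro _ ⟨i, rfl⟩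
    change h.op F (h.isom (toL2 η (e i))) = h.isom (mulOp η F (toL2 η (e i)))
    rw [mulOp_toL2, mul_comm, ← mulOp_toL2, ← h.W_isom, h.isom_e, ← h.op_vec]
    exact congr($(h.comm _ (h.op_mem F) _ (h.mem i)) Ω)
  exact congr($this ξ)

/-- Paired with `yΩ` for `y` in the commutant, both sides become linear functionals of `F` that are
bounded in the `L²` norm, so that it suffices to treat `e i`, where the claim is `W i⁻¹ = (W i)*`.
-/
theorem op_star (F : BddMeas Z) : h.op (star F) = star (h.op F) := by
  refine h.eq_of_apply (h.op_mem _) (star_mem (h.op_mem _)) ?_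
  refine ext_of_dense_inner h.denseRange_evalCommutant ?_
  rintro _ ⟨⟨y, hy : y ∈ A.commutant⟩, rfl⟩
  refine (starRingEnd ℂ).injective ?_
  rw [inner_conj_symm, inner_conj_symm]
  change inner ℂ (h.op (star F) Ω) (y Ω) = inner ℂ ((star (h.op F)) Ω) (y Ω)
  rw [ContinuousLinearMap.star_eq_adjoint, ContinuousLinearMap.adjoint_inner_left, h.op_apply F hy,
    h.op_vec]
  let Φ : BddMeas Z →ₗ[ℂ] ℂ :=
    { toFun := fun F => inner ℂ (h.isom (toL2 η (star F))) (y Ω) -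
          inner ℂ Ω (y (h.isom (toL2 η F)))
      map_add' := fun F F' => by
        simp only [star_add, map_add, inner_add_left, inner_add_right]
        ring
      map_smul' := fun c F => by
        simp only [star_smul, map_smul, inner_smul_left,
          inner_smul_right, RingHom.id_apply, smul_eq_mul, RCLike.star_def, Complex.conj_conj]
        ring }
  refine sub_eq_zero.1 (h.eq_zero_of_bound Φ (‖y Ω‖ + ‖Ω‖ * ‖y‖) (fun F => ?_) (fun i => ?_) F)
  · refine (norm_sub_le _ _).trans ?_
    rw [add_mul]
    refine add_le_add ?_ ?_
    · refine (norm_inner_le_norm _ _).trans ?_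
      rw [LinearIsometry.norm_map, norm_toL2_star, mul_comm]
    · refine (norm_inner_le_norm _ _).trans ?_
      rw [mul_assoc]
      gcongr
      refine (y.le_opNorm _).trans ?_
      rw [LinearIsometry.norm_map]
  · change inner ℂ (h.isom (toL2 η (star (e i)))) (y Ω) - inner ℂ Ω (y (h.isom (toL2 η (e i)))) = 0
    rw [VonNeumannAlgebra.mem_commutant_iff] at hy
    have h1 : y (W i Ω) = W i (y Ω) := congr($(hy _ (h.mem i)) Ω).symm
    rw [← h.star_e, h.isom_e, h.isom_e, h1, h.star_W, ContinuousLinearMap.star_eq_adjoint,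
      ContinuousLinearMap.adjoint_inner_left, sub_self]

/-- The `*`-homomorphism from bounded functions to `A`. -/
def repr : BddMeas Z →⋆ₐ[ℂ] (H →L[ℂ] H) where
  toFun := h.op
  map_one' := by
    rw [← map_one e, h.op_e, map_one]
  map_mul' F G := by
    refine h.eq_of_apply (h.op_mem _) (mul_mem (h.op_mem _) (h.op_mem _)) ?_
    change _ = h.op F (h.op G Ω)
    rw [h.op_vec, h.op_vec, h.op_isom, mulOp_toL2]
  map_zero' := by
    refine h.eq_of_apply (h.op_mem _) (zero_mem _) ?_
    rw [h.op_vec, map_zero, map_zero]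
    rfl
  map_add' F G := by
    refine h.eq_of_apply (h.op_mem _) (add_mem (h.op_mem _) (h.op_mem _)) ?_
    rw [add_apply, h.op_vec, h.op_vec, h.op_vec, map_add, map_add]
  commutes' c := by
    refine h.eq_of_apply (h.op_mem _) (algebraMap_mem A.toStarSubalgebra c) ?_
    rw [h.op_vec, Algebra.algebraMap_eq_smul_one, Algebra.algebraMap_eq_smul_one, map_smul,
      map_smul, h.isom_one]
    rfl
  map_star' := h.op_star

theorem repr_mem (F : BddMeas Z) : h.repr F ∈ A := h.op_mem F

theorem repr_e (i : I) : h.repr (e i) = W i := h.op_e i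

theorem repr_vec (F : BddMeas Z) : h.repr F Ω = h.isom (toL2 η F) := h.op_vec F

theorem repr_eq_zero_iff (F : BddMeas Z) : h.repr F = 0 ↔ F.1 =ᵐ[η] 0 := by
  rw [show (F.1 =ᵐ[η] 0) ↔ toL2 η F = toL2 η 0 from (toL2_eq_iff η (f := F) (g := 0)).symm]
  constructor
  · intro h0
    refine h.isom.injective ?_
    rw [← h.repr_vec, h0, map_zero, map_zero]
    rfl
  · intro h0
    refine h.eq_of_apply (h.op_mem F) (zero_mem _) ?_
    change h.op F Ω = _
    rw [h.op_vec, h0, map_zero, map_zero]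
    rfl

theorem inner_repr (F : BddMeas Z) : inner ℂ Ω (h.repr F Ω) = ∫ z, F.1 z ∂η := by
  have h1 : inner ℂ Ω (h.repr F Ω) = inner ℂ (h.isom (toL2 η 1)) (h.isom (toL2 η F)) := by
    rw [h.repr_vec, h.isom_one]
  rw [h1, LinearIsometry.inner_map_map, inner_toL2_toL2, star_one, one_mul]

/-- The vector `xΩ` comes from some `ξ ∈ L²`. As `x` commutes with `A`, multiplying `ξ` by `G` has
norm `‖x (op G) Ω‖ ≤ ‖x‖ ‖G‖₂`, so `ξ` is essentially bounded by `‖x‖` and represents an element of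
`A`. -/
theorem exists_repr_vec_eq {x : H →L[ℂ] H} (hx : ∀ a ∈ A, a * x = x * a)
    (hxΩ : x Ω ∈ closure (Submodule.span ℂ (Set.range fun i => W i Ω) : Set H)) :
    ∃ F, h.repr F Ω = x Ω := by
  have hcl : closure (Submodule.span ℂ (Set.range fun i => W i Ω) : Set H) ⊆
      Set.range h.isom := by
    refine closure_minimal ?_ h.isom.isometry.isClosedEmbedding.isClosed_range
    have : Submodule.span ℂ (Set.range fun i => W i Ω) ≤ LinearMap.range h.isom.toLinearMap := by
      rw [Submodule.span_le]
      rintro _ ⟨i, rfl⟩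
      exact ⟨_, h.isom_e i⟩
    exact this
  obtain ⟨ξ, hξ⟩ := hcl hxΩ
  have hb : ∀ᵐ z ∂η, ‖ξ z‖ ≤ ‖x‖ := by
    refine ae_norm_le_of_mulOp_le η ξ (norm_nonneg _) fun G => ?_
    rw [← h.isom.norm_map, ← h.op_isom, hξ]
    have : h.op G (x Ω) = x (h.op G Ω) := congr($(hx _ (h.op_mem G)) Ω)
    rw [this, h.op_vec]
    refine (x.le_opNorm _).trans ?_
    rw [LinearIsometry.norm_map]
  have hm : Measurable ξ := (Lp.stronglyMeasurable ξ).measurable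
  have hs : MeasurableSet {z | ‖ξ z‖ ≤ ‖x‖} := measurableSet_le hm.norm measurable_const
  -- Cutting `ξ` off on a null set makes the bound hold everywhere.
  let F : BddMeas Z := ⟨{z | ‖ξ z‖ ≤ ‖x‖}.indicator ξ, hm.indicator hs, ‖x‖, fun z => by
    by_cases hz : z ∈ {z | ‖ξ z‖ ≤ ‖x‖}
    · rw [Set.indicator_of_mem hz]; exact hz
    · rw [Set.indicator_of_notMem hz, norm_zero]; exact norm_nonneg _⟩
  refine ⟨F, ?_⟩
  rw [h.repr_vec, ← hξ]
  congr 1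
  refine Lp.ext ((coeFn_toL2 η F).trans ?_)
  filter_upwards [hb] with z hz
  exact Set.indicator_of_mem (s := {z | ‖ξ z‖ ≤ ‖x‖}) hz _

end IsAbelianModel

end Model

/-! ### Strong limits of partial isometries; tracial vectors -/

section StrongLimits

variable {H : Type*} [NormedAddCommGroup H] [InnerProductSpace ℂ H] [CompleteSpace H]

open Filter Topology

theorem mem_of_tendsto_apply (M : VonNeumannAlgebra H) {u : ℕ → H →L[ℂ] H} (hu : ∀ n, u n ∈ M)
    {U : H →L[ℂ] H} (h : ∀ ξ, Tendsto (fun n => u n ξ) atTop (𝓝 (U ξ))) : U ∈ M := by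
  have hM : U ∈ M.commutant.commutant ↔ U ∈ M := by rw [M.commutant_commutant]
  rw [← hM, VonNeumannAlgebra.mem_commutant_iff]
  intro y hy
  rw [VonNeumannAlgebra.mem_commutant_iff] at hy
  ext ξ
  change y (U ξ) = U (y ξ)
  refine tendsto_nhds_unique ((y.continuous.tendsto _).comp (h ξ)) ?_
  refine (h (y ξ)).congr fun n => ?_
  exact congr($(hy _ (hu n)) ξ)

/-- The compatibility of the `u n` gives `‖u n ξ - u m ξ‖² = ⟨ξ, (u n)* u n ξ - (u m)* u m ξ⟩` for
`m ≤ n`, so strong convergence of `(u n)* u n` makes `u n ξ` a Cauchy sequence. -/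
theorem exists_isometric_limit (u : ℕ → H →L[ℂ] H)
    (h1 : ∀ m n, m ≤ n → star (u n) * u m = star (u m) * u m)
    (hP : ∀ ξ, Tendsto (fun n => (star (u n) * u n) ξ) atTop (𝓝 ξ)) :
    ∃ U : H →L[ℂ] H, star U * U = 1 ∧ ∀ ξ, Tendsto (fun n => u n ξ) atTop (𝓝 (U ξ)) := by
  have h2 : ∀ m n, m ≤ n → star (u m) * u n = star (u m) * u m := by
    intro m n hmn
    have := congrArg star (h1 m n hmn)
    simpa only [star_mul, star_star] using this
  have hn : ∀ n ξ, ‖u n ξ‖ ^ 2 = RCLike.re (inner ℂ ξ ((star (u n) * u n) ξ)) := by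
    intro n ξ
    change _ = RCLike.re (inner ℂ ξ (star (u n) (u n ξ)))
    rw [ContinuousLinearMap.star_eq_adjoint, ContinuousLinearMap.adjoint_inner_right,
      inner_self_eq_norm_sq]
  have hdiff : ∀ m n, m ≤ n → ∀ ξ, ‖u n ξ - u m ξ‖ ^ 2 =
      RCLike.re (inner ℂ ξ ((star (u n) * u n) ξ - (star (u m) * u m) ξ)) := by
    intro m n hmn ξ
    have e : star (u n - u m) * (u n - u m) = star (u n) * u n - star (u m) * u m := by
      rw [star_sub, sub_mul, mul_sub, mul_sub, h1 m n hmn, h2 m n hmn]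
      abel
    have : inner ℂ ξ ((star (u n) * u n) ξ - (star (u m) * u m) ξ) =
        inner ℂ ξ ((star (u n - u m)) ((u n - u m) ξ)) :=
      congrArg (fun T : H →L[ℂ] H => inner ℂ ξ (T ξ)) e.symm
    rw [this, ContinuousLinearMap.star_eq_adjoint, ContinuousLinearMap.adjoint_inner_right,
      inner_self_eq_norm_sq]
    rfl
  have hlim : ∀ ξ, ∃ ζ, Tendsto (fun n => u n ξ) atTop (𝓝 ζ) := by
    intro ξ
    refine cauchySeq_tendsto_of_complete ?_
    have hc := (hP ξ).cauchySeq
    rw [Metric.cauchySeq_iff'] at hc ⊢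
    intro ε hε
    obtain ⟨N, hN⟩ := hc (ε ^ 2 / (‖ξ‖ + 1)) (by positivity)
    refine ⟨N, fun n hn' => ?_⟩
    have h3 := hN n hn'
    rw [dist_eq_norm] at h3 ⊢
    have h4 : ‖u n ξ - u N ξ‖ ^ 2 < ε ^ 2 := by
      rw [hdiff N n hn']
      refine ((RCLike.re_le_norm _).trans (norm_inner_le_norm _ _)).trans_lt ?_
      calc ‖ξ‖ * ‖(star (u n) * u n) ξ - (star (u N) * u N) ξ‖
          ≤ (‖ξ‖ + 1) * ‖(star (u n) * u n) ξ - (star (u N) * u N) ξ‖ := by gcongr; simp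
        _ < (‖ξ‖ + 1) * (ε ^ 2 / (‖ξ‖ + 1)) := by gcongr
        _ = ε ^ 2 := by field_simp
    exact lt_of_pow_lt_pow_left₀ 2 hε.le h4
  choose f hf using hlim
  let U : H →L[ℂ] H := continuousLinearMapOfTendsto u (f := f) (tendsto_pi_nhds.2 hf)
  have hU : ∀ ξ, Tendsto (fun n => u n ξ) atTop (𝓝 (U ξ)) := hf
  refine ⟨U, ?_, hU⟩
  rw [ContinuousLinearMap.star_eq_adjoint]
  refine (ContinuousLinearMap.norm_map_iff_adjoint_comp_self U).1 fun ξ => ?_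
  have h5 : ‖U ξ‖ ^ 2 = ‖ξ‖ ^ 2 := by
    refine tendsto_nhds_unique (((hU ξ).norm).pow 2) ?_
    simp only [hn]
    rw [← inner_self_eq_norm_sq (𝕜 := ℂ) ξ]
    exact (RCLike.continuous_re.tendsto _).comp (tendsto_const_nhds.inner (hP ξ))
  exact (sq_eq_sq₀ (norm_nonneg _) (norm_nonneg _)).1 h5

/-- The sequence and the sequence of its adjoints both have isometric limits, and these limits are
adjoint to each other. -/
theorem exists_unitary_limit (u : ℕ → H →L[ℂ] H)
    (h1 : ∀ m n, m ≤ n → star (u n) * u m = star (u m) * u m)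
    (h2 : ∀ m n, m ≤ n → u n * star (u m) = u m * star (u m))
    (hP : ∀ ξ, Tendsto (fun n => (star (u n) * u n) ξ) atTop (𝓝 ξ))
    (hQ : ∀ ξ, Tendsto (fun n => (u n * star (u n)) ξ) atTop (𝓝 ξ)) :
    ∃ U ∈ unitary (H →L[ℂ] H), ∀ ξ, Tendsto (fun n => u n ξ) atTop (𝓝 (U ξ)) := by
  obtain ⟨U, hU, hUt⟩ := exists_isometric_limit u h1 hP
  obtain ⟨V, hV, hVt⟩ := exists_isometric_limit (fun n => star (u n))
    (by simpa only [star_star] using h2) (by simpa only [star_star] using hQ)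
  have hVU : V = star U := by
    rw [ContinuousLinearMap.star_eq_adjoint, ContinuousLinearMap.eq_adjoint_iff]
    intro ξ ζ
    refine tendsto_nhds_unique ((hVt ξ).inner tendsto_const_nhds) ?_
    refine (tendsto_const_nhds.inner (hUt ζ)).congr fun n => ?_
    rw [ContinuousLinearMap.star_eq_adjoint, ContinuousLinearMap.adjoint_inner_left]
  rw [hVU, star_star] at hV
  exact ⟨U, Unitary.mem_iff.2 ⟨hU, hV⟩, hUt⟩

/-- A separating vector of a von Neumann algebra whose vector state is a trace. -/
structure IsTracialVector (M : VonNeumannAlgebra H) (Ω : H) : Prop where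
  separating : ∀ x ∈ M, x Ω = 0 → x = 0
  tracial : ∀ x ∈ M, ∀ y ∈ M, inner ℂ Ω (x (y Ω)) = inner ℂ Ω (y (x Ω))

theorem IsTracialVector.eq_of_apply {M : VonNeumannAlgebra H} {Ω : H} (h : IsTracialVector M Ω)
    {x y : H →L[ℂ] H} (hx : x ∈ M) (hy : y ∈ M) (hxy : x Ω = y Ω) : x = y := by
  refine sub_eq_zero.1 (h.separating _ (sub_mem hx hy) ?_)
  rw [sub_apply, hxy, sub_self]

theorem norm_star_unitary_apply {w : H →L[ℂ] H} (hw : w ∈ unitary (H →L[ℂ] H)) (ξ : H) :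
    ‖star w ξ‖ = ‖ξ‖ := by
  refine (ContinuousLinearMap.norm_map_iff_adjoint_comp_self (star w)).2 ?_ ξ
  rw [← ContinuousLinearMap.star_eq_adjoint, star_star]
  exact (Unitary.mem_iff.1 hw).2

end StrongLimits

/-! ### Gluing countably many maps into an automorphism -/

section Gluing

/-- At each point the first admissible index of an enumeration is used; outside the union of the `S
j` every index is admissible. The glued map thus agrees with one of the `f j` at every point, not
only almost everywhere, and so follows orbits exactly. -/
theorem exists_measurable_glue {Z Y J : Type*} [MeasurableSpace Z] [MeasurableSpace Y] [Countable J]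
    [Nonempty J] (S : J → Set Z) (hS : ∀ j, MeasurableSet (S j)) (f : J → Z → Y)
    (hf : ∀ j, Measurable (f j)) :
    ∃ ψ : Z → Y, Measurable ψ ∧ ∀ z, ∃ j, ψ z = f j z ∧ (z ∈ ⋃ j, S j → z ∈ S j) := by
  classical
  obtain ⟨e, he⟩ := exists_surjective_nat J
  have h : ∀ z, ∃ n, z ∈ S (e n) ∪ (⋃ j, S j)ᶜ := by
    intro z
    by_cases hz : z ∈ ⋃ j, S j
    · obtain ⟨j, hj⟩ := mem_iUnion.1 hz
      obtain ⟨n, rfl⟩ := he j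
      exact ⟨n, Or.inl hj⟩
    · exact ⟨0, Or.inr hz⟩
  refine ⟨fun z => f (e (Nat.find (h z))) z,
    Measurable.find (f := fun n => f (e n)) (p := fun n z => z ∈ S (e n) ∪ (⋃ j, S j)ᶜ)
      (fun n => hf _) (fun n => (hS _).union (MeasurableSet.iUnion hS).compl) h,
    fun z => ⟨e (Nat.find (h z)), rfl, fun hz => ?_⟩⟩
  rcases Nat.find_spec (h z) with h' | h'
  · exact h'
  · exact absurd hz h'

/-- Applied to the indicators of a countable separating family, the hypothesis says that `τ z` and
`z` lie in the same sets of that family for almost every `z`. -/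
theorem ae_eq_id_of_comp {Z : Type*} [MeasurableSpace Z] [MeasurableSpace.CountablySeparated Z]
    (η : Measure Z) {τ : Z → Z} (hτ : Measurable τ)
    (h : ∀ F : BddMeas Z, (compMap F τ hτ).1 =ᵐ[η] F.1) : ∀ᵐ z ∂η, τ z = z := by
  refine Filter.EventuallyEq.of_forall_separating_mem_iff (g := id) MeasurableSet ?_
  intro s hs
  filter_upwards [h (indFun s hs)] with z hz
  change s.indicator (fun _ => (1 : ℂ)) (τ z) = s.indicator (fun _ => (1 : ℂ)) z at hz
  by_cases h1 : τ z ∈ s <;> by_cases h2 : z ∈ s <;> simp_all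

/-- Two maps along the orbits of a countable group that are inverse to each other almost everywhere
agree almost everywhere with an automorphism along the orbits and with its inverse. -/
theorem exists_measurableEquiv_of_ae_inverse {Z P : Type*} [MeasurableSpace Z] [MeasurableEq Z]
    [Group P] [Countable P] [MulAction P Z] [MeasurableConstSMul P Z] (η : Measure Z)
    [SMulInvariantMeasure P Z η] {ψ ψ' : Z → Z} (hψ : Measurable ψ) (hψ' : Measurable ψ')
    (ho : ∀ z, ∃ g : P, ψ z = g • z) (ho' : ∀ z, ∃ g : P, ψ' z = g • z)
    (h1 : ∀ᵐ z ∂η, ψ (ψ' z) = z) (h2 : ∀ᵐ z ∂η, ψ' (ψ z) = z) :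
    ∃ φ : Z ≃ᵐ Z, (∀ z, ∃ g : P, φ z = g • z) ∧ (∀ᵐ z ∂η, φ z = ψ' z) ∧
      ∀ᵐ z ∂η, φ.symm z = ψ z := by
  classical
  let N₀ : Set Z := {z | ψ (ψ' z) = z ∧ ψ' (ψ z) = z}ᶜ
  have hN₀ : MeasurableSet N₀ :=
    ((measurableSet_eq_fun (hψ.comp hψ') measurable_id).inter
      (measurableSet_eq_fun (hψ'.comp hψ) measurable_id)).compl
  have hN₀0 : η N₀ = 0 := by
    have : ∀ᵐ z ∂η, ψ (ψ' z) = z ∧ ψ' (ψ z) = z := h1.and h2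
    exact this
  -- The saturation of the exceptional set is still null, as `P` is countable and preserves `η`.
  -- Both maps move along orbits and so preserve its complement, where they are mutually inverse; on
  -- `N` the automorphism is the identity.
  let N : Set Z := ⋃ g : P, (fun z => g • z) ⁻¹' N₀
  have hN : MeasurableSet N := MeasurableSet.iUnion fun g => measurable_const_smul g hN₀
  have hN0 : η N = 0 := measure_iUnion_null fun g => by
    rw [(measurePreserving_smul g η).measure_preimage hN₀.nullMeasurableSet, hN₀0]
  have hNinv : ∀ (g : P) z, z ∈ N → g • z ∈ N := by
    intro g z hz
    obtain ⟨g', hg'⟩ := mem_iUnion.1 hz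
    refine mem_iUnion.2 ⟨g' * g⁻¹, ?_⟩
    change (g' * g⁻¹) • g • z ∈ N₀
    rwa [smul_smul, inv_mul_cancel_right]
  have hNinv' : ∀ (g : P) z, g • z ∈ N → z ∈ N := fun g z hz => by
    have := hNinv g⁻¹ _ hz
    rwa [inv_smul_smul] at this
  have hgood : ∀ z, z ∉ N → ψ (ψ' z) = z ∧ ψ' (ψ z) = z := by
    intro z hz
    by_contra hcon
    refine hz (mem_iUnion.2 ⟨1, ?_⟩)
    change (1 : P) • z ∈ N₀
    rwa [one_smul]
  have hψN : ∀ z, z ∉ N → ψ z ∉ N := fun z hz h => by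
    obtain ⟨g, hg⟩ := ho z
    rw [hg] at h
    exact hz (hNinv' g z h)
  have hψN' : ∀ z, z ∉ N → ψ' z ∉ N := fun z hz h => by
    obtain ⟨g, hg⟩ := ho' z
    rw [hg] at h
    exact hz (hNinv' g z h)
  let φ : Z ≃ᵐ Z :=
    { toFun := fun z => if z ∈ N then z else ψ' z
      invFun := fun z => if z ∈ N then z else ψ z
      left_inv := fun z => by
        by_cases hz : z ∈ N
        · simp [hz]
        · simp [hz, hψN' z hz, (hgood z hz).1]
      right_inv := fun z => by
        by_cases hz : z ∈ N
        · simp [hz]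
        · simp [hz, hψN z hz, (hgood z hz).2]
      measurable_toFun := Measurable.ite hN measurable_id hψ'
      measurable_invFun := Measurable.ite hN measurable_id hψ }
  have hae : ∀ᵐ z ∂η, z ∉ N := by
    rw [ae_iff]
    simpa using hN0
  refine ⟨φ, fun z => ?_, ?_, ?_⟩
  · by_cases hz : z ∈ N
    · exact ⟨1, by rw [one_smul]; exact if_pos hz⟩
    · obtain ⟨g, hg⟩ := ho' z
      exact ⟨g, by rw [← hg]; exact if_neg hz⟩
  · filter_upwards [hae] with z hz
    exact if_neg hz
  · filter_upwards [hae] with z hz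
    exact if_neg hz

end Gluing

/-! ### Expectation onto `L^∞(Z)` at the level of vectors -/

section InducedRelation

variable {H : Type*} [NormedAddCommGroup H] [InnerProductSpace ℂ H] [CompleteSpace H]
  {Z : Type*} [MeasurableSpace Z]

/-- A total family of unitaries `W` of `M` that normalize `A ≅ L^∞(Z, η)` and implement the action
of a countable group `P` on `Z`. -/
structure IsImplementing (A M : VonNeumannAlgebra H) (Ω : H) (η : Measure Z)
    (θ : BddMeas Z →⋆ₐ[ℂ] (H →L[ℂ] H)) (P : Type*) [Group P] [MulAction P Z]
    [MeasurableConstSMul P Z] {J : Type*} (W : J → H →L[ℂ] H) (p : J → P) : Prop where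
  tracial : IsTracialVector M Ω
  le : A ≤ M
  iso : IsLinftyIso A η θ
  trace : ∀ f : BddMeas Z, inner ℂ Ω (θ f Ω) = ∫ z, f.1 z ∂η
  mem : ∀ j, W j ∈ M
  unitary : ∀ j, W j ∈ unitary (H →L[ℂ] H)
  total : Dense (Submodule.span ℂ (Set.range fun j => W j Ω) : Set H)
  implements : ∀ j (f : BddMeas Z), W j * θ f * star (W j) =
    θ (compMap f (fun z => (p j)⁻¹ • z) (measurable_const_smul _))
  surjective : Function.Surjective p

namespace IsImplementing

variable {A M : VonNeumannAlgebra H} {Ω : H} {η : Measure Z} [IsProbabilityMeasure η]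
  {θ : BddMeas Z →⋆ₐ[ℂ] (H →L[ℂ] H)} {P : Type*} [Group P] [Countable P] [MulAction P Z]
  [MeasurableConstSMul P Z] [SMulInvariantMeasure P Z η] {J : Type*} [Countable J]
  {W : J → H →L[ℂ] H} {p : J → P} (h : IsImplementing A M Ω η θ P W p)

include h

theorem mem_A (f : BddMeas Z) : θ f ∈ A := by
  rw [← SetLike.mem_coe, ← h.iso.2]
  exact ⟨f, rfl⟩

theorem mem_M (f : BddMeas Z) : θ f ∈ M := h.le (h.mem_A f)

theorem exists_eq {x : H →L[ℂ] H} (hx : x ∈ A) : ∃ f, θ f = x := by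
  rwa [← SetLike.mem_coe, ← h.iso.2] at hx

theorem eq_iff {f g : BddMeas Z} : θ f = θ g ↔ f.1 =ᵐ[η] g.1 := by
  rw [← sub_eq_zero, ← map_sub, h.iso.1]
  constructor
  · intro h'
    filter_upwards [h'] with z hz
    exact sub_eq_zero.1 hz
  · intro h'
    filter_upwards [h'] with z hz
    exact sub_eq_zero.2 hz

theorem star_mul_W (j : J) : star (W j) * W j = 1 := (Unitary.mem_iff.1 (h.unitary j)).1

theorem W_mul_star (j : J) : W j * star (W j) = 1 := (Unitary.mem_iff.1 (h.unitary j)).2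

theorem W_mul (j : J) (f : BddMeas Z) : W j * θ f =
    θ (compMap f (fun z => (p j)⁻¹ • z) (measurable_const_smul _)) * W j := by
  rw [← h.implements, mul_assoc _ _ (W j), h.star_mul_W, mul_one]

theorem inner_apply_apply (f g : BddMeas Z) :
    inner ℂ (θ f Ω) (θ g Ω) = inner ℂ (toL2 η f) (toL2 η g) := by
  rw [inner_toL2_toL2, ← h.trace, map_mul, map_star, ContinuousLinearMap.star_eq_adjoint,
    mul_apply_eq_comp, ContinuousLinearMap.adjoint_inner_right]

theorem norm_apply (f : BddMeas Z) : ‖θ f Ω‖ = ‖toL2 η f‖ := by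
  have h1 := h.inner_apply_apply f f
  rw [inner_self_eq_norm_sq_to_K, inner_self_eq_norm_sq_to_K] at h1
  have h2 : ‖θ f Ω‖ ^ 2 = ‖toL2 η f‖ ^ 2 := by exact_mod_cast h1
  exact (sq_eq_sq₀ (norm_nonneg _) (norm_nonneg _)).1 h2

theorem exists_isometry : ∃ E : Lp ℂ 2 η →ₗᵢ[ℂ] H, ∀ f, E (toL2 η f) = θ f Ω := by
  refine exists_linearIsometry_of_gram (toL2 η) (fun f => θ f Ω) ?_
    fun f g => (h.inner_apply_apply f g).symm
  exact (denseRange_toL2 η).mono Submodule.subset_span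

/-- The isometry `L²(Z, η) → H`. -/
def isom : Lp ℂ 2 η →ₗᵢ[ℂ] H := h.exists_isometry.choose

theorem isom_toL2 (f : BddMeas Z) : h.isom (toL2 η f) = θ f Ω := h.exists_isometry.choose_spec f

/-- The coisometry `H → L²(Z, η)`. -/
def coisom : H →L[ℂ] Lp ℂ 2 η := ContinuousLinearMap.adjoint h.isom.toContinuousLinearMap

theorem inner_coisom (f : BddMeas Z) (ζ : H) :
    inner ℂ (toL2 η f) (h.coisom ζ) = inner ℂ (θ f Ω) ζ := by
  rw [coisom, ContinuousLinearMap.adjoint_inner_right]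
  congr 1
  exact h.isom_toL2 f

theorem inner_adjoint_left (f : BddMeas Z) (ξ ζ : H) :
    inner ℂ (θ (star f) ξ) ζ = inner ℂ ξ (θ f ζ) := by
  rw [map_star, ContinuousLinearMap.star_eq_adjoint, ContinuousLinearMap.adjoint_inner_left]

theorem coisom_apply (g : BddMeas Z) (ζ : H) : h.coisom (θ g ζ) = mulOp η g (h.coisom ζ) := by
  refine ext_of_dense_inner (denseRange_toL2 η) ?_
  rintro _ ⟨f, rfl⟩
  rw [h.inner_coisom, inner_mulOp_right, mulOp_toL2, h.inner_coisom, map_mul, mul_apply_eq_comp,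
    h.inner_adjoint_left]

/-- On vectors `xΩ` the coisometry is the conditional expectation of `x`. The left module property
holds on all of `H`; the right one is where traciality of `Ω` enters. -/
theorem coisom_apply_right {x : H →L[ℂ] H} (hx : x ∈ M) (g : BddMeas Z) :
    h.coisom (x (θ g Ω)) = mulOp η g (h.coisom (x Ω)) := by
  refine ext_of_dense_inner (denseRange_toL2 η) ?_
  rintro _ ⟨f, rfl⟩
  rw [h.inner_coisom, inner_mulOp_right, mulOp_toL2, h.inner_coisom, mul_comm]
  have e1 : inner ℂ (θ f Ω) (x (θ g Ω)) = inner ℂ Ω ((θ (star f) * x) (θ g Ω)) := by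
    rw [mul_apply_eq_comp, ← h.inner_adjoint_left, star_star]
  have e2 : inner ℂ (θ (f * star g) Ω) (x Ω) = inner ℂ Ω (θ g ((θ (star f) * x) Ω)) := by
    rw [mul_apply_eq_comp, ← mul_apply_eq_comp (θ g), ← map_mul, ← h.inner_adjoint_left, star_mul,
      star_star]
  rw [e1, e2]
  exact h.tracial.tracial _ (mul_mem (h.mem_M _) hx) _ (h.mem_M g)

end IsImplementing

end InducedRelation

/-! ### Normalizing unitaries and the full group -/

section InducedRelation

variable {H : Type*} [NormedAddCommGroup H] [InnerProductSpace ℂ H] [CompleteSpace H]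
  {Z : Type*} [MeasurableSpace Z]

namespace IsImplementing

variable {A M : VonNeumannAlgebra H} {Ω : H} {η : Measure Z} [IsProbabilityMeasure η]
  {θ : BddMeas Z →⋆ₐ[ℂ] (H →L[ℂ] H)} {P : Type*} [Group P] [Countable P] [MulAction P Z]
  [MeasurableConstSMul P Z] [SMulInvariantMeasure P Z η] {J : Type*} [Countable J]
  {W : J → H →L[ℂ] H} {p : J → P} (h : IsImplementing A M Ω η θ P W p)

include h

theorem nonempty_index : Nonempty J := (h.surjective 1).nonempty

theorem normalizer_cancel {u : H →L[ℂ] H} (hu : u ∈ normalizer A M) :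
    star u * u = 1 ∧ u * star u = 1 := Unitary.mem_iff.1 hu.2.1

theorem star_mem_normalizer {u : H →L[ℂ] H} (hu : u ∈ normalizer A M) :
    star u ∈ normalizer A M := by
  obtain ⟨h1, h2⟩ := h.normalizer_cancel hu
  refine ⟨star_mem hu.1, Unitary.star_mem hu.2.1, ?_⟩
  conv_lhs => rw [← hu.2.2]
  rw [Set.image_image]
  have : ∀ a : H →L[ℂ] H, star u * (u * a * star u) * star (star u) = a := by
    intro a
    rw [star_star, mul_assoc, mul_assoc _ (star u), h1, mul_one, ← mul_assoc, h1, one_mul]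
  simp only [this, Set.image_id']

theorem conj_mem {u : H →L[ℂ] H} (hu : u ∈ normalizer A M) (f : BddMeas Z) :
    ∃ g, θ g = u * θ f * star u := by
  refine h.exists_eq ?_
  rw [← SetLike.mem_coe, ← hu.2.2]
  exact ⟨_, h.mem_A f, rfl⟩

/-- A unitary that normalizes `A` acts on `A ≅ L^∞(Z, η)` through a map along the orbits. -/
theorem exists_map_of_normalizer {u : H →L[ℂ] H} (hu : u ∈ normalizer A M) :
    ∃ (ψ : Z → Z) (hψ : Measurable ψ), (∀ z, ∃ g : P, ψ z = g • z) ∧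
      (∀ f, u * θ f * star u = θ (compMap f ψ hψ)) ∧ MeasurePreserving ψ η η := by
  obtain ⟨hu1, hu2⟩ := h.normalizer_cancel hu
  haveI := h.nonempty_index
  -- The `j`-th Fourier coefficient of `u`: the conditional expectation of `u (W j)*`.
  let a : J → Lp ℂ 2 η := fun j => h.coisom (u (star (W j) Ω))
  have ha : ∀ j, Measurable (a j) := fun j => (Lp.stronglyMeasurable (a j)).measurable
  have hWΩ : ∀ j f, star (W j) (θ (compMap f (fun z => (p j)⁻¹ • z)
      (measurable_const_smul _)) Ω) = θ f (star (W j) Ω) := by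
    intro j f
    rw [← h.implements]
    change (star (W j) * (W j * θ f * star (W j))) Ω = _
    rw [← mul_assoc, ← mul_assoc, h.star_mul_W, one_mul]
    rfl
  -- Applying the expectation to `θ g u (W j)* = u θ f (W j)* = u (W j)* θ (f ∘ (p j)⁻¹)`: where `a
  -- j` does not vanish, `Ad u` acts on functions as composition with `(p j)⁻¹`.
  have hrel : ∀ f g, θ g = u * θ f * star u → ∀ᵐ z ∂η, ∀ j,
      g.1 z * a j z = f.1 ((p j)⁻¹ • z) * a j z := by
    intro f g hg
    rw [ae_all_iff]
    intro j
    have e1 : θ g (u (star (W j) Ω)) = (u * star (W j)) (θ (compMap f (fun z => (p j)⁻¹ • z)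
        (measurable_const_smul _)) Ω) := by
      rw [hg, mul_apply_eq_comp u, hWΩ]
      change (u * θ f * star u * u) (star (W j) Ω) = (u * θ f) (star (W j) Ω)
      rw [mul_assoc _ (star u), hu1, mul_one]
    have e2 := h.coisom_apply g (u (star (W j) Ω))
    rw [e1, h.coisom_apply_right (mul_mem hu.1 (star_mem (h.mem j)))] at e2
    have e3 := coeFn_mulOp η g (a j)
    have e4 := coeFn_mulOp η (compMap f (fun z => (p j)⁻¹ • z) (measurable_const_smul _)) (a j)
    have e5 : mulOp η g (a j) =
      mulOp η (compMap f (fun z => (p j)⁻¹ • z) (measurable_const_smul _)) (a j) := e2.symm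
    rw [e5] at e3
    filter_upwards [e3, e4] with z h3 h4
    rw [← h3, h4]
    rfl
  let S : J → Set Z := fun j => {z | a j z ≠ 0}
  have hS : ∀ j, MeasurableSet (S j) := fun j =>
    (measurableSet_eq_fun (ha j) measurable_const).compl
  -- If `q` is the indicator of the common zero set of all coefficients, then `θ q * u` applied to
  -- `Ω` is orthogonal to every `W j Ω`; hence `θ q * u = 0`, and `q` vanishes almost everywhere.
  have hcover : ∀ᵐ z ∂η, z ∈ ⋃ j, S j := by
    let q : BddMeas Z := indFun (⋃ j, S j)ᶜ (MeasurableSet.iUnion hS).compl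
    have hq0 : ∀ j, mulOp η q (a j) = 0 := by
      intro j
      refine Lp.ext ?_
      filter_upwards [coeFn_mulOp η q (a j), Lp.coeFn_zero ℂ 2 η] with z hz hz0
      rw [hz, hz0]
      by_cases hzj : a j z = 0
      · rw [hzj, mul_zero]; rfl
      · have hmem : z ∉ (⋃ j, S j)ᶜ := fun hc => hc (mem_iUnion.2 ⟨j, hzj⟩)
        change (⋃ j, S j)ᶜ.indicator (fun _ => (1 : ℂ)) z * _ = 0
        rw [Set.indicator_of_notMem hmem, zero_mul]
    have horth : ∀ j, inner ℂ (W j Ω) (θ q (u Ω)) = 0 := by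
      intro j
      have e1 : inner ℂ (W j Ω) (θ q (u Ω)) = inner ℂ Ω (star (W j) ((θ q * u) Ω)) := by
        rw [ContinuousLinearMap.star_eq_adjoint, ContinuousLinearMap.adjoint_inner_right]
        rfl
      rw [e1, h.tracial.tracial _ (star_mem (h.mem j)) _ (mul_mem (h.mem_M q) hu.1)]
      have e2 := h.inner_coisom 1 ((θ q * u) (star (W j) Ω))
      rw [show θ 1 Ω = Ω by rw [_root_.map_one θ]; rfl] at e2
      rw [← e2, mul_apply_eq_comp, h.coisom_apply]
      change inner ℂ _ (mulOp η q (a j)) = 0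
      rw [hq0, inner_zero_right]
    have hzero : (θ q * u) Ω = 0 := by
      refine h.total.eq_zero_of_inner_right ℂ ?_
      intro v hv
      induction hv using Submodule.span_induction with
      | mem x hx =>
        obtain ⟨j, rfl⟩ := hx
        exact horth j
      | zero => exact inner_zero_left _
      | add x y _ _ hx hy => rw [inner_add_left, hx, hy, add_zero]
      | smul c x _ hx => rw [inner_smul_left, hx, mul_zero]
    have hqu : θ q * u = 0 := h.tracial.separating _ (mul_mem (h.mem_M q) hu.1) hzero
    have hq : θ q = 0 := by
      have := congrArg (· * star u) hqu
      simpa [mul_assoc, hu2] using this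
    rw [h.iso.1] at hq
    filter_upwards [hq] with z hz
    by_contra hc
    have : q.1 z = 1 := Set.indicator_of_mem (s := (⋃ j, S j)ᶜ) hc (fun _ => (1 : ℂ))
    rw [this] at hz
    exact one_ne_zero hz
  obtain ⟨ψ, hψ, hψs⟩ := exists_measurable_glue S hS (fun j z => (p j)⁻¹ • z)
    fun j => measurable_const_smul _
  have himp : ∀ f, u * θ f * star u = θ (compMap f ψ hψ) := by
    intro f
    obtain ⟨g, hg⟩ := h.conj_mem hu f
    rw [← hg, h.eq_iff]
    filter_upwards [hrel f g hg, hcover] with z h1 h2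
    obtain ⟨j, hj, hj'⟩ := hψs z
    rw [compMap_val, hj]
    exact mul_right_cancel₀ (hj' h2) (h1 j)
  refine ⟨ψ, hψ, fun z => ?_, himp, hψ, ?_⟩
  · obtain ⟨j, hj, _⟩ := hψs z
    exact ⟨_, hj⟩
  · ext s hs
    -- Measure preservation is the invariance of the trace under `Ad u`.
    have e1 : ∫ z, (compMap (indFun s hs) ψ hψ).1 z ∂η = ∫ z, (indFun s hs).1 z ∂η := by
      rw [← h.trace, ← h.trace, ← himp]
      change inner ℂ Ω ((u * θ (indFun s hs)) (star u Ω)) = _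
      rw [h.tracial.tracial _ (mul_mem hu.1 (h.mem_M _)) _ (star_mem hu.1), ← mul_apply_eq_comp,
        ← mul_assoc, hu1, one_mul]
    have e2 : ∀ t (ht : MeasurableSet t), ∫ z, (indFun t ht).1 z ∂η = (η.real t : ℂ) := by
      intro t ht
      change ∫ z, t.indicator (fun _ => (1 : ℂ)) z ∂η = _
      rw [integral_indicator ht]
      simp
    have e3 : compMap (indFun s hs) ψ hψ = indFun (ψ ⁻¹' s) (hψ hs) := rfl
    rw [e3, e2, e2] at e1
    rw [Measure.map_apply hψ hs]
    have e4 : η.real (ψ ⁻¹' s) = η.real s := by exact_mod_cast e1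
    exact (measureReal_eq_measureReal_iff).1 e4

/-- The maps `ψ`, `ψ'` obtained from `u` and `u*` are inverse almost everywhere because `Ad u` and
`Ad u*` are. As `Ad u` is to be composition with the inverse of the automorphism, it is `ψ'` that
gets corrected to `φ`, with `ψ` as its inverse. -/
theorem exists_automorphism [MeasurableSpace.CountablySeparated Z] [MeasurableEq Z]
    {u : H →L[ℂ] H} (hu : u ∈ normalizer A M) :
    ∃ φ ∈ fullGroup η (MulAction.orbitRel P Z), Implements θ u φ := by
  obtain ⟨hu1, hu2⟩ := h.normalizer_cancel hu
  obtain ⟨ψ, hψ, ho, himp, hmp⟩ := h.exists_map_of_normalizer hu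
  obtain ⟨ψ', hψ', ho', himp', hmp'⟩ := h.exists_map_of_normalizer (h.star_mem_normalizer hu)
  have h1 : ∀ᵐ z ∂η, ψ (ψ' z) = z := by
    refine ae_eq_id_of_comp η (hψ.comp hψ') fun F => ?_
    rw [← h.eq_iff]
    change θ (compMap (compMap F ψ hψ) ψ' hψ') = θ F
    rw [← himp', ← himp, star_star, ← mul_assoc, ← mul_assoc, hu1, one_mul, mul_assoc, hu1,
      mul_one]
  have h2 : ∀ᵐ z ∂η, ψ' (ψ z) = z := by
    refine ae_eq_id_of_comp η (hψ'.comp hψ) fun F => ?_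
    rw [← h.eq_iff]
    change θ (compMap (compMap F ψ' hψ') ψ hψ) = θ F
    rw [← himp, ← himp', star_star, ← mul_assoc, ← mul_assoc, hu2, one_mul, mul_assoc, hu2,
      mul_one]
  obtain ⟨φ, hφ, hφ', hφs⟩ := exists_measurableEquiv_of_ae_inverse (P := P) η hψ hψ' ho ho' h1 h2
  refine ⟨φ, ⟨?_, Filter.Eventually.of_forall fun z => ?_⟩, fun f => ?_⟩
  · refine ⟨φ.measurable, ?_⟩
    rw [Measure.map_congr (g := ψ') hφ', hmp'.map_eq]
  · obtain ⟨g, hg⟩ := hφ z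
    exact ⟨g, hg.symm⟩
  · rw [himp, h.eq_iff]
    filter_upwards [hφs] with z hz
    rw [compMap_val, compMap_val, hz]

open Filter Topology

theorem norm_indicator_apply_le (s : Set Z) (hs : MeasurableSet s) (ξ : H) :
    ‖θ (indFun s hs) ξ‖ ≤ ‖ξ‖ := by
  have hid : star (indFun s hs) * indFun s hs = indFun s hs := by
    refine Subtype.ext (funext fun z => ?_)
    change conj (s.indicator (fun _ => (1 : ℂ)) z) * s.indicator (fun _ => (1 : ℂ)) z =
      s.indicator (fun _ => (1 : ℂ)) z
    by_cases hz : z ∈ s <;> simp [hz]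
  have h1 : ‖θ (indFun s hs) ξ‖ ^ 2 ≤ ‖ξ‖ * ‖θ (indFun s hs) ξ‖ := by
    rw [← inner_self_eq_norm_sq (𝕜 := ℂ), ← h.inner_adjoint_left, ← mul_apply_eq_comp, ← map_mul,
      hid]
    refine (RCLike.re_le_norm _).trans ((norm_inner_le_norm _ _).trans ?_)
    rw [mul_comm]
  nlinarith [norm_nonneg (θ (indFun s hs) ξ), norm_nonneg ξ]

/-- The indicator functions of an increasing sequence of sets that exhausts `Z` converge strongly
to the identity. -/
theorem tendsto_indicator {B : ℕ → Set Z} (hB : ∀ n, MeasurableSet (B n)) (hmono : Monotone B)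
    (hex : ∀ᵐ z ∂η, z ∈ ⋃ n, B n) (ξ : H) :
    Tendsto (fun n => θ (indFun (B n) (hB n)) ξ) atTop (𝓝 ξ) := by
  -- Traciality removes the unitary `W j`, so convergence on the total set of vectors `W j Ω`
  -- amounts to `L²` convergence of the indicators to `1`.
  have hW : ∀ g j, ‖θ g (W j Ω)‖ = ‖toL2 η g‖ := by
    intro g j
    have e1 : ‖θ g (W j Ω)‖ ^ 2 = ‖star (W j) (θ (star g) Ω)‖ ^ 2 := by
      rw [← inner_self_eq_norm_sq (𝕜 := ℂ), ← inner_self_eq_norm_sq (𝕜 := ℂ)]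
      congr 1
      have e2 : inner ℂ (θ g (W j Ω)) (θ g (W j Ω)) =
          inner ℂ Ω ((star (W j) * θ (star g)) ((θ g * W j) Ω)) := by
        rw [mul_apply_eq_comp, ContinuousLinearMap.star_eq_adjoint,
          ContinuousLinearMap.adjoint_inner_right, ← h.inner_adjoint_left (star g), star_star]
        rfl
      rw [e2, h.tracial.tracial _ (mul_mem (star_mem (h.mem j)) (h.mem_M _)) _
        (mul_mem (h.mem_M _) (h.mem j)), mul_apply_eq_comp, mul_apply_eq_comp,
        ← h.inner_adjoint_left, ContinuousLinearMap.star_eq_adjoint,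
        ContinuousLinearMap.adjoint_inner_left]
    rw [norm_star_unitary_apply (h.unitary j), h.norm_apply, norm_toL2_star] at e1
    exact (sq_eq_sq₀ (norm_nonneg _) (norm_nonneg _)).1 e1
  have hL2 : Tendsto (fun n => ‖toL2 η (indFun (B n) (hB n) - 1)‖ ^ 2) atTop (𝓝 0) := by
    simp only [norm_toL2_sq]
    rw [← integral_zero Z ℝ (μ := η)]
    refine tendsto_integral_of_dominated_convergence (fun _ => 4) (fun n => ?_)
      (integrable_const _) (fun n => ?_) ?_
    · exact ((indFun (B n) (hB n) - 1).2.1.norm.pow_const 2).aestronglyMeasurable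
    · refine Filter.Eventually.of_forall fun z => ?_
      change ‖‖(B n).indicator (fun _ => (1 : ℂ)) z - 1‖ ^ 2‖ ≤ 4
      by_cases hz : z ∈ B n <;> simp [hz]
    · filter_upwards [hex] with z hz
      obtain ⟨N, hN⟩ := mem_iUnion.1 hz
      refine tendsto_const_nhds.congr' ?_
      filter_upwards [eventually_ge_atTop N] with n hn
      change 0 = ‖(B n).indicator (fun _ => (1 : ℂ)) z - 1‖ ^ 2
      rw [Set.indicator_of_mem (hmono hn hN)]
      simp
  have hL : Tendsto (fun n => ‖toL2 η (indFun (B n) (hB n) - 1)‖) atTop (𝓝 0) := by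
    have := (Real.continuous_sqrt.tendsto _).comp hL2
    rw [Real.sqrt_zero] at this
    refine this.congr fun n => ?_
    exact Real.sqrt_sq (norm_nonneg _)
  have hspan : ∀ ξ ∈ Submodule.span ℂ (Set.range fun j => W j Ω),
      Tendsto (fun n => θ (indFun (B n) (hB n)) ξ) atTop (𝓝 ξ) := by
    intro ξ hξ
    induction hξ using Submodule.span_induction with
    | mem x hx =>
      obtain ⟨j, rfl⟩ := hx
      rw [tendsto_iff_norm_sub_tendsto_zero]
      refine hL.congr fun n => ?_
      rw [← hW _ j, map_sub, map_one]
      rfl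
    | zero => simp
    | add x y _ _ hx hy => simpa only [map_add] using hx.add hy
    | smul c x _ hx => simpa only [map_smul] using hx.const_smul c
  rw [Metric.tendsto_atTop]
  intro ε hε
  obtain ⟨ζ, hζ, hd⟩ := Metric.mem_closure_iff.1 (h.total ξ) (ε / 3) (by positivity)
  obtain ⟨N, hN⟩ := Metric.tendsto_atTop.1 (hspan ζ hζ) (ε / 3) (by positivity)
  refine ⟨N, fun n hn => ?_⟩
  have h3 := hN n hn
  rw [dist_eq_norm] at hd h3 ⊢
  have h4 := h.norm_indicator_apply_le (B n) (hB n) (ξ - ζ)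
  have h5 : θ (indFun (B n) (hB n)) ξ - ξ = θ (indFun (B n) (hB n)) (ξ - ζ) +
      (θ (indFun (B n) (hB n)) ζ - ζ) - (ξ - ζ) := by
    rw [map_sub]
    abel
  rw [h5]
  refine (norm_sub_le _ _).trans_lt ?_
  have := norm_add_le (θ (indFun (B n) (hB n)) (ξ - ζ)) (θ (indFun (B n) (hB n)) ζ - ζ)
  linarith

/-- Up to a null set, `Z` splits into pieces `D n` on which `φ` is the action of `p (e n)`. The
partial isometries `W (e n) θ(1_{D n})` have disjoint initial supports `D n` and disjoint final
supports `φ (D n)`, both exhausting `Z`, so their partial sums converge strongly to a unitary that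
implements `φ`. -/
theorem exists_unitary_of_mem_fullGroup [MeasurableEq Z] {φ : Z ≃ᵐ Z}
    (hφ : φ ∈ fullGroup η (MulAction.orbitRel P Z)) :
    ∃ u ∈ normalizer A M, Implements θ u φ := by
  classical
  obtain ⟨hmp, horb⟩ := hφ
  haveI := h.nonempty_index
  obtain ⟨e, he⟩ := exists_surjective_nat J
  let S : ℕ → Set Z := fun n => {z | p (e n) • z = φ z}
  have hS : ∀ n, MeasurableSet (S n) := fun n =>
    measurableSet_eq_fun (measurable_const_smul _) φ.measurable
  let D : ℕ → Set Z := disjointed S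
  have hD : ∀ n, MeasurableSet (D n) := fun n => MeasurableSet.disjointed hS n
  have hDS : ∀ n z, z ∈ D n → p (e n) • z = φ z := fun n z hz => disjointed_subset S n hz
  have hdisj : ∀ m n, m ≠ n → ∀ z, z ∈ D m → z ∉ D n := fun m n hmn z hm hn =>
    Set.disjoint_left.1 (disjoint_disjointed S hmn) hm hn
  have hex : ∀ᵐ z ∂η, z ∈ ⋃ n, D n := by
    rw [iUnion_disjointed]
    filter_upwards [horb] with z hz
    obtain ⟨g, hg⟩ := hz
    obtain ⟨j, rfl⟩ := h.surjective g
    obtain ⟨n, rfl⟩ := he j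
    exact mem_iUnion.2 ⟨n, hg⟩
  let σ : BddMeas Z → BddMeas Z := fun f => compMap f φ.symm φ.symm.measurable
  let d : ℕ → BddMeas Z := fun n => indFun (D n) (hD n)
  have hdd : ∀ m n, d m * d n = if m = n then d n else 0 := by
    intro m n
    refine Subtype.ext (funext fun z => ?_)
    split_ifs with hmn
    · subst hmn
      change (D m).indicator (fun _ => (1 : ℂ)) z * (D m).indicator (fun _ => (1 : ℂ)) z =
        (D m).indicator (fun _ => (1 : ℂ)) z
      by_cases hz : z ∈ D m <;> simp [hz]
    · change (D m).indicator (fun _ => (1 : ℂ)) z * (D n).indicator (fun _ => (1 : ℂ)) z = 0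
      by_cases hz : z ∈ D m
      · simp [hdisj m n hmn z hz]
      · simp [hz]
  have hds : ∀ n, star (d n) = d n := by
    intro n
    refine Subtype.ext (funext fun z => ?_)
    change conj ((D n).indicator (fun _ => (1 : ℂ)) z) = (D n).indicator (fun _ => (1 : ℂ)) z
    by_cases hz : z ∈ D n <;> simp [hz]
  -- For functions supported in `D n`, composition with `(p (e n))⁻¹` and with `φ⁻¹` coincide; the
  -- supports agree because `φ` is injective.
  have hσd : ∀ n f, compMap (d n * f) (fun z => (p (e n))⁻¹ • z) (measurable_const_smul _) =
      σ (d n * f) := by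
    intro n f
    refine Subtype.ext (funext fun z => ?_)
    change (D n).indicator (fun _ => (1 : ℂ)) ((p (e n))⁻¹ • z) * f.1 ((p (e n))⁻¹ • z) =
      (D n).indicator (fun _ => (1 : ℂ)) (φ.symm z) * f.1 (φ.symm z)
    by_cases h1 : φ.symm z ∈ D n
    · have h2 := hDS n _ h1
      rw [φ.apply_symm_apply] at h2
      have h3 : (p (e n))⁻¹ • z = φ.symm z := by
        rw [inv_smul_eq_iff, h2]
      rw [h3]
    · have h4 : (p (e n))⁻¹ • z ∉ D n := by
        intro h5
        have h6 := hDS n _ h5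
        rw [smul_inv_smul] at h6
        refine h1 ?_
        rw [h6, φ.symm_apply_apply]
        exact h5
      rw [Set.indicator_of_notMem h1, Set.indicator_of_notMem h4, zero_mul, zero_mul]
  have hWd : ∀ n f, W (e n) * θ (d n * f) = θ (σ (d n * f)) * W (e n) := by
    intro n f
    rw [h.W_mul, hσd]
  let v : ℕ → H →L[ℂ] H := fun n => W (e n) * θ (d n)
  have hv' : ∀ n, v n = θ (σ (d n)) * W (e n) := by
    intro n
    have := hWd n 1
    rwa [mul_one] at this
  have hsv : ∀ n, star (θ (d n)) = θ (d n) := fun n => by rw [← map_star, hds]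
  have hsσ : ∀ n, star (θ (σ (d n))) = θ (σ (d n)) := fun n => by
    rw [← map_star]
    exact congrArg (fun f => θ (σ f)) (hds n)
  have hθdd : ∀ m n, θ (d m) * θ (d n) = if m = n then θ (d n) else 0 := fun m n => by
    rw [← map_mul, hdd]
    split_ifs
    · rfl
    · exact map_zero θ
  have hθσ : ∀ m n, θ (σ (d m)) * θ (σ (d n)) = if m = n then θ (σ (d n)) else 0 := fun m n => by
    have : σ (d m) * σ (d n) = σ (d m * d n) := rfl
    rw [← map_mul, this, hdd]
    split_ifs
    · rfl
    · exact map_zero θ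
  have hvv : ∀ m n, star (v m) * v n = if m = n then θ (d n) else 0 := by
    intro m n
    by_cases hmn : m = n
    · subst hmn
      rw [if_pos rfl]
      change star (W (e m) * θ (d m)) * (W (e m) * θ (d m)) = _
      rw [star_mul, mul_assoc, ← mul_assoc (star (W (e m))), h.star_mul_W, one_mul, hsv, hθdd,
        if_pos rfl]
    · rw [if_neg hmn, hv', hv', star_mul, hsσ, mul_assoc, ← mul_assoc (θ (σ (d m))), hθσ,
        if_neg hmn, zero_mul, mul_zero]
  have hvv' : ∀ m n, v m * star (v n) = if m = n then θ (σ (d n)) else 0 := by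
    intro m n
    by_cases hmn : m = n
    · subst hmn
      rw [if_pos rfl, hv', star_mul, hsσ, mul_assoc, ← mul_assoc (W (e m)), h.W_mul_star, one_mul,
        hθσ, if_pos rfl]
    · rw [if_neg hmn]
      change W (e m) * θ (d m) * star (W (e n) * θ (d n)) = 0
      rw [star_mul, hsv, mul_assoc, ← mul_assoc (θ (d m)), hθdd, if_neg hmn, zero_mul, mul_zero]
  let B : ℕ → Set Z := fun N => ⋃ n ∈ Finset.range N, D n
  have hB : ∀ N, MeasurableSet (B N) := fun N =>
    Finset.measurableSet_biUnion _ fun n _ => hD n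
  have hBm : Monotone B := fun m n hmn =>
    Set.biUnion_subset_biUnion_left fun k hk => by
      simp only [Finset.coe_range, Set.mem_Iio] at *
      exact lt_of_lt_of_le hk hmn
  have hBsum : ∀ N, ∑ n ∈ Finset.range N, d n = indFun (B N) (hB N) := by
    intro N
    refine Subtype.ext ?_
    have h1 : (∑ n ∈ Finset.range N, d n).1 = ∑ n ∈ Finset.range N, (d n).1 :=
      map_sum (BddMeas Z).subtype _ _
    rw [h1]
    change _ = (B N).indicator fun _ => (1 : ℂ)
    rw [Finset.indicator_biUnion]
    · funext z
      rw [Finset.sum_apply]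
      rfl
    · intro m _ n _ hmn
      exact disjoint_disjointed S hmn
  have hBex : ∀ᵐ z ∂η, z ∈ ⋃ N, B N := by
    filter_upwards [hex] with z hz
    obtain ⟨n, hn⟩ := mem_iUnion.1 hz
    exact mem_iUnion.2 ⟨n + 1, mem_biUnion (Finset.self_mem_range_succ n) hn⟩
  let u : ℕ → H →L[ℂ] H := fun N => ∑ n ∈ Finset.range N, v n
  have huu : ∀ m n, m ≤ n → star (u n) * u m = θ (indFun (B m) (hB m)) := by
    intro m n hmn
    rw [← hBsum, map_sum]
    change star (∑ k ∈ Finset.range n, v k) * ∑ k ∈ Finset.range m, v k = _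
    rw [star_sum, Finset.sum_mul_sum, Finset.sum_comm]
    refine Finset.sum_congr rfl fun k hk => ?_
    simp only [hvv]
    rw [Finset.sum_ite_eq', if_pos]
    exact Finset.mem_range.2 ((Finset.mem_range.1 hk).trans_le hmn)
  have hB' : ∀ N, MeasurableSet (φ.symm ⁻¹' B N) := fun N => φ.symm.measurable (hB N)
  have huu' : ∀ m n, m ≤ n → u n * star (u m) = θ (indFun (φ.symm ⁻¹' B m) (hB' m)) := by
    intro m n hmn
    have h1 : indFun (φ.symm ⁻¹' B m) (hB' m) = ∑ k ∈ Finset.range m, σ (d k) := by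
      have h2 : indFun (φ.symm ⁻¹' B m) (hB' m) = σ (∑ k ∈ Finset.range m, d k) := by
        rw [hBsum]
        rfl
      have h3 : ∀ s : Finset ℕ, σ (∑ k ∈ s, d k) = ∑ k ∈ s, σ (d k) := by
        intro s
        induction s using Finset.induction_on with
        | empty => rfl
        | insert a s ha ih =>
          rw [Finset.sum_insert ha, Finset.sum_insert ha, ← ih]
          rfl
      rw [h2, h3]
    rw [h1, map_sum]
    change (∑ k ∈ Finset.range n, v k) * star (∑ k ∈ Finset.range m, v k) = _
    rw [star_sum, Finset.sum_mul_sum, Finset.sum_comm]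
    refine Finset.sum_congr rfl fun k hk => ?_
    simp only [hvv']
    rw [Finset.sum_ite_eq', if_pos]
    exact Finset.mem_range.2 ((Finset.mem_range.1 hk).trans_le hmn)
  obtain ⟨U, hU, hUt⟩ := exists_unitary_limit u
    (fun m n hmn => by rw [huu m n hmn, huu m m le_rfl])
    (fun m n hmn => by rw [huu' m n hmn, huu' m m le_rfl])
    (fun ξ => by
      simp only [huu _ _ le_rfl]
      exact h.tendsto_indicator hB hBm hBex ξ)
    (fun ξ => by
      simp only [huu' _ _ le_rfl]
      refine h.tendsto_indicator hB' (fun m n hmn => Set.preimage_mono (hBm hmn)) ?_ ξ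
      -- The final supports exhaust `Z` because `φ⁻¹` preserves null sets.
      have := (hmp.symm φ).quasiMeasurePreserving.ae hBex
      filter_upwards [this] with z hz
      rw [← Set.preimage_iUnion]
      exact hz)
  have hvM : ∀ n, v n ∈ M := fun n => mul_mem (h.mem _) (h.mem_M _)
  have hUM : U ∈ M := mem_of_tendsto_apply M (fun N => sum_mem fun n _ => hvM n) hUt
  have hcomm : ∀ f, U * θ f = θ (σ f) * U := by
    intro f
    have hN : ∀ N, u N * θ f = θ (σ f) * u N := by
      intro N
      change (∑ n ∈ Finset.range N, v n) * θ f = θ (σ f) * ∑ n ∈ Finset.range N, v n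
      rw [Finset.sum_mul, Finset.mul_sum]
      refine Finset.sum_congr rfl fun n _ => ?_
      have h1 : σ (d n * f) = σ f * σ (d n) := by
        rw [mul_comm]
        rfl
      rw [hv' n, ← mul_assoc, ← map_mul, ← h1, ← hWd, map_mul, ← mul_assoc, ← hv']
    ext ξ
    refine tendsto_nhds_unique (hUt (θ f ξ)) ?_
    refine (((θ (σ f)).continuous.tendsto _).comp (hUt ξ)).congr fun N => ?_
    exact congr($(hN N) ξ).symm
  have himp : Implements θ U φ := by
    intro f
    rw [hcomm, mul_assoc, (Unitary.mem_iff.1 hU).2, mul_one]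
  refine ⟨U, ⟨hUM, hU, ?_⟩, himp⟩
  refine Set.Subset.antisymm ?_ ?_
  · rintro _ ⟨a, ha, rfl⟩
    obtain ⟨f, rfl⟩ := h.exists_eq ha
    change U * θ f * star U ∈ A
    rw [himp]
    exact h.mem_A _
  · intro a ha
    obtain ⟨f, rfl⟩ := h.exists_eq ha
    refine ⟨θ (compMap f φ φ.measurable), h.mem_A _, ?_⟩
    change U * θ _ * star U = θ f
    rw [himp]
    congr 1
    refine Subtype.ext (funext fun z => ?_)
    change f.1 (φ (φ.symm z)) = f.1 z
    rw [φ.apply_symm_apply]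

theorem isInducedRelation [MeasurableSpace.CountablySeparated Z] [MeasurableEq Z] :
    IsInducedRelation A M η θ (MulAction.orbitRel P Z) where
  measurable := by
    have : {q : Z × Z | MulAction.orbitRel P Z q.1 q.2} = ⋃ g : P, {q | g • q.2 = q.1} := by
      ext q
      simp only [mem_ofPred_eq, Set.mem_iUnion]
      rfl
    rw [this]
    exact MeasurableSet.iUnion fun g =>
      measurableSet_eq_fun (measurable_snd.const_smul g) measurable_fst
  countable z := by
    refine (Set.countable_range fun g : P => g⁻¹ • z).mono ?_
    rintro w ⟨g, hg⟩
    exact ⟨g, by rw [← hg]; exact inv_smul_smul g w⟩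
  normalizer_mem _ hu := h.exists_automorphism hu
  fullGroup_mem _ hφ := h.exists_unitary_of_mem_fullGroup hφ

end IsImplementing

end InducedRelation

/-! ### A criterion for traciality -/

section TracialVector

variable {H : Type*} [NormedAddCommGroup H] [InnerProductSpace ℂ H] [CompleteSpace H]

open Filter Topology

/-- A vector is tracial for `M` if there is a total family of elements of `M` for which it
coincides, together with the adjoints, with a family in the commutant. -/
theorem isTracialVector_of_commutant {M : VonNeumannAlgebra H} {Ω : H} {J : Type*}
    {W W' : J → H →L[ℂ] H} (hW : ∀ j, W j ∈ M) (hW' : ∀ j, W' j ∈ M.commutant)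
    (h1 : ∀ j, W j Ω = W' j Ω) (h2 : ∀ j, star (W j) Ω = star (W' j) Ω)
    (ht : Dense (Submodule.span ℂ (Set.range fun j => W j Ω) : Set H)) :
    IsTracialVector M Ω := by
  have hsep : ∀ x ∈ M, x Ω = 0 → x = 0 := by
    intro x hx hxΩ
    refine ContinuousLinearMap.ext_on ht ?_
    rintro _ ⟨j, rfl⟩
    have := hW' j
    rw [VonNeumannAlgebra.mem_commutant_iff] at this
    change x (W j Ω) = 0
    rw [h1, show x (W' j Ω) = W' j (x Ω) from congr($(this x hx) Ω), hxΩ, map_zero]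
  have hadj : ∀ (x : H →L[ℂ] H) (ξ ζ : H), inner ℂ ξ (x ζ) = inner ℂ (star x ξ) ζ := by
    intro x ξ ζ
    rw [ContinuousLinearMap.star_eq_adjoint, ContinuousLinearMap.adjoint_inner_left]
  -- Moving `W j` to the left, it may be replaced by `W' j`, which commutes with `x`; then it is
  -- replaced back on the right.
  have hA : ∀ j, ∀ x ∈ M, inner ℂ Ω (W j (x Ω)) = inner ℂ Ω (x (W j Ω)) := by
    intro j x hx
    have := hW' j
    rw [VonNeumannAlgebra.mem_commutant_iff] at this
    rw [hadj, h2, ← hadj, h1, show x (W' j Ω) = W' j (x Ω) from congr($(this x hx) Ω)]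
  let S : Submodule ℂ (H →L[ℂ] H) := Submodule.span ℂ (Set.range W)
  have hSA : ∀ z ∈ S, z ∈ M ∧ ∀ x ∈ M, inner ℂ Ω (z (x Ω)) = inner ℂ Ω (x (z Ω)) := by
    intro z hz
    induction hz using Submodule.span_induction with
    | mem z hz =>
      obtain ⟨j, rfl⟩ := hz
      exact ⟨hW j, hA j⟩
    | zero => exact ⟨zero_mem _, fun x _ => by simp⟩
    | add y z _ _ hy hz =>
      refine ⟨add_mem hy.1 hz.1, fun x hx => ?_⟩
      simp only [add_apply, map_add, inner_add_right, hy.2 x hx, hz.2 x hx]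
    | smul c z _ hz =>
      refine ⟨M.toStarSubalgebra.toSubalgebra.smul_mem hz.1 c, fun x hx => ?_⟩
      simp only [smul_apply, map_smul, inner_smul_right, hz.2 x hx]
  have hSd : Dense ((fun z : H →L[ℂ] H => z Ω) '' (S : Set (H →L[ℂ] H))) := by
    refine ht.mono ?_
    intro ξ hξ
    have hmap : S.map (ContinuousLinearMap.apply ℂ H Ω).toLinearMap =
        Submodule.span ℂ (Set.range fun j => W j Ω) := by
      rw [Submodule.map_span, ← Set.range_comp]
      rfl
    rw [SetLike.mem_coe, ← hmap] at hξ
    exact hξ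
  -- Hence the adjoint is isometric on the span of the `W j`. Vector approximations of `yΩ` from
  -- that span, which need not converge as operators, thus have adjoints converging on `Ω`, and the
  -- limit is identified with `y* Ω` by pairing with the `W j Ω`.
  have hSn : ∀ z ∈ S, ‖star z Ω‖ = ‖z Ω‖ := by
    intro z hz
    have e := (hSA z hz).2 _ (star_mem (hSA z hz).1)
    rw [hadj z Ω, hadj (star z) Ω, star_star, inner_self_eq_norm_sq_to_K, inner_self_eq_norm_sq_to_K] at e
    have e2 : ‖star z Ω‖ ^ 2 = ‖z Ω‖ ^ 2 := by exact_mod_cast e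
    exact (sq_eq_sq₀ (norm_nonneg _) (norm_nonneg _)).1 e2
  refine ⟨hsep, fun x hx y hy => ?_⟩
  obtain ⟨s, hs, hst⟩ := mem_closure_iff_seq_limit.1 (hSd (y Ω))
  choose z hz hzs using hs
  have hzt : Tendsto (fun n => z n Ω) atTop (𝓝 (y Ω)) := hst.congr fun n => (hzs n).symm
  have hcauchy : CauchySeq fun n => star (z n) Ω := by
    have hc := hzt.cauchySeq
    rw [Metric.cauchySeq_iff] at hc ⊢
    intro ε hε
    obtain ⟨N, hN⟩ := hc ε hε
    refine ⟨N, fun m hm n hn => ?_⟩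
    have := hN m hm n hn
    rw [dist_eq_norm] at this ⊢
    have e := hSn _ (sub_mem (hz m) (hz n))
    rw [star_sub] at e
    exact lt_of_eq_of_lt e this
  obtain ⟨ζ, hζ⟩ := cauchySeq_tendsto_of_complete hcauchy
  have hζy : ζ = star y Ω := by
    refine ht.eq_of_inner_left ℂ ?_
    intro v hv
    induction hv using Submodule.span_induction with
    | mem v hv =>
      obtain ⟨j, rfl⟩ := hv
      change inner ℂ ζ (W j Ω) = inner ℂ (star y Ω) (W j Ω)
      rw [← hadj, ← hA j y hy]
      refine tendsto_nhds_unique (hζ.inner tendsto_const_nhds) ?_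
      refine (tendsto_const_nhds.inner (((W j).continuous.tendsto _).comp hzt)).congr fun n => ?_
      change inner ℂ Ω (W j (z n Ω)) = _
      rw [hA j _ (hSA _ (hz n)).1, hadj]
    | zero => simp
    | add a b _ _ ha hb => rw [inner_add_right, inner_add_right, ha, hb]
    | smul c a _ ha => rw [inner_smul_right, inner_smul_right, ha]
  rw [hadj y, ← hζy]
  refine tendsto_nhds_unique (tendsto_const_nhds.inner ((x.continuous.tendsto _).comp hzt)) ?_
  refine (hζ.inner tendsto_const_nhds).congr fun n => ?_
  rw [← hadj, (hSA _ (hz n)).2 x hx]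
  rfl

end TracialVector

/-! ### The crossed product, its commutant and its trace -/

section CrossedProduct

variable {G : Type*} [Group G] [Countable G] [MeasurableSpace G] [DiscreteMeasurableSpace G]
  {X : Type*} [MeasurableSpace X] (μ : Measure X) [IsProbabilityMeasure μ] [MulAction G X]
  [MeasurableConstSMul G X] [SMulInvariantMeasure G X μ]

theorem coeFn_groupUnitary (g : G) (ξ : RegularSpace G X μ) :
    groupUnitary μ g ξ =ᵐ[(Measure.count : Measure G).prod μ]
      fun p => ξ (g⁻¹ * p.1, g⁻¹ • p.2) :=
  Lp.coeFn_compMeasurePreserving ξ (measurePreserving_diag μ g)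

theorem coeFn_functionOp (f : BddMeas X) (ξ : RegularSpace G X μ) :
    functionOp G μ f ξ =ᵐ[(Measure.count : Measure G).prod μ] fun p => f.1 p.2 * ξ p :=
  coeFn_mulOp _ _ ξ

theorem measurePreserving_right (t : G) :
    MeasurePreserving (fun p : G × X => (p.1 * t, p.2))
      ((Measure.count : Measure G).prod μ) ((Measure.count : Measure G).prod μ) := by
  have h1 : MeasurePreserving (fun h : G => h * t) Measure.count Measure.count := by
    refine ⟨Measurable.of_discrete, ?_⟩
    ext s hs
    rw [Measure.map_apply Measurable.of_discrete hs,
      Measure.count_apply (MeasurableSet.of_discrete), Measure.count_apply hs]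
    rw [Set.encard_preimage_of_bijective (Group.mulRight_bijective t) s]
  exact h1.prod (MeasurePreserving.id μ)

/-- The right translation `(R_t ξ)(h, x) = ξ(h t, x)`. -/
def rightUnitary (t : G) : RegularSpace G X μ →L[ℂ] RegularSpace G X μ :=
  (Lp.compMeasurePreservingₗᵢ ℂ (fun p : G × X => (p.1 * t, p.2))
    (measurePreserving_right μ t)).toContinuousLinearMap

theorem coeFn_rightUnitary (t : G) (ξ : RegularSpace G X μ) :
    rightUnitary μ t ξ =ᵐ[(Measure.count : Measure G).prod μ] fun p => ξ (p.1 * t, p.2) :=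
  Lp.coeFn_compMeasurePreserving ξ (measurePreserving_right μ t)

theorem measurable_twist : Measurable fun p : G × X => p.1⁻¹ • p.2 :=
  measurable_from_prod_countable_right fun g => measurable_const_smul g⁻¹

variable (G) in
/-- The operator `(D_f ξ)(h, x) = f(h⁻¹ x) ξ(h, x)`. -/
def twistedFunctionOp (f : BddMeas X) : RegularSpace G X μ →L[ℂ] RegularSpace G X μ :=
  mulOp ((Measure.count : Measure G).prod μ) (compMap f _ measurable_twist)

theorem coeFn_twistedFunctionOp (f : BddMeas X) (ξ : RegularSpace G X μ) :
    twistedFunctionOp G μ f ξ =ᵐ[(Measure.count : Measure G).prod μ]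
      fun p => f.1 (p.1⁻¹ • p.2) * ξ p :=
  coeFn_mulOp _ _ ξ

theorem ae_groupUnitary {Q : G × X → Prop} (h : ∀ᵐ p ∂((Measure.count : Measure G).prod μ), Q p)
    (g : G) : ∀ᵐ p ∂((Measure.count : Measure G).prod μ), Q (g⁻¹ * p.1, g⁻¹ • p.2) :=
  (measurePreserving_diag μ g).quasiMeasurePreserving.ae h

theorem ae_rightUnitary {Q : G × X → Prop} (h : ∀ᵐ p ∂((Measure.count : Measure G).prod μ), Q p)
    (t : G) : ∀ᵐ p ∂((Measure.count : Measure G).prod μ), Q (p.1 * t, p.2) :=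
  (measurePreserving_right μ t).quasiMeasurePreserving.ae h

theorem groupUnitary_mul (g h : G) :
    groupUnitary (X := X) μ (g * h) = groupUnitary μ g * groupUnitary μ h := by
  ext1 ξ
  refine Lp.ext ?_
  filter_upwards [coeFn_groupUnitary μ (g * h) ξ, coeFn_groupUnitary μ g (groupUnitary μ h ξ),
    ae_groupUnitary μ (coeFn_groupUnitary μ h ξ) g] with p h1 h2 h3
  rw [h1, mul_apply_eq_comp, h2, h3]
  simp only [mul_inv_rev, mul_assoc, mul_smul]

theorem groupUnitary_one : groupUnitary (X := X) μ (1 : G) = 1 := by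
  ext1 ξ
  refine Lp.ext ?_
  filter_upwards [coeFn_groupUnitary μ 1 ξ] with p h1
  rw [h1]
  simp

theorem norm_groupUnitary (g : G) (ξ : RegularSpace G X μ) : ‖groupUnitary μ g ξ‖ = ‖ξ‖ :=
  LinearIsometry.norm_map _ _

theorem star_groupUnitary (g : G) :
    star (groupUnitary (X := X) μ g) = groupUnitary μ g⁻¹ := by
  have h1 : star (groupUnitary (X := X) μ g) * groupUnitary μ g = 1 := by
    rw [ContinuousLinearMap.star_eq_adjoint]
    exact (ContinuousLinearMap.norm_map_iff_adjoint_comp_self _).1 (norm_groupUnitary μ g)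
  have h2 : groupUnitary (X := X) μ g * groupUnitary μ g⁻¹ = 1 := by
    rw [← groupUnitary_mul, mul_inv_cancel, groupUnitary_one]
  exact left_inv_eq_right_inv h1 h2

theorem rightUnitary_mul (g h : G) :
    rightUnitary (X := X) μ (g * h) = rightUnitary μ g * rightUnitary μ h := by
  ext1 ξ
  refine Lp.ext ?_
  filter_upwards [coeFn_rightUnitary μ (g * h) ξ, coeFn_rightUnitary μ g (rightUnitary μ h ξ),
    ae_rightUnitary μ (coeFn_rightUnitary μ h ξ) g] with p h1 h2 h3
  rw [h1, mul_apply_eq_comp, h2, h3]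
  simp only [mul_assoc]

theorem rightUnitary_one : rightUnitary (X := X) μ (1 : G) = 1 := by
  ext1 ξ
  refine Lp.ext ?_
  filter_upwards [coeFn_rightUnitary μ 1 ξ] with p h1
  rw [h1]
  simp

theorem star_rightUnitary (g : G) :
    star (rightUnitary (X := X) μ g) = rightUnitary μ g⁻¹ := by
  have h1 : star (rightUnitary (X := X) μ g) * rightUnitary μ g = 1 := by
    rw [ContinuousLinearMap.star_eq_adjoint]
    exact (ContinuousLinearMap.norm_map_iff_adjoint_comp_self _).1
      fun ξ => LinearIsometry.norm_map _ _
  have h2 : rightUnitary (X := X) μ g * rightUnitary μ g⁻¹ = 1 := by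
    rw [← rightUnitary_mul, mul_inv_cancel, rightUnitary_one]
  exact left_inv_eq_right_inv h1 h2

theorem mulOp_mul {Y : Type*} [MeasurableSpace Y] (η : Measure Y) (f g : BddMeas Y) :
    mulOp η (f * g) = mulOp η f * mulOp η g := by
  ext1 ξ
  refine Lp.ext ?_
  filter_upwards [coeFn_mulOp η (f * g) ξ, coeFn_mulOp η f (mulOp η g ξ), coeFn_mulOp η g ξ]
    with p h1 h2 h3
  rw [h1, mul_apply_eq_comp, h2, h3, ← mul_assoc]
  rfl

theorem mulOp_one {Y : Type*} [MeasurableSpace Y] (η : Measure Y) :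
    mulOp η (1 : BddMeas Y) = 1 := by
  ext1 ξ
  refine Lp.ext ?_
  filter_upwards [coeFn_mulOp η 1 ξ] with p h1
  rw [h1]
  exact one_mul _

theorem star_mulOp {Y : Type*} [MeasurableSpace Y] (η : Measure Y) (f : BddMeas Y) :
    star (mulOp η f) = mulOp η (star f) := by
  rw [ContinuousLinearMap.star_eq_adjoint, eq_comm, ContinuousLinearMap.eq_adjoint_iff]
  intro ξ ζ
  rw [L2.inner_def, L2.inner_def]
  refine integral_congr_ae ?_
  filter_upwards [coeFn_mulOp η (star f) ξ, coeFn_mulOp η f ζ] with z h1 h2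
  rw [h1, h2, RCLike.inner_apply, RCLike.inner_apply, map_mul]
  change ζ z * (conj (conj (f.1 z)) * conj (ξ z)) = _
  rw [Complex.conj_conj]
  ring

theorem functionOp_mul (f g : BddMeas X) :
    functionOp G μ (f * g) = functionOp G μ f * functionOp G μ g :=
  mulOp_mul _ (compMap f Prod.snd measurable_snd) (compMap g Prod.snd measurable_snd)

theorem functionOp_one : functionOp G μ (1 : BddMeas X) = 1 := mulOp_one _

theorem star_functionOp (f : BddMeas X) : star (functionOp G μ f) = functionOp G μ (star f) :=
  star_mulOp _ _

theorem star_twistedFunctionOp (f : BddMeas X) :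
    star (twistedFunctionOp G μ f) = twistedFunctionOp G μ (star f) :=
  star_mulOp _ _

theorem groupUnitary_mul_functionOp (g : G) (f : BddMeas X) :
    groupUnitary μ g * functionOp G μ f =
      functionOp G μ (compMap f (fun x => g⁻¹ • x) (measurable_const_smul _)) *
        groupUnitary μ g := by
  ext1 ξ
  refine Lp.ext ?_
  filter_upwards [coeFn_groupUnitary μ g (functionOp G μ f ξ),
    ae_groupUnitary μ (coeFn_functionOp μ f ξ) g,
    coeFn_functionOp μ (compMap f (fun x => g⁻¹ • x) (measurable_const_smul _))
      (groupUnitary μ g ξ), coeFn_groupUnitary μ g ξ] with p h1 h2 h3 h4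
  rw [mul_apply_eq_comp, h1, h2, mul_apply_eq_comp, h3, h4]
  rfl

theorem rightUnitary_mul_groupUnitary (t g : G) :
    rightUnitary (X := X) μ t * groupUnitary μ g = groupUnitary μ g * rightUnitary μ t := by
  ext1 ξ
  refine Lp.ext ?_
  filter_upwards [coeFn_rightUnitary μ t (groupUnitary μ g ξ),
    ae_rightUnitary μ (coeFn_groupUnitary μ g ξ) t,
    coeFn_groupUnitary μ g (rightUnitary μ t ξ),
    ae_groupUnitary μ (coeFn_rightUnitary μ t ξ) g] with p h1 h2 h3 h4
  rw [mul_apply_eq_comp, h1, h2, mul_apply_eq_comp, h3, h4]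
  simp only [mul_assoc]

theorem rightUnitary_mul_functionOp (t : G) (f : BddMeas X) :
    rightUnitary μ t * functionOp G μ f = functionOp G μ f * rightUnitary μ t := by
  ext1 ξ
  refine Lp.ext ?_
  filter_upwards [coeFn_rightUnitary μ t (functionOp G μ f ξ),
    ae_rightUnitary μ (coeFn_functionOp μ f ξ) t,
    coeFn_functionOp μ f (rightUnitary μ t ξ), coeFn_rightUnitary μ t ξ] with p h1 h2 h3 h4
  rw [mul_apply_eq_comp, h1, h2, mul_apply_eq_comp, h3, h4]

theorem twistedFunctionOp_mul_functionOp (f g : BddMeas X) :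
    twistedFunctionOp G μ f * functionOp G μ g = functionOp G μ g * twistedFunctionOp G μ f := by
  rw [twistedFunctionOp, functionOp, ← mulOp_mul, ← mulOp_mul, mul_comm]

/-- The point `h⁻¹ x` does not change when `(h, x)` is replaced by `(g⁻¹ h, g⁻¹ x)`. Together with
the right translations, these operators provide enough elements of the commutant of the crossed
product. -/
theorem twistedFunctionOp_mul_groupUnitary (f : BddMeas X) (g : G) :
    twistedFunctionOp G μ f * groupUnitary μ g = groupUnitary μ g * twistedFunctionOp G μ f := by
  ext1 ξ
  refine Lp.ext ?_
  filter_upwards [coeFn_twistedFunctionOp μ f (groupUnitary μ g ξ),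
    coeFn_groupUnitary μ g ξ, coeFn_groupUnitary μ g (twistedFunctionOp G μ f ξ),
    ae_groupUnitary μ (coeFn_twistedFunctionOp μ f ξ) g] with p h1 h2 h3 h4
  rw [mul_apply_eq_comp, h1, h2, mul_apply_eq_comp, h3, h4]
  simp only [mul_inv_rev, inv_inv, mul_smul, smul_inv_smul]

theorem functionOp_mem (f : BddMeas X) : functionOp G μ f ∈ crossedProduct G X μ :=
  subset_generatedBy _ (Or.inl ⟨f, rfl⟩)

theorem groupUnitary_mem (g : G) : groupUnitary μ g ∈ crossedProduct G X μ :=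
  subset_generatedBy _ (Or.inr ⟨g, rfl⟩)

theorem mem_commutant_crossedProduct {T : RegularSpace G X μ →L[ℂ] RegularSpace G X μ}
    (h1 : ∀ f, T * functionOp G μ f = functionOp G μ f * T)
    (h2 : ∀ g, T * groupUnitary μ g = groupUnitary μ g * T) :
    T ∈ (crossedProduct G X μ).commutant := by
  rw [VonNeumannAlgebra.mem_commutant_iff]
  intro x hx
  refine (mem_generatedBy_iff.1 hx T ?_ ?_).symm
  · rintro _ (⟨f, rfl⟩ | ⟨g, rfl⟩)
    · exact (h1 f).symm
    · exact (h2 g).symm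
  · rintro _ (⟨f, rfl⟩ | ⟨g, rfl⟩)
    · rw [star_functionOp]; exact (h1 _).symm
    · rw [star_groupUnitary]; exact (h2 _).symm

theorem rightUnitary_mem (t : G) : rightUnitary μ t ∈ (crossedProduct G X μ).commutant :=
  mem_commutant_crossedProduct μ (rightUnitary_mul_functionOp μ t)
    (rightUnitary_mul_groupUnitary μ t)

theorem twistedFunctionOp_mem (f : BddMeas X) :
    twistedFunctionOp G μ f ∈ (crossedProduct G X μ).commutant :=
  mem_commutant_crossedProduct μ (twistedFunctionOp_mul_functionOp μ f)
    (twistedFunctionOp_mul_groupUnitary μ f)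

theorem coeFn_traceVector : traceVector G X μ =ᵐ[(Measure.count : Measure G).prod μ]
    fun p => ({1} ×ˢ univ : Set (G × X)).indicator (fun _ => 1) p :=
  indicatorConstLp_coeFn

/-- The trace vector is supported on `h = 1`, where the twist is invisible. -/
theorem twistedFunctionOp_traceVector (f : BddMeas X) :
    twistedFunctionOp G μ f (traceVector G X μ) = functionOp G μ f (traceVector G X μ) := by
  refine Lp.ext ?_
  filter_upwards [coeFn_twistedFunctionOp μ f (traceVector G X μ),
    coeFn_functionOp μ f (traceVector G X μ), coeFn_traceVector (G := G) μ] with p h1 h2 h3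
  rw [h1, h2, h3]
  by_cases hp : p.1 = 1
  · rw [hp, inv_one, one_smul]
  · simp [hp]

theorem rightUnitary_traceVector (t : G) :
    rightUnitary μ t (traceVector G X μ) = groupUnitary μ t⁻¹ (traceVector G X μ) := by
  refine Lp.ext ?_
  filter_upwards [coeFn_rightUnitary μ t (traceVector G X μ),
    coeFn_groupUnitary μ t⁻¹ (traceVector G X μ),
    ae_rightUnitary μ (coeFn_traceVector (G := G) μ) t,
    ae_groupUnitary μ (coeFn_traceVector (G := G) μ) t⁻¹] with p h1 h2 h3 h4
  rw [h1, h2, h3, h4]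
  have : p.1 * t = 1 ↔ t⁻¹⁻¹ * p.1 = 1 := by
    rw [inv_inv, mul_eq_one_iff_eq_inv, mul_eq_one_iff_inv_eq, eq_comm]
  by_cases hp : p.1 * t = 1
  · simp only [Set.indicator, Set.mem_prod, Set.mem_singleton_iff, Set.mem_univ, and_true, hp,
      this.1 hp]
  · simp only [Set.indicator, Set.mem_prod, Set.mem_singleton_iff, Set.mem_univ, and_true, hp,
      mt this.2 hp, if_false]

/-- The vector `δ_h ⊗ f`. -/
def tensorVec (h : G) (f : BddMeas X) : RegularSpace G X μ :=
  functionOp G μ f (groupUnitary μ h (traceVector G X μ))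

theorem coeFn_tensorVec (h : G) (f : BddMeas X) :
    tensorVec μ h f =ᵐ[(Measure.count : Measure G).prod μ]
      fun p => ({h} ×ˢ univ : Set (G × X)).indicator (fun p => f.1 p.2) p := by
  filter_upwards [coeFn_functionOp μ f (groupUnitary μ h (traceVector G X μ)),
    coeFn_groupUnitary μ h (traceVector G X μ),
    ae_groupUnitary μ (coeFn_traceVector (G := G) μ) h] with p h1 h2 h3
  rw [tensorVec, h1, h2, h3]
  have : h⁻¹ * p.1 = 1 ↔ p.1 = h := by rw [inv_mul_eq_one, eq_comm]
  by_cases hp : p.1 = h <;> simp [Set.indicator, this, hp]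

theorem groupUnitary_tensorVec (g h : G) (f : BddMeas X) :
    groupUnitary μ g (tensorVec μ h f) =
      tensorVec μ (g * h) (compMap f (fun x => g⁻¹ • x) (measurable_const_smul _)) := by
  rw [tensorVec, tensorVec, groupUnitary_mul, mul_apply_eq_comp]
  exact congr($(groupUnitary_mul_functionOp μ g f) _)

theorem functionOp_tensorVec (h : G) (f g : BddMeas X) :
    functionOp G μ f (tensorVec μ h g) = tensorVec μ h (f * g) := by
  rw [tensorVec, tensorVec, functionOp_mul]
  rfl

theorem rightUnitary_tensorVec (t h : G) (f : BddMeas X) :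
    rightUnitary μ t (tensorVec μ h f) = tensorVec μ (h * t⁻¹) f := by
  rw [tensorVec, tensorVec, groupUnitary_mul, mul_apply_eq_comp, ← rightUnitary_traceVector,
    ← mul_apply_eq_comp, rightUnitary_mul_functionOp, mul_apply_eq_comp,
    ← mul_apply_eq_comp (rightUnitary μ t) (groupUnitary μ h),
    rightUnitary_mul_groupUnitary, mul_apply_eq_comp]

theorem twistedFunctionOp_tensorVec (h : G) (f g : BddMeas X) :
    twistedFunctionOp G μ f (tensorVec μ h g) =
      tensorVec μ h (g * compMap f (fun x => h⁻¹ • x) (measurable_const_smul _)) := by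
  rw [tensorVec, tensorVec, functionOp_mul, ← mul_apply_eq_comp, twistedFunctionOp_mul_functionOp,
    mul_apply_eq_comp, ← mul_apply_eq_comp (twistedFunctionOp G μ f),
    twistedFunctionOp_mul_groupUnitary, mul_apply_eq_comp, twistedFunctionOp_traceVector,
    ← mul_apply_eq_comp (groupUnitary μ h), groupUnitary_mul_functionOp]
  rfl

theorem restrict_singleton_prod (h : G) :
    ((Measure.count : Measure G).prod μ).restrict ({h} ×ˢ univ) = μ.map (Prod.mk h) := by
  rw [← Measure.prod_restrict, Measure.restrict_univ, Measure.restrict_singleton,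
    Measure.count_singleton, one_smul, Measure.dirac_prod]

theorem measurableEmbedding_mk (h : G) : MeasurableEmbedding (Prod.mk h : X → G × X) :=
  measurableEmbedding_prodMk_left h

theorem inner_tensorVec (h : G) (f : BddMeas X) (ξ : RegularSpace G X μ) :
    inner ℂ (tensorVec μ h f) ξ = ∫ x, conj (f.1 x) * ξ (h, x) ∂μ := by
  have hs : MeasurableSet ({h} ×ˢ univ : Set (G × X)) :=
    (MeasurableSet.singleton h).prod MeasurableSet.univ
  rw [L2.inner_def]
  have e : ∫ p, inner ℂ (tensorVec μ h f p) (ξ p) ∂((Measure.count : Measure G).prod μ) =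
      ∫ p, ({h} ×ˢ univ : Set (G × X)).indicator (fun p => conj (f.1 p.2) * ξ p) p
        ∂((Measure.count : Measure G).prod μ) := by
    refine integral_congr_ae ?_
    filter_upwards [coeFn_tensorVec μ h f] with p hp
    rw [hp, RCLike.inner_apply]
    by_cases hph : p ∈ ({h} ×ˢ univ : Set (G × X))
    · rw [Set.indicator_of_mem hph, Set.indicator_of_mem hph, mul_comm]
    · rw [Set.indicator_of_notMem hph, Set.indicator_of_notMem hph, map_zero, mul_zero]
  rw [e, integral_indicator hs, restrict_singleton_prod, (measurableEmbedding_mk h).integral_map]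

theorem ae_tensorVec [DecidableEq G] (h : G) (f : BddMeas X) (g : G) :
    ∀ᵐ x ∂μ, tensorVec μ h f (g, x) = if g = h then f.1 x else 0 := by
  have h1 := ae_restrict_of_ae (s := {g} ×ˢ univ) (coeFn_tensorVec μ h f)
  rw [restrict_singleton_prod, (measurableEmbedding_mk g).ae_map_iff] at h1
  filter_upwards [h1] with x hx
  rw [hx]
  by_cases hgh : g = h <;> simp [Set.indicator, hgh]

theorem inner_tensorVec_tensorVec [DecidableEq G] (h g : G) (f k : BddMeas X) :
    inner ℂ (tensorVec μ h f) (tensorVec μ g k) =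
      if h = g then ∫ x, (star f * k).1 x ∂μ else 0 := by
  rw [inner_tensorVec]
  split_ifs with hgh
  · subst hgh
    refine integral_congr_ae ?_
    filter_upwards [ae_tensorVec μ h k h] with x hx
    rw [hx, if_pos rfl]
    rfl
  · rw [integral_eq_zero_of_ae]
    filter_upwards [ae_tensorVec μ g k h] with x hx
    rw [hx, if_neg hgh, mul_zero]
    rfl

theorem memLp_section (ξ : RegularSpace G X μ) (h : G) : MemLp (fun x => ξ (h, x)) 2 μ := by
  have h1 := (Lp.memLp ξ).restrict ({h} ×ˢ univ)
  rw [restrict_singleton_prod] at h1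
  exact ((measurableEmbedding_mk h).memLp_map_measure_iff).1 h1

/-- If `e` is total in `L²(X)`, then the vectors `δ_h ⊗ e_i` are total in `L²(G × X)`. -/
theorem dense_span_tensorVec {I : Type*} (e : I → BddMeas X)
    (he : Dense (Submodule.span ℂ (Set.range fun i => toL2 μ (e i)) : Set (Lp ℂ 2 μ))) :
    Dense (Submodule.span ℂ (Set.range fun p : G × I => tensorVec μ p.1 (e p.2)) :
      Set (RegularSpace G X μ)) := by
  rw [Submodule.dense_iff_topologicalClosure_eq_top,
    Submodule.topologicalClosure_eq_top_iff, Submodule.eq_bot_iff]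
  intro ξ hξ
  rw [Submodule.mem_orthogonal] at hξ
  -- A vector orthogonal to all `δ_h ⊗ e_i` has each of its sections orthogonal to the total family
  -- `e`; countably many null sections give a null vector.
  have hsec : ∀ h : G, ∀ᵐ x ∂μ, ξ (h, x) = 0 := by
    intro h
    let ζ : Lp ℂ 2 μ := (memLp_section μ ξ h).toLp _
    have hζ : ζ =ᵐ[μ] fun x => ξ (h, x) := MemLp.coeFn_toLp _
    have h0 : ζ = 0 := by
      refine he.eq_zero_of_inner_right ℂ ?_
      intro v hv
      induction hv using Submodule.span_induction with
      | mem v hv =>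
        obtain ⟨i, rfl⟩ := hv
        change inner ℂ (toL2 μ (e i)) ζ = 0
        rw [inner_toL2, ← hξ _ (Submodule.subset_span ⟨(h, i), rfl⟩), inner_tensorVec]
        refine integral_congr_ae ?_
        filter_upwards [hζ] with x hx
        rw [hx]
      | zero => simp
      | add a b _ _ ha hb => rw [inner_add_left, ha, hb, add_zero]
      | smul c a _ ha => rw [inner_smul_left, ha, mul_zero]
    rw [h0] at hζ
    filter_upwards [hζ, Lp.coeFn_zero ℂ 2 μ] with x h1 h2
    rw [← h1, h2]
    rfl
  refine Lp.ext ?_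
  refine Filter.EventuallyEq.trans ?_ (Lp.coeFn_zero ℂ 2 _).symm
  have hcover : (⋃ h : G, ({h} ×ˢ univ : Set (G × X))) = univ := by
    ext p
    simp
  have hae : ∀ᵐ p ∂((Measure.count : Measure G).prod μ).restrict
      (⋃ h : G, ({h} ×ˢ univ : Set (G × X))), ξ p = 0 := by
    rw [ae_restrict_iUnion_iff]
    intro h
    rw [restrict_singleton_prod, (measurableEmbedding_mk h).ae_map_iff]
    exact hsec h
  rwa [hcover, Measure.restrict_univ] at hae

theorem star_tensor_traceVector (h : G) (f : BddMeas X) :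
    star (functionOp G μ f * groupUnitary μ h) (traceVector G X μ) =
      star (rightUnitary μ h⁻¹ * twistedFunctionOp G μ f) (traceVector G X μ) := by
  rw [star_mul, star_mul, star_functionOp, star_groupUnitary, star_twistedFunctionOp,
    star_rightUnitary, inv_inv, mul_apply_eq_comp, mul_apply_eq_comp, rightUnitary_traceVector,
    ← twistedFunctionOp_traceVector, ← mul_apply_eq_comp, ← twistedFunctionOp_mul_groupUnitary,
    mul_apply_eq_comp]

theorem tensor_traceVector (h : G) (f : BddMeas X) :
    (functionOp G μ f * groupUnitary μ h) (traceVector G X μ) =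
      (rightUnitary μ h⁻¹ * twistedFunctionOp G μ f) (traceVector G X μ) := by
  rw [mul_apply_eq_comp, mul_apply_eq_comp, twistedFunctionOp_traceVector, ← mul_apply_eq_comp
    (rightUnitary μ h⁻¹), rightUnitary_mul_functionOp, mul_apply_eq_comp, rightUnitary_traceVector,
    inv_inv]

/-- The operators `f u_h` of the crossed product and the operators `R_{h⁻¹} D_f` of its commutant,
as well as their adjoints, have the same effect on the trace vector, and the resulting vectors are
total. -/
theorem isTracialVector_traceVector :
    IsTracialVector (crossedProduct G X μ) (traceVector G X μ) := by
  refine isTracialVector_of_commutant (J := G × BddMeas X)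
    (W := fun p => functionOp G μ p.2 * groupUnitary μ p.1)
    (W' := fun p => rightUnitary μ p.1⁻¹ * twistedFunctionOp G μ p.2)
    (fun p => mul_mem (functionOp_mem μ _) (groupUnitary_mem μ _))
    (fun p => mul_mem (rightUnitary_mem μ _) (twistedFunctionOp_mem μ _))
    (fun p => tensor_traceVector μ p.1 p.2) (fun p => star_tensor_traceVector μ p.1 p.2) ?_
  exact dense_span_tensorVec μ id ((denseRange_toL2 μ).mono Submodule.subset_span)

theorem tensorVec_one_one : tensorVec μ (1 : G) (1 : BddMeas X) = traceVector G X μ := by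
  rw [tensorVec, functionOp_one, groupUnitary_one]
  rfl

end CrossedProduct

/-! ### Bessel's inequality and Fourier support -/

section Orthonormal

variable {I H : Type*} [NormedAddCommGroup H] [InnerProductSpace ℂ H] [CompleteSpace H]

/-- By Bessel's inequality the squared coefficients are summable. Consequently, a coefficient whose
modulus recurs at infinitely many indices is zero; this is how infiniteness of `Γ` is exploited. -/
theorem finite_setOf_le_norm_inner {v : I → H} (hv : Orthonormal ℂ v) (ξ : H) {ε : ℝ}
    (hε : 0 < ε) : {i | ε ≤ ‖inner ℂ (v i) ξ‖}.Finite := by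
  have h := (hv.inner_products_summable ξ).tendsto_cofinite_zero
  have h2 := h.eventually (gt_mem_nhds (pow_pos hε 2))
  rw [Filter.eventually_cofinite] at h2
  refine h2.subset fun i hi => ?_
  rw [mem_ofPred_eq, not_lt]
  exact pow_le_pow_left₀ hε.le hi 2

theorem mem_closure_span_of_inner_eq_zero {v : I → H} (hv : Orthonormal ℂ v)
    (ht : Dense (Submodule.span ℂ (Set.range v) : Set H)) (S : Set I) {ξ : H}
    (hξ : ∀ i, i ∉ S → inner ℂ (v i) ξ = 0) :
    ξ ∈ closure (Submodule.span ℂ (v '' S) : Set H) := by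
  let b := HilbertBasis.mk hv (by
    rw [← Submodule.dense_iff_topologicalClosure_eq_top.1 ht])
  have hb : ∀ i, b i = v i := fun i => congr($(HilbertBasis.coe_mk hv _) i)
  refine mem_closure_of_tendsto (b.hasSum_repr ξ) (Filter.Eventually.of_forall fun s => ?_)
  refine Submodule.sum_mem _ fun i _ => ?_
  rw [b.repr_apply_apply, hb]
  by_cases hi : i ∈ S
  · exact Submodule.smul_mem _ _ (Submodule.subset_span ⟨i, hi, rfl⟩)
  · rw [hξ i hi, zero_smul]
    exact Submodule.zero_mem _

end Orthonormal

/-! ### Characters of `K^Γ` under shift and diagonal translation -/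

section Characters

variable {Γ : Type*} [Group Γ] {K : Type*} [CommGroup K] [TopologicalSpace K]
  [IsTopologicalGroup K]

/-- The character `x ↦ χ(γ⁻¹ · x)` of `K^Γ`. -/
def shiftChar (γ : Γ) (χ : PontryaginDual (Γ → K)) : PontryaginDual (Γ → K) :=
  PontryaginDual.map ⟨shift γ⁻¹, continuous_pi fun _ => continuous_apply _⟩ χ

theorem shiftChar_apply (γ : Γ) (χ : PontryaginDual (Γ → K)) (x : Γ → K) :
    shiftChar γ χ x = χ (shift γ⁻¹ x) := rfl

theorem shiftChar_one (χ : PontryaginDual (Γ → K)) : shiftChar 1 χ = χ := by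
  refine PontryaginDual.ext fun x => ?_
  rw [shiftChar_apply]
  congr 1
  funext h
  change x (h * 1⁻¹) = x h
  rw [inv_one, mul_one]

theorem shiftChar_mul (γ δ : Γ) (χ : PontryaginDual (Γ → K)) :
    shiftChar (γ * δ) χ = shiftChar γ (shiftChar δ χ) := by
  refine PontryaginDual.ext fun x => ?_
  rw [shiftChar_apply, shiftChar_apply, shiftChar_apply]
  congr 1
  funext h
  change x (h * (γ * δ)⁻¹) = x (h * δ⁻¹ * γ⁻¹)
  rw [mul_inv_rev, mul_assoc]

theorem shiftChar_map_mul (γ : Γ) (χ ψ : PontryaginDual (Γ → K)) :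
    shiftChar γ (χ * ψ) = shiftChar γ χ * shiftChar γ ψ := rfl

theorem shiftChar_map_one (γ : Γ) : shiftChar γ (1 : PontryaginDual (Γ → K)) = 1 := rfl

theorem shiftChar_eq_one_iff (γ : Γ) (χ : PontryaginDual (Γ → K)) :
    shiftChar γ χ = 1 ↔ χ = 1 := by
  refine ⟨fun h => ?_, fun h => by rw [h, shiftChar_map_one]⟩
  rw [← shiftChar_one χ, ← inv_mul_cancel γ, shiftChar_mul, h, shiftChar_map_one]

/-- The character `k ↦ χ(k, k, …)` of `K`. -/
def diagChar (χ : PontryaginDual (Γ → K)) : PontryaginDual K :=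
  PontryaginDual.map ⟨diagHom Γ, continuous_pi fun _ => continuous_id⟩ χ

theorem diagChar_apply (χ : PontryaginDual (Γ → K)) (k : K) :
    diagChar χ k = χ (diagHom Γ k) := rfl

/-- The character `x ↦ ω(x_a)` of `K^Γ`. -/
def coordChar (a : Γ) (ω : PontryaginDual K) : PontryaginDual (Γ → K) :=
  PontryaginDual.map ⟨Pi.evalMonoidHom _ a, continuous_apply a⟩ ω

theorem coordChar_apply (a : Γ) (ω : PontryaginDual K) (x : Γ → K) :
    coordChar a ω x = ω (x a) := rfl

theorem shiftChar_coordChar (γ a : Γ) (ω : PontryaginDual K) :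
    shiftChar γ (coordChar a ω) = coordChar (a * γ⁻¹) ω := rfl

theorem mul_char_apply {A : Type*} [Monoid A] [TopologicalSpace A] (χ ψ : PontryaginDual A)
    (x : A) : (χ * ψ) x = χ x * ψ x := rfl

theorem inv_char_apply {A : Type*} [Group A] [TopologicalSpace A] (χ : PontryaginDual A)
    (x : A) : χ⁻¹ x = (χ x)⁻¹ := rfl

/-- The fibres of `a ↦ (γ · χ_a) / χ_a`, `χ_a(x) = ω(x_a) / ω(x_1)`, are finite. -/
theorem finite_setOf_twist_eq {γ : Γ} (hγ : γ ≠ 1) {ω : PontryaginDual K} (hω : ω ≠ 1)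
    (χ ψ : PontryaginDual (Γ → K)) :
    {a : Γ | χ * (shiftChar γ (coordChar a ω * (coordChar 1 ω)⁻¹)) *
      (coordChar a ω * (coordChar 1 ω)⁻¹)⁻¹ = ψ}.Finite := by
  classical
  obtain ⟨k, hk⟩ : ∃ k, ω k ≠ 1 := by
    by_contra! h
    exact hω (PontryaginDual.ext h)
  by_cases hne : {a : Γ | χ * (shiftChar γ (coordChar a ω * (coordChar 1 ω)⁻¹)) *
      (coordChar a ω * (coordChar 1 ω)⁻¹)⁻¹ = ψ}.Nonempty
  swap
  · rw [Set.not_nonempty_iff_eq_empty.1 hne]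
    exact finite_empty
  obtain ⟨c, hc⟩ := hne
  -- With `c` a fixed point of the fibre, the identity for `a` and the one for `c` are compared on
  -- the element equal to `k` at the coordinate `a` and trivial elsewhere. Unless `a` is one of the
  -- four listed coordinates, only the factor `ω(x_a)⁻¹` sees it, which forces `ω k = 1`.
  refine (Set.toFinite {c, c * γ⁻¹, 1, γ⁻¹}).subset fun a ha => ?_
  by_contra hcon
  simp only [mem_insert_iff, mem_singleton_iff, not_or] at hcon
  rw [mem_ofPred_eq] at ha hc
  have h1 := congr($(ha.trans hc.symm) (Pi.mulSingle a k))
  have haγ : a * γ⁻¹ ≠ a := by simpa using hγ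
  simp only [mul_char_apply, inv_char_apply, shiftChar_map_mul, shiftChar_coordChar,
    show ∀ φ : PontryaginDual (Γ → K), shiftChar γ φ⁻¹ = (shiftChar γ φ)⁻¹ from fun _ => rfl,
    coordChar_apply, one_mul, Pi.mulSingle_eq_same, Pi.mulSingle_eq_of_ne haγ,
    Pi.mulSingle_eq_of_ne (Ne.symm hcon.1), Pi.mulSingle_eq_of_ne (Ne.symm hcon.2.1),
    Pi.mulSingle_eq_of_ne (Ne.symm hcon.2.2.1), Pi.mulSingle_eq_of_ne (Ne.symm hcon.2.2.2),
    _root_.map_one, inv_one, mul_one] at h1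
  exact hk (by simpa using h1)

section Compact

variable [CompactSpace K] [T2Space K] [SecondCountableTopology K] [MeasurableSpace K]
  [BorelSpace K]

theorem exists_character_ne_one' [Nontrivial K] : ∃ ω : PontryaginDual K, ω ≠ 1 := by
  obtain ⟨k, hk⟩ := exists_ne (1 : K)
  obtain ⟨ω, hω⟩ := exists_character_ne_one hk
  exact ⟨ω, fun h => hω (by rw [h]; rfl)⟩

/-- Characters of `K^Γ` depend on finitely many coordinates. -/
theorem exists_finite_support [Countable Γ] (χ : PontryaginDual (Γ → K)) :
    ∃ F : Set Γ, F.Finite ∧ ∀ x : Γ → K, (∀ a ∈ F, x a = 1) → χ x = 1 := by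
  let D : Subgroup (PontryaginDual (Γ → K)) :=
    { carrier := {χ | ∃ F : Set Γ, F.Finite ∧ ∀ x : Γ → K, (∀ a ∈ F, x a = 1) → χ x = 1}
      one_mem' := ⟨∅, finite_empty, fun x _ => rfl⟩
      mul_mem' := by
        rintro χ ψ ⟨F, hF, h⟩ ⟨F', hF', h'⟩
        refine ⟨F ∪ F', hF.union hF', fun x hx => ?_⟩
        rw [mul_char_apply, h x fun a ha => hx a (Or.inl ha), h' x fun a ha => hx a (Or.inr ha),
          one_mul]
      inv_mem' := by
        rintro χ ⟨F, hF, h⟩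
        refine ⟨F, hF, fun x hx => ?_⟩
        rw [inv_char_apply, h x hx, inv_one] }
  -- Characters of finite support form a group that separates points, since it contains those of a
  -- single coordinate.
  refine mem_of_separating D (fun x hx => ?_) χ
  obtain ⟨a, ha⟩ := Function.ne_iff.1 hx
  obtain ⟨ω, hω⟩ := exists_character_ne_one ha
  refine ⟨coordChar a ω, ⟨{a}, finite_singleton a, fun y hy => ?_⟩, hω⟩
  rw [coordChar_apply, hy a rfl, _root_.map_one]

/-- The stabilizers in `Γ` of non-trivial characters of `K^Γ` are finite. -/
theorem finite_setOf_shiftChar_eq [Countable Γ] {χ : PontryaginDual (Γ → K)} (hχ : χ ≠ 1)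
    (ψ : PontryaginDual (Γ → K)) : {γ : Γ | shiftChar γ χ = ψ}.Finite := by
  classical
  obtain ⟨F, hF, h⟩ := exists_finite_support χ
  obtain ⟨F', hF', h'⟩ := exists_finite_support ψ
  -- For `γ ∉ F'⁻¹ F` the support `F γ⁻¹` of the shifted character misses `F'`. The character then
  -- ignores coordinates in `F'` because of its support, and those outside `F'` because it equals
  -- `ψ`; so it is trivial.
  refine (hF'.inv.mul hF).subset fun γ hγ => ?_
  by_contra hcon
  refine hχ ((shiftChar_eq_one_iff γ χ).1 ?_)
  rw [mem_ofPred_eq] at hγ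
  refine PontryaginDual.ext fun y => ?_
  let y₁ : Γ → K := fun a => if a ∈ F' then 1 else y a
  let y₂ : Γ → K := fun a => if a ∈ F' then y a else 1
  have hy : y = y₁ * y₂ := by
    funext a
    by_cases ha : a ∈ F' <;> simp [y₁, y₂, ha]
  have h1 : shiftChar γ χ y₁ = 1 := by
    rw [hγ]
    exact h' _ fun a ha => by simp [y₁, ha]
  have h2 : shiftChar γ χ y₂ = 1 := by
    rw [shiftChar_apply]
    refine h _ fun a ha => ?_
    change y₂ (a * γ⁻¹) = 1
    have : a * γ⁻¹ ∉ F' := fun hm => hcon ⟨(a * γ⁻¹)⁻¹, Set.inv_mem_inv.2 hm, a, ha, by simp⟩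
    simp [y₂, this]
  rw [hy, _root_.map_mul, h1, h2, one_mul]
  rfl

end Compact

end Characters

/-! ### The Fourier basis of `ℓ²(Γ × Λ) ⊗ L²(X)` -/

section Bernoulli

variable {Γ : Type*} [Group Γ] [Countable Γ] [MeasurableSpace Γ] [DiscreteMeasurableSpace Γ]
  {K : Type*} [CommGroup K] [TopologicalSpace K] [IsTopologicalGroup K] [CompactSpace K]
  [T2Space K] [SecondCountableTopology K] [MeasurableSpace K] [BorelSpace K]
  (Λ : Subgroup K) [Countable Λ]

theorem measurePreserving_mul_measX (y : Γ → K) :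
    MeasurePreserving (fun x => y * x) (measX Γ K) (measX Γ K) := by
  refine ⟨measurable_const_mul y, ?_⟩
  have := Measure.infinitePi_map_pi (fun _ : Γ => haarProb K) (f := fun a x => y a * x)
    fun a => measurable_const_mul _
  refine this.trans ?_
  congr 1
  funext a
  exact (measurePreserving_mul_haarProb (y a)).map_eq

theorem smul_eq_shift (g : Γ × Λ) (x : Γ → K) :
    g⁻¹ • x = diagHom Γ (g.2 : K)⁻¹ * shift g.1⁻¹ x := rfl

theorem compMap_charFun_smul (g : Γ × Λ) (χ : PontryaginDual (Γ → K)) :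
    compMap (charFun χ) (fun x : Γ → K => g⁻¹ • x) (measurable_const_smul _) =
      (conj (diagChar χ g.2 : ℂ)) • charFun (shiftChar g.1 χ) := by
  refine Subtype.ext (funext fun x => ?_)
  change ((χ (g⁻¹ • x) : Circle) : ℂ) = conj (diagChar χ g.2 : ℂ) * (shiftChar g.1 χ x : ℂ)
  rw [smul_eq_shift, _root_.map_mul, Circle.coe_mul, _root_.map_inv, _root_.map_inv,
    Circle.coe_inv_eq_conj]
  rfl

/-- The orthonormal basis `δ_h ⊗ χ` of `ℓ²(Γ × Λ) ⊗ L²(X)`. -/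
def fourierVec (p : (Γ × Λ) × PontryaginDual (Γ → K)) :
    RegularSpace (Γ × Λ) (Γ → K) (measX Γ K) :=
  tensorVec (measX Γ K) p.1 (charFun p.2)

theorem dense_span_fourierVec :
    Dense (Submodule.span ℂ (Set.range (fourierVec (Γ := Γ) Λ)) :
      Set (RegularSpace (Γ × Λ) (Γ → K) (measX Γ K))) :=
  dense_span_tensorVec (measX Γ K) (fun χ => charFun χ) (dense_span_charFun_top (measX Γ K))

theorem orthonormal_fourierVec : Orthonormal ℂ (fourierVec (Γ := Γ) Λ) := by
  classical
  rw [orthonormal_iff_ite]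
  rintro ⟨h, χ⟩ ⟨g, ψ⟩
  rw [fourierVec, fourierVec, inner_tensorVec_tensorVec, ← charFun_inv, ← _root_.map_mul charFun,
    integral_charFun (measX Γ K) measurePreserving_mul_measX]
  simp only [inv_mul_eq_one, Prod.mk.injEq]
  split_ifs <;> simp_all

theorem fourierVec_one_one : fourierVec Λ (1, 1) = traceVector (Γ × Λ) (Γ → K) (measX Γ K) := by
  rw [fourierVec, _root_.map_one charFun]
  exact tensorVec_one_one _

theorem tensorVec_smul {G X : Type*} [Group G] [Countable G] [MeasurableSpace G]
    [DiscreteMeasurableSpace G] [MeasurableSpace X] (μ : Measure X) [IsProbabilityMeasure μ]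
    [MulAction G X] [MeasurableConstSMul G X] [SMulInvariantMeasure G X μ] (h : G) (c : ℂ)
    (f : BddMeas X) : tensorVec μ h (c • f) = c • tensorVec μ h f := by
  refine Lp.ext ?_
  filter_upwards [coeFn_tensorVec μ h (c • f), Lp.coeFn_smul c (tensorVec μ h f),
    coeFn_tensorVec μ h f] with p h1 h2 h3
  rw [h1, h2, Pi.smul_apply, h3]
  by_cases hp : p ∈ ({h} ×ˢ univ : Set (G × X))
  · rw [Set.indicator_of_mem hp, Set.indicator_of_mem hp]
    rfl
  · rw [Set.indicator_of_notMem hp, Set.indicator_of_notMem hp, smul_zero]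

theorem groupUnitary_fourierVec (g h : Γ × Λ) (χ : PontryaginDual (Γ → K)) :
    groupUnitary (measX Γ K) g (fourierVec Λ (h, χ)) =
      conj (diagChar χ g.2 : ℂ) • fourierVec Λ (g * h, shiftChar g.1 χ) := by
  rw [fourierVec, groupUnitary_tensorVec, compMap_charFun_smul, tensorVec_smul]
  rfl

theorem functionOp_fourierVec (h : Γ × Λ) (χ ψ : PontryaginDual (Γ → K)) :
    functionOp (Γ × Λ) (measX Γ K) (charFun χ) (fourierVec Λ (h, ψ)) =
      fourierVec Λ (h, χ * ψ) := by
  rw [fourierVec, functionOp_tensorVec, ← _root_.map_mul charFun]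
  rfl

theorem rightUnitary_fourierVec (t h : Γ × Λ) (χ : PontryaginDual (Γ → K)) :
    rightUnitary (measX Γ K) t (fourierVec Λ (h, χ)) = fourierVec Λ (h * t⁻¹, χ) :=
  rightUnitary_tensorVec _ _ _ _

theorem twistedFunctionOp_fourierVec (h : Γ × Λ) (χ ψ : PontryaginDual (Γ → K)) :
    twistedFunctionOp (Γ × Λ) (measX Γ K) (charFun χ) (fourierVec Λ (h, ψ)) =
      conj (diagChar χ h.2 : ℂ) • fourierVec Λ (h, ψ * shiftChar h.1 χ) := by
  rw [fourierVec, twistedFunctionOp_tensorVec, compMap_charFun_smul, mul_smul_comm,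
    ← _root_.map_mul charFun, tensorVec_smul]
  rfl

end Bernoulli

/-! ### The subalgebras `C(K₁)` -/

section Subalgebra

variable {Γ : Type*} [Group Γ] [Countable Γ] [MeasurableSpace Γ] [DiscreteMeasurableSpace Γ]
  {K : Type*} [CommGroup K] [TopologicalSpace K] [IsTopologicalGroup K] [CompactSpace K]
  [T2Space K] [SecondCountableTopology K] [MeasurableSpace K] [BorelSpace K]
  (Λ : Subgroup K) [Countable Λ] (K₁ : Subgroup K)

theorem functionOp_mem_algM (f : BddMeas (Γ → K)) :
    functionOp (Γ × Λ) (measX Γ K) f ∈ algM Γ Λ := functionOp_mem _ f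

theorem groupUnitary_mem_algM (g : Γ × Λ) : groupUnitary (measX Γ K) g ∈ algM Γ Λ :=
  groupUnitary_mem _ g

theorem algC_le_algM : algC Γ Λ K₁ ≤ algM Γ Λ := by
  refine generatedBy_le ?_
  rintro _ (⟨f, rfl⟩ | ⟨s, _, rfl⟩)
  · exact functionOp_mem_algM Λ _
  · exact groupUnitary_mem_algM Λ _

theorem functionOp_pullback_mem (f : BddMeas (QuotX Γ K₁)) :
    functionOp (Γ × Λ) (measX Γ K) (pullback K₁ f) ∈ algC Γ Λ K₁ :=
  subset_generatedBy _ (Or.inl ⟨f, rfl⟩)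

theorem groupUnitary_mem_algC {s : Λ} (hs : (s : K) ∈ K₁) :
    groupUnitary (measX Γ K) ((1, s) : Γ × Λ) ∈ algC Γ Λ K₁ :=
  subset_generatedBy _ (Or.inr ⟨s, hs, rfl⟩)

/-- The function on `X/K₁` defined by a `K₁`-invariant function on `X`. -/
def descend (f : BddMeas (Γ → K)) (hf : ∀ k ∈ K₁, ∀ x, f.1 (diagHom Γ k * x) = f.1 x) :
    BddMeas (QuotX Γ K₁) :=
  ⟨fun y => Quotient.liftOn' y f.1 fun x x' h => by
      obtain ⟨k, hk, hkx⟩ := QuotientGroup.leftRel_apply.1 h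
      have : x' = diagHom Γ k * x := by rw [hkx, mul_comm, mul_inv_cancel_left]
      rw [this, hf k hk],
    measurable_from_quotient.2 f.2.1, f.2.2.choose, fun y => by
      obtain ⟨x, rfl⟩ := QuotientGroup.mk_surjective y
      exact f.2.2.choose_spec x⟩

theorem pullback_descend (f : BddMeas (Γ → K))
    (hf : ∀ k ∈ K₁, ∀ x, f.1 (diagHom Γ k * x) = f.1 x) : pullback K₁ (descend K₁ f hf) = f := rfl

theorem pullback_invariant (f : BddMeas (QuotX Γ K₁)) {k : K} (hk : k ∈ K₁) (x : Γ → K) :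
    (pullback K₁ f).1 (diagHom Γ k * x) = (pullback K₁ f).1 x := by
  have : ((diagHom Γ k * x : Γ → K) : QuotX Γ K₁) = (x : QuotX Γ K₁) := by
    exact QuotientGroup.eq.2 (Subgroup.mem_map.2
      ⟨k⁻¹, inv_mem hk, by rw [_root_.map_inv, mul_inv, mul_assoc, inv_mul_cancel, mul_one]⟩)
  exact congr(f.1 $this)

theorem functionOp_mem_algC (f : BddMeas (Γ → K))
    (hf : ∀ k ∈ K₁, ∀ x, f.1 (diagHom Γ k * x) = f.1 x) :
    functionOp (Γ × Λ) (measX Γ K) f ∈ algC Γ Λ K₁ := by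
  rw [← pullback_descend K₁ f hf]
  exact functionOp_pullback_mem Λ K₁ _

theorem functionOp_charFun_mem_algC {χ : PontryaginDual (Γ → K)}
    (hχ : ∀ k ∈ K₁, diagChar χ k = 1) :
    functionOp (Γ × Λ) (measX Γ K) (charFun χ) ∈ algC Γ Λ K₁ := by
  refine functionOp_mem_algC Λ K₁ _ fun k hk x => ?_
  change ((χ (diagHom Γ k * x) : Circle) : ℂ) = (χ x : ℂ)
  rw [_root_.map_mul, ← diagChar_apply, hχ k hk, one_mul]

/-- Shrinking `K₁` enlarges the algebra of invariant functions, while no canonical unitary is lost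
as long as `Λ ∩ K₁` stays inside. The case of interest is `K₂` the closure of `Λ ∩ K₁`. -/
theorem algC_le_of_le {K₁ K₂ : Subgroup K} (h : K₂ ≤ K₁) (h' : Λ ⊓ K₁ ≤ K₂) :
    algC Γ Λ K₁ ≤ algC Γ Λ K₂ := by
  refine generatedBy_le ?_
  rintro _ (⟨f, rfl⟩ | ⟨s, hs, rfl⟩)
  · exact functionOp_mem_algC Λ K₂ _ fun k hk x => pullback_invariant K₁ f (h hk) x
  · exact groupUnitary_mem_algC Λ K₂ (h' ⟨s.2, hs⟩)

theorem inv_smul_one_eq (s : Λ) (x : Γ → K) :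
    ((1, s) : Γ × Λ)⁻¹ • x = diagHom Γ (s : K)⁻¹ * x := by
  rw [smul_eq_shift]
  congr 1
  funext h
  change x (h * (1 : Γ)⁻¹) = x h
  rw [inv_one, mul_one]

theorem compMap_pullback_smul_one {s : Λ} (hs : (s : K) ∈ K₁) (f : BddMeas (QuotX Γ K₁)) :
    compMap (pullback K₁ f) (fun x => ((1, s) : Γ × Λ)⁻¹ • x) (measurable_const_smul _) =
      pullback K₁ f := by
  refine Subtype.ext (funext fun x => ?_)
  change (pullback K₁ f).1 (((1, s) : Γ × Λ)⁻¹ • x) = _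
  rw [inv_smul_one_eq, pullback_invariant K₁ f (inv_mem hs)]

theorem star_pullback (f : BddMeas (QuotX Γ K₁)) :
    star (functionOp (Γ × Λ) (measX Γ K) (pullback K₁ f)) =
      functionOp (Γ × Λ) (measX Γ K) (pullback K₁ (star f)) := star_functionOp _ _

theorem functionOp_commute (f g : BddMeas (Γ → K)) :
    functionOp (Γ × Λ) (measX Γ K) f * functionOp (Γ × Λ) (measX Γ K) g =
      functionOp (Γ × Λ) (measX Γ K) g * functionOp (Γ × Λ) (measX Γ K) f := by
  rw [← functionOp_mul, mul_comm, functionOp_mul]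

theorem groupUnitary_commute_pullback {s : Λ} (hs : (s : K) ∈ K₁) (f : BddMeas (QuotX Γ K₁)) :
    groupUnitary (measX Γ K) ((1, s) : Γ × Λ) * functionOp (Γ × Λ) (measX Γ K) (pullback K₁ f) =
      functionOp (Γ × Λ) (measX Γ K) (pullback K₁ f) *
        groupUnitary (measX Γ K) ((1, s) : Γ × Λ) := by
  rw [groupUnitary_mul_functionOp, compMap_pullback_smul_one Λ K₁ hs]

theorem groupUnitary_one_commute (s : Λ) (g : Γ × Λ) :
    groupUnitary (measX Γ K) ((1, s) : Γ × Λ) * groupUnitary (measX Γ K) g =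
      groupUnitary (measX Γ K) g * groupUnitary (measX Γ K) ((1, s) : Γ × Λ) := by
  rw [← groupUnitary_mul, ← groupUnitary_mul]
  congr 1
  exact Prod.ext (by simp) (mul_comm _ _)

theorem star_groupUnitary_one (s : Λ) :
    star (groupUnitary (measX Γ K) ((1, s) : Γ × Λ)) =
      groupUnitary (measX Γ K) ((1, s⁻¹) : Γ × Λ) := by
  rw [star_groupUnitary]
  congr 1
  exact Prod.ext (by simp) rfl

/-- The group `Λ ∩ K₁` is abelian and acts trivially on `K₁`-invariant functions. -/
theorem commute_algC {x y : RegularSpace (Γ × Λ) (Γ → K) (measX Γ K) →L[ℂ]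
    RegularSpace (Γ × Λ) (Γ → K) (measX Γ K)} (hx : x ∈ algC Γ Λ K₁) (hy : y ∈ algC Γ Λ K₁) :
    x * y = y * x := by
  refine commute_generatedBy ?_ ?_ hx hy
  · rintro _ (⟨f, rfl⟩ | ⟨s, hs, rfl⟩) _ (⟨g, rfl⟩ | ⟨t, ht, rfl⟩)
    · exact functionOp_commute Λ _ _
    · exact (groupUnitary_commute_pullback Λ K₁ ht f).symm
    · exact groupUnitary_commute_pullback Λ K₁ hs g
    · exact groupUnitary_one_commute Λ s _
  · rintro _ (⟨f, rfl⟩ | ⟨s, hs, rfl⟩) _ (⟨g, rfl⟩ | ⟨t, ht, rfl⟩)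
    · simp only [star_pullback]
      exact functionOp_commute Λ _ _
    · rw [star_groupUnitary_one]
      exact (groupUnitary_commute_pullback Λ K₁ (s := t⁻¹) (inv_mem ht) f).symm
    · simp only [star_pullback]
      exact groupUnitary_commute_pullback Λ K₁ hs _
    · rw [star_groupUnitary_one]
      exact groupUnitary_one_commute Λ s _

end Subalgebra

/-! ### Fourier coefficients of elements of relative commutants -/

section Coefficients

variable {Γ : Type*} [Group Γ] [Countable Γ] [MeasurableSpace Γ] [DiscreteMeasurableSpace Γ]
  {K : Type*} [CommGroup K] [TopologicalSpace K] [IsTopologicalGroup K] [CompactSpace K]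
  [T2Space K] [SecondCountableTopology K] [MeasurableSpace K] [BorelSpace K]
  (Λ : Subgroup K) [Countable Λ]
  {x : RegularSpace (Γ × Λ) (Γ → K) (measX Γ K) →L[ℂ] RegularSpace (Γ × Λ) (Γ → K) (measX Γ K)}

theorem commutant_apply {y : RegularSpace (Γ × Λ) (Γ → K) (measX Γ K) →L[ℂ]
      RegularSpace (Γ × Λ) (Γ → K) (measX Γ K)} (hy : y ∈ (algM Γ Λ).commutant)
    (hx : x ∈ algM Γ Λ) (ξ : RegularSpace (Γ × Λ) (Γ → K) (measX Γ K)) : x (y ξ) = y (x ξ) := by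
  rw [VonNeumannAlgebra.mem_commutant_iff] at hy
  exact congr($(hy x hx) ξ)

/-- Writing `Ω` for the trace vector and `D_f` for the twisted operator, `f x Ω = x f Ω = x D_f Ω =
D_f x Ω`. Commutation with `f` thus becomes a linear equation for the single vector `xΩ`. -/
theorem functionOp_apply_eq_twisted (hx : x ∈ algM Γ Λ) {f : BddMeas (Γ → K)}
    (h : functionOp (Γ × Λ) (measX Γ K) f * x = x * functionOp (Γ × Λ) (measX Γ K) f) :
    functionOp (Γ × Λ) (measX Γ K) f (x (traceVector (Γ × Λ) (Γ → K) (measX Γ K))) =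
      twistedFunctionOp (Γ × Λ) (measX Γ K) f (x (traceVector (Γ × Λ) (Γ → K) (measX Γ K))) := by
  have e : functionOp (Γ × Λ) (measX Γ K) f (x (traceVector (Γ × Λ) (Γ → K) (measX Γ K))) = x (functionOp (Γ × Λ) (measX Γ K) f (traceVector (Γ × Λ) (Γ → K) (measX Γ K))) :=
    congr($h (traceVector (Γ × Λ) (Γ → K) (measX Γ K)))
  rw [e, ← twistedFunctionOp_traceVector]
  exact commutant_apply Λ (twistedFunctionOp_mem _ f) hx _

theorem groupUnitary_apply_eq_right (hx : x ∈ algM Γ Λ) {g : Γ × Λ}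
    (h : groupUnitary (measX Γ K) g * x = x * groupUnitary (measX Γ K) g) :
    groupUnitary (measX Γ K) g (x (traceVector (Γ × Λ) (Γ → K) (measX Γ K))) = rightUnitary (measX Γ K) g⁻¹ (x (traceVector (Γ × Λ) (Γ → K) (measX Γ K))) := by
  have e : groupUnitary (measX Γ K) g (x (traceVector (Γ × Λ) (Γ → K) (measX Γ K))) = x (groupUnitary (measX Γ K) g (traceVector (Γ × Λ) (Γ → K) (measX Γ K))) :=
    congr($h (traceVector (Γ × Λ) (Γ → K) (measX Γ K)))
  have e2 := rightUnitary_traceVector (X := Γ → K) (measX Γ K) g⁻¹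
  rw [inv_inv] at e2
  rw [e, ← e2]
  exact commutant_apply Λ (rightUnitary_mem _ g⁻¹) hx _

theorem inner_apply_eq_star {H : Type*} [NormedAddCommGroup H] [InnerProductSpace ℂ H]
    [CompleteSpace H] (T : H →L[ℂ] H) (ξ ζ : H) : inner ℂ ξ (T ζ) = inner ℂ (star T ξ) ζ := by
  rw [ContinuousLinearMap.star_eq_adjoint, ContinuousLinearMap.adjoint_inner_left]

/-- The Fourier coefficients of an element of the crossed product that commutes with a character. -/
theorem inner_fourierVec_mul (hx : x ∈ algM Γ Λ) {ψ : PontryaginDual (Γ → K)}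
    (h : functionOp (Γ × Λ) (measX Γ K) (charFun ψ⁻¹) * x =
      x * functionOp (Γ × Λ) (measX Γ K) (charFun ψ⁻¹)) (p : Γ × Λ)
    (χ : PontryaginDual (Γ → K)) :
    inner ℂ (fourierVec Λ (p, ψ * χ)) (x (traceVector (Γ × Λ) (Γ → K) (measX Γ K))) =
      (diagChar ψ p.2 : ℂ) * inner ℂ (fourierVec Λ (p, χ * shiftChar p.1 ψ)) (x (traceVector (Γ × Λ) (Γ → K) (measX Γ K))) := by
  have e := congr(inner ℂ (fourierVec Λ (p, χ)) $(functionOp_apply_eq_twisted Λ hx h))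
  rw [inner_apply_eq_star (functionOp _ _ _), inner_apply_eq_star (twistedFunctionOp _ _ _),
    star_functionOp, star_twistedFunctionOp,
    ← charFun_inv, inv_inv, functionOp_fourierVec, twistedFunctionOp_fourierVec, inner_smul_left,
    Complex.conj_conj] at e
  exact e

/-- The Fourier coefficients of an element of the crossed product that commutes with a canonical
unitary. -/
theorem inner_fourierVec_conj (hx : x ∈ algM Γ Λ) {g : Γ × Λ}
    (h : groupUnitary (measX Γ K) g * x = x * groupUnitary (measX Γ K) g) (p : Γ × Λ)
    (χ : PontryaginDual (Γ → K)) :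
    inner ℂ (fourierVec Λ (p * g⁻¹, χ)) (x (traceVector (Γ × Λ) (Γ → K) (measX Γ K))) =
      (diagChar χ (g⁻¹).2 : ℂ) *
        inner ℂ (fourierVec Λ (g⁻¹ * p, shiftChar (g⁻¹).1 χ)) (x (traceVector (Γ × Λ) (Γ → K) (measX Γ K))) := by
  have e := congr(inner ℂ (fourierVec Λ (p, χ)) $(groupUnitary_apply_eq_right Λ hx h))
  rw [inner_apply_eq_star (groupUnitary _ _), inner_apply_eq_star (rightUnitary _ _),
    star_groupUnitary, star_rightUnitary, inv_inv,
    rightUnitary_fourierVec, groupUnitary_fourierVec, inner_smul_left, Complex.conj_conj] at e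
  exact e.symm

theorem mul_left_eq_self_circle {z : Circle} {w : ℂ} (h : w = z * w) (hw : w ≠ 0) : z = 1 := by
  refine Circle.ext ?_
  have : (z : ℂ) * w = 1 * w := by rw [← h, one_mul]
  exact mul_right_cancel₀ hw this

variable {K₁ : Subgroup K}

/-- The characters `ψ_a(x) = ω(x_a)/ω(x_1)` are invariant under all diagonal translations, so they
belong to `C(K₁)` for every `K₁`. Commutation with them equates, in modulus, the coefficient at `χ`
with the one at `χ · (p.1 · ψ_a)/ψ_a`. If `p.1 ≠ 1`, these characters take each value for finitely
many `a` only, so an infinite `Γ` yields infinitely many equally large coefficients. -/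
theorem fst_eq_one_of_inner_ne_zero (hΓK : (Infinite Γ ∧ Nontrivial K) ∨ Subsingleton Γ)
    (hx : x ∈ relativeCommutant (algC Γ Λ K₁) (algM Γ Λ)) {p : Γ × Λ}
    {χ : PontryaginDual (Γ → K)} (hne : inner ℂ (fourierVec Λ (p, χ)) (x (traceVector (Γ × Λ) (Γ → K) (measX Γ K))) ≠ 0) : p.1 = 1 := by
  rcases hΓK with ⟨hΓ, hK⟩ | hΓ
  swap
  · exact Subsingleton.elim _ _
  by_contra hp
  obtain ⟨ω, hω⟩ := exists_character_ne_one' (K := K)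
  let c : PontryaginDual (Γ → K) → ℂ := fun ψ => inner ℂ (fourierVec Λ (p, ψ)) (x (traceVector (Γ × Λ) (Γ → K) (measX Γ K)))
  have hfin : {ψ | ‖c χ‖ ≤ ‖c ψ‖}.Finite :=
    finite_setOf_le_norm_inner ((orthonormal_fourierVec Λ).comp (fun ψ => (p, ψ))
      (Prod.mk_right_injective p)) (x (traceVector (Γ × Λ) (Γ → K) (measX Γ K))) (norm_pos_iff.2 hne)
  let F : Γ → PontryaginDual (Γ → K) := fun a =>
    χ * (shiftChar p.1 (coordChar a ω * (coordChar 1 ω)⁻¹)) * (coordChar a ω * (coordChar 1 ω)⁻¹)⁻¹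
  have hF : F ⁻¹' {ψ | ‖c χ‖ ≤ ‖c ψ‖} = univ := by
    refine eq_univ_of_forall fun a => ?_
    set ψ := coordChar a ω * (coordChar 1 ω)⁻¹ with hψ
    have hψ1 : ∀ k ∈ K₁, diagChar ψ⁻¹ k = 1 := by
      intro k _
      rw [diagChar_apply, inv_char_apply, hψ, mul_char_apply, inv_char_apply]
      change (ω k * (ω k)⁻¹)⁻¹ = 1
      rw [mul_inv_cancel, inv_one]
    have e := inner_fourierVec_mul Λ hx.1 (hx.2 _ (functionOp_charFun_mem_algC Λ K₁ hψ1)) p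
      (χ * ψ⁻¹)
    rw [mul_left_comm, mul_inv_cancel, mul_one, mul_right_comm] at e
    change ‖c χ‖ ≤ ‖c (F a)‖
    have e2 : c χ = (diagChar ψ p.2 : ℂ) * c (F a) := e
    rw [e2, norm_mul, Circle.norm_coe, one_mul]
  have := hfin.preimage' (f := F) fun ψ _ => finite_setOf_twist_eq hp hω χ ψ
  rw [hF] at this
  exact infinite_univ this

/-- If `p.2 ∉ K₁`, a character `ω` of `K` trivial on `K₁` has `ω(p.2) ≠ 1`. Read at the coordinate
`1` it lies in `C(K₁)`, and commuting with it multiplies the coefficient by `ω(p.2)`. -/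
theorem snd_mem_of_inner_ne_zero (hK₁ : IsClosed (K₁ : Set K))
    (hx : x ∈ relativeCommutant (algC Γ Λ K₁) (algM Γ Λ)) {p : Γ × Λ} (hp : p.1 = 1)
    {χ : PontryaginDual (Γ → K)} (hne : inner ℂ (fourierVec Λ (p, χ)) (x (traceVector (Γ × Λ) (Γ → K) (measX Γ K))) ≠ 0) :
    (p.2 : K) ∈ K₁ := by
  by_contra hs
  obtain ⟨ω, hω, hωs⟩ := exists_character_of_notMem K₁ hK₁ hs
  have hψ1 : ∀ k ∈ K₁, diagChar (coordChar (1 : Γ) ω)⁻¹ k = 1 := by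
    intro k hk
    change (ω k)⁻¹ = 1
    rw [hω k hk, inv_one]
  have e := inner_fourierVec_mul Λ hx.1 (hx.2 _ (functionOp_charFun_mem_algC Λ K₁ hψ1)) p
    (χ * (coordChar 1 ω)⁻¹)
  rw [hp, shiftChar_one, inv_mul_cancel_right, mul_left_comm, mul_inv_cancel, mul_one] at e
  exact hωs (mul_left_eq_self_circle e hne)

/-- Conjugation by `u_s` fixes the index of the coefficient, as `(1, s)` is central in `Γ × Λ`, and
multiplies it by the value of `χ` on the diagonal element `s⁻¹`. -/
theorem diagChar_eq_one_of_inner_ne_zero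
    (hx : x ∈ algM Γ Λ) {p : Γ × Λ} {s : Λ}
    (hs : groupUnitary (measX Γ K) ((1, s) : Γ × Λ) * x =
      x * groupUnitary (measX Γ K) ((1, s) : Γ × Λ))
    {χ : PontryaginDual (Γ → K)} (hne : inner ℂ (fourierVec Λ (p, χ)) (x (traceVector (Γ × Λ) (Γ → K) (measX Γ K))) ≠ 0) :
    diagChar χ s = 1 := by
  have e := inner_fourierVec_conj Λ hx hs (p * (1, s)) χ
  have h1 : ((1, s) : Γ × Λ)⁻¹ * (p * (1, s)) = p := by
    refine Prod.ext ?_ ?_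
    · simp
    · exact (mul_left_comm _ _ _).trans (by simp)
  have h2 : shiftChar (((1, s) : Γ × Λ)⁻¹).1 χ = χ := by
    change shiftChar (1 : Γ)⁻¹ χ = χ
    rw [inv_one, shiftChar_one]
  rw [mul_inv_cancel_right, h1, h2] at e
  have h3 : diagChar χ (s : K)⁻¹ = 1 := mul_left_eq_self_circle e hne
  rwa [_root_.map_inv, inv_eq_one] at h3

end Coefficients

/-! ### Norm identities and linearity -/

section Bounds

theorem norm_toL2_compMap {Y Z : Type*} [MeasurableSpace Y] [MeasurableSpace Z] {ν : Measure Y}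
    {η : Measure Z} [IsFiniteMeasure ν] [IsFiniteMeasure η] {p : Y → Z}
    (hp : MeasurePreserving p ν η) (f : BddMeas Z) :
    ‖toL2 ν (compMap f p hp.measurable)‖ = ‖toL2 η f‖ := by
  refine (sq_eq_sq₀ (norm_nonneg _) (norm_nonneg _)).1 ?_
  rw [norm_toL2_sq, norm_toL2_sq]
  refine (integral_map (f := fun z => ‖f.1 z‖ ^ 2) hp.measurable.aemeasurable ?_).symm.trans ?_
  · exact (f.2.1.norm.pow_const 2).aestronglyMeasurable
  · rw [hp.map_eq]

theorem mulOp_add {Y : Type*} [MeasurableSpace Y] (η : Measure Y) (f g : BddMeas Y) :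
    mulOp η (f + g) = mulOp η f + mulOp η g := by
  ext1 ξ
  refine Lp.ext ?_
  rw [add_apply]
  filter_upwards [coeFn_mulOp η (f + g) ξ, coeFn_mulOp η f ξ, coeFn_mulOp η g ξ,
    Lp.coeFn_add (mulOp η f ξ) (mulOp η g ξ)] with z h1 h2 h3 h4
  rw [h1, h4, Pi.add_apply, h2, h3, ← add_mul]
  rfl

theorem mulOp_smul {Y : Type*} [MeasurableSpace Y] (η : Measure Y) (c : ℂ) (f : BddMeas Y) :
    mulOp η (c • f) = c • mulOp η f := by
  ext1 ξ
  refine Lp.ext ?_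
  rw [smul_apply]
  filter_upwards [coeFn_mulOp η (c • f) ξ, coeFn_mulOp η f ξ, Lp.coeFn_smul c (mulOp η f ξ)]
    with z h1 h2 h3
  rw [h1, h3, Pi.smul_apply, h2, smul_eq_mul, ← mul_assoc]
  rfl

variable {G X : Type*} [Group G] [Countable G] [MeasurableSpace G] [DiscreteMeasurableSpace G]
  [MeasurableSpace X] (μ : Measure X) [IsProbabilityMeasure μ] [MulAction G X]
  [MeasurableConstSMul G X] [SMulInvariantMeasure G X μ]

theorem functionOp_add (f g : BddMeas X) :
    functionOp G μ (f + g) = functionOp G μ f + functionOp G μ g :=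
  mulOp_add _ (compMap f Prod.snd measurable_snd) (compMap g Prod.snd measurable_snd)

theorem functionOp_smul (c : ℂ) (f : BddMeas X) :
    functionOp G μ (c • f) = c • functionOp G μ f :=
  mulOp_smul _ c (compMap f Prod.snd measurable_snd)

theorem norm_tensorVec (h : G) (f : BddMeas X) : ‖tensorVec μ h f‖ = ‖toL2 μ f‖ := by
  classical
  have h1 : inner ℂ (tensorVec μ h f) (tensorVec μ h f) = inner ℂ (toL2 μ f) (toL2 μ f) := by
    rw [inner_tensorVec_tensorVec, if_pos rfl, inner_toL2_toL2]
  rw [inner_self_eq_norm_sq_to_K, inner_self_eq_norm_sq_to_K] at h1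
  have h2 : ‖tensorVec μ h f‖ ^ 2 = ‖toL2 μ f‖ ^ 2 := by exact_mod_cast h1
  exact (sq_eq_sq₀ (norm_nonneg _) (norm_nonneg _)).1 h2

theorem functionOp_traceVector (f : BddMeas X) :
    functionOp G μ f (traceVector G X μ) = tensorVec μ 1 f := by
  rw [tensorVec, groupUnitary_one, one_apply_eq_self]

end Bounds

/-! ### Evaluation characters on the dual of a discrete group -/

section DiscreteDual

variable {A : Type*} [CommGroup A]

instance [Countable A] : SecondCountableTopology (DiscreteDual A) := by
  haveI : Countable (Discr A) := inferInstanceAs (Countable A)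
  exact (ContinuousMonoidHom.isEmbedding_toContinuousMap (Discr A)
    Circle).toIsInducing.secondCountableTopology

/-- The evaluation at `a` as a character of the dual group. -/
def evalDual (a : A) : PontryaginDual (DiscreteDual A) :=
  show DiscreteDual A →ₜ* Circle from
    { toFun := fun χ => χ (show Discr A from a)
      map_one' := rfl
      map_mul' := fun _ _ => rfl
      continuous_toFun :=
        ContinuousEvalConst.continuous_eval_const (F := (Discr A →ₜ* Circle))
          (show Discr A from a) }

theorem evalFun_mul (a b : A) : evalFun (a * b) = evalFun a * evalFun b := by
  refine Subtype.ext (funext fun χ => ?_)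
  exact congr(((↑) : Circle → ℂ) $(_root_.map_mul χ (show Discr A from a) (show Discr A from b)))

theorem evalFun_one : evalFun (1 : A) = 1 := by
  refine Subtype.ext (funext fun χ => ?_)
  exact congr(((↑) : Circle → ℂ) $(_root_.map_one χ))

theorem evalFun_inv (a : A) : evalFun a⁻¹ = star (evalFun a) := by
  refine Subtype.ext (funext fun χ => ?_)
  change ((χ (show Discr A from a)⁻¹ : Circle) : ℂ) = conj (χ (show Discr A from a) : ℂ)
  rw [_root_.map_inv, Circle.coe_inv_eq_conj]

end DiscreteDual

/-! ### The model of `C(K₁)` on `X/K₁ × Λ̂₁` -/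

section Model

variable {Γ : Type*} [Group Γ] [Countable Γ] [MeasurableSpace Γ] [DiscreteMeasurableSpace Γ]
  {K : Type*} [CommGroup K] [TopologicalSpace K] [IsTopologicalGroup K] [CompactSpace K]
  [T2Space K] [SecondCountableTopology K] [MeasurableSpace K] [BorelSpace K]
  (Λ : Subgroup K) [Countable Λ] (K₁ : Subgroup K)

instance : Countable ↥(Λ ⊓ K₁) :=
  (Subgroup.inclusion_injective (inf_le_left : Λ ⊓ K₁ ≤ Λ)).countable

instance : PolishSpace (Γ → K) := by
  letI := TopologicalSpace.metrizableSpaceMetric (Γ → K)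
  haveI : CompleteSpace (Γ → K) := complete_of_compact
  exact inferInstance

variable (Γ) in
theorem isClosed_diag {K₁ : Subgroup K} (hK₁ : IsClosed (K₁ : Set K)) :
    IsClosed (diag Γ K₁ : Set (Γ → K)) := by
  rw [Subgroup.coe_map]
  exact (hK₁.isCompact.image (continuous_pi fun _ => continuous_id)).isClosed

variable (Γ) in
-- The quotient σ-algebra on `X/K₁` is the Borel one because `X` is Polish and the diagonal copy of
-- `K₁` is closed; this allows continuous characters to be used as measurable functions there.
theorem borelSpace_quotX {K₁ : Subgroup K} (hK₁ : IsClosed (K₁ : Set K)) :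
    BorelSpace (QuotX Γ K₁) := by
  haveI := isClosed_diag Γ hK₁
  exact inferInstance

variable (Γ) in
theorem t2Space_quotX {K₁ : Subgroup K} (hK₁ : IsClosed (K₁ : Set K)) :
    T2Space (QuotX Γ K₁) := by
  haveI := isClosed_diag Γ hK₁
  exact inferInstance

/-- The measure on `X/K₁`. -/
abbrev measQuot : Measure (QuotX Γ K₁) :=
  (measX Γ K).map (QuotientGroup.mk : (Γ → K) → QuotX Γ K₁)

theorem measurePreserving_mk :
    MeasurePreserving (QuotientGroup.mk : (Γ → K) → QuotX Γ K₁) (measX Γ K) (measQuot K₁) :=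
  ⟨QuotientGroup.measurable_coe, rfl⟩

instance : IsProbabilityMeasure (measQuot (Γ := Γ) K₁) :=
  Measure.isProbabilityMeasure_map QuotientGroup.measurable_coe.aemeasurable

instance : IsProbabilityMeasure (measBase Γ Λ K₁) :=
  inferInstanceAs (IsProbabilityMeasure ((measQuot K₁).prod (haarProb (DiscreteDual ↥(Λ ⊓ K₁)))))

theorem measurePreserving_fst_measBase :
    MeasurePreserving (Prod.fst : BaseSpace Γ Λ K₁ → _) (measBase Γ Λ K₁) (measQuot K₁) :=
  measurePreserving_fst

/-- A character of `X/K₁` as a character of `X`. -/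
def pullbackChar (χ : PontryaginDual (QuotX Γ K₁)) : PontryaginDual (Γ → K) :=
  PontryaginDual.map ⟨QuotientGroup.mk' _, continuous_quotient_mk'⟩ χ

theorem pullbackChar_apply (χ : PontryaginDual (QuotX Γ K₁)) (x : Γ → K) :
    pullbackChar K₁ χ x = χ (x : QuotX Γ K₁) := rfl

theorem diagChar_pullbackChar (χ : PontryaginDual (QuotX Γ K₁)) {k : K} (hk : k ∈ K₁) :
    diagChar (pullbackChar K₁ χ) k = 1 := by
  have : ((diagHom Γ k : Γ → K) : QuotX Γ K₁) = 1 :=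
    (QuotientGroup.eq_one_iff _).2 ⟨k, hk, rfl⟩
  rw [diagChar_apply, pullbackChar_apply, this, _root_.map_one]

theorem exists_pullbackChar_eq {χ : PontryaginDual (Γ → K)}
    (hχ : ∀ k ∈ K₁, diagChar χ k = 1) : ∃ ψ, pullbackChar K₁ ψ = χ := by
  refine ⟨show QuotX Γ K₁ →ₜ* Circle from
    { toMonoidHom := QuotientGroup.lift _ (χ : (Γ → K) →ₜ* Circle).toMonoidHom ?_
      continuous_toFun := (map_continuous χ).quotient_lift _ }, ?_⟩
  · rintro _ ⟨k, hk, rfl⟩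
    exact hχ k hk
  · exact PontryaginDual.ext fun x => rfl

theorem pullbackChar_injective : Function.Injective (pullbackChar (Γ := Γ) K₁) := by
  intro χ ψ h
  refine PontryaginDual.ext fun y => ?_
  obtain ⟨x, rfl⟩ := QuotientGroup.mk_surjective y
  exact congr($h x)

theorem measurePreserving_mul_measQuot (y : QuotX Γ K₁) :
    MeasurePreserving (fun x => y * x) (measQuot K₁) (measQuot K₁) := by
  obtain ⟨x, rfl⟩ := QuotientGroup.mk_surjective y
  have hm : Measurable fun y : QuotX Γ K₁ => (x : QuotX Γ K₁) * y :=
    measurable_from_quotient.2 (QuotientGroup.measurable_coe.comp (measurable_const_mul x))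
  refine ⟨hm, ?_⟩
  rw [Measure.map_map hm QuotientGroup.measurable_coe]
  change (measX Γ K).map (QuotientGroup.mk ∘ fun y => x * y) = _
  rw [← Measure.map_map QuotientGroup.measurable_coe (measurable_const_mul x),
    (measurePreserving_mul_measX x).map_eq]

/-- The element `s` of `Λ₁` in `Γ × Λ`. -/
def inclG (s : ↥(Λ ⊓ K₁)) : Γ × Λ := (1, Subgroup.inclusion inf_le_left s)

theorem inclG_mul (s t : ↥(Λ ⊓ K₁)) :
    inclG (Γ := Γ) Λ K₁ (s * t) = inclG Λ K₁ s * inclG Λ K₁ t :=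
  Prod.ext (one_mul _).symm rfl

variable [BorelSpace (QuotX Γ K₁)]

/-- The index group of the Fourier basis of `L²(X/K₁ × Λ̂₁)`. -/
abbrev ModelIndex : Type _ := PontryaginDual (QuotX Γ K₁) × ↥(Λ ⊓ K₁)

/-- The characters of `X/K₁ × Λ̂₁`. -/
def modelChar : ModelIndex (Γ := Γ) Λ K₁ →* BddMeas (BaseSpace Γ Λ K₁) where
  toFun i := compMap (charFun i.1) Prod.fst measurable_fst *
    compMap (evalFun i.2) Prod.snd measurable_snd
  map_one' := by
    rw [Prod.fst_one, Prod.snd_one, _root_.map_one charFun, evalFun_one]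
    exact one_mul _
  map_mul' i j := by
    rw [Prod.fst_mul, Prod.snd_mul, _root_.map_mul charFun, evalFun_mul]
    exact Subtype.ext (funext fun z => mul_mul_mul_comm (_ : ℂ) _ _ _)

theorem modelChar_val (i : ModelIndex (Γ := Γ) Λ K₁) (z : BaseSpace Γ Λ K₁) :
    (modelChar Λ K₁ i).1 z = (i.1 z.1 : ℂ) * evalChar i.2 z.2 := rfl

/-- The unitaries in `C(K₁)` that correspond to the characters of `X/K₁ × Λ̂₁`. -/
def modelOp : ModelIndex (Γ := Γ) Λ K₁ →* (RegularSpace (Γ × Λ) (Γ → K) (measX Γ K) →L[ℂ]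
    RegularSpace (Γ × Λ) (Γ → K) (measX Γ K)) where
  toFun i := functionOp (Γ × Λ) (measX Γ K) (pullback K₁ (charFun i.1)) *
    groupUnitary (measX Γ K) (inclG Λ K₁ i.2)
  map_one' := by
    rw [Prod.fst_one, Prod.snd_one, _root_.map_one charFun]
    refine (congrArg₂ _ (functionOp_one _) ?_).trans (one_mul _)
    exact groupUnitary_one _
  map_mul' i j := by
    have h1 : functionOp (Γ × Λ) (measX Γ K) (pullback K₁ (charFun (i * j).1)) =
        functionOp (Γ × Λ) (measX Γ K) (pullback K₁ (charFun i.1)) *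
          functionOp (Γ × Λ) (measX Γ K) (pullback K₁ (charFun j.1)) := by
      rw [← functionOp_mul, Prod.fst_mul, _root_.map_mul charFun]
      rfl
    rw [h1, Prod.snd_mul, inclG_mul, groupUnitary_mul]
    have h2 := groupUnitary_commute_pullback Λ K₁ (s := Subgroup.inclusion inf_le_left i.2) i.2.2.2
      (charFun j.1)
    change groupUnitary (measX Γ K) (inclG Λ K₁ i.2) * _ = _ * groupUnitary (measX Γ K)
      (inclG Λ K₁ i.2) at h2
    simp only [mul_assoc]
    congr 1
    rw [← mul_assoc, ← h2, mul_assoc]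

theorem modelOp_apply (i : ModelIndex (Γ := Γ) Λ K₁) :
    modelOp Λ K₁ i = functionOp (Γ × Λ) (measX Γ K) (charFun (pullbackChar K₁ i.1)) *
    groupUnitary (measX Γ K) (inclG Λ K₁ i.2) := rfl

theorem modelOp_traceVector (i : ModelIndex (Γ := Γ) Λ K₁) :
    modelOp Λ K₁ i (traceVector (Γ × Λ) (Γ → K) (measX Γ K)) =
      fourierVec Λ (inclG Λ K₁ i.2, pullbackChar K₁ i.1) := rfl

theorem modelOp_mem (i : ModelIndex (Γ := Γ) Λ K₁) : modelOp Λ K₁ i ∈ algC Γ Λ K₁ :=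
  mul_mem (functionOp_pullback_mem Λ K₁ _) (groupUnitary_mem_algC Λ K₁ i.2.2.2)

theorem modelOp_unitary (i : ModelIndex (Γ := Γ) Λ K₁) :
    star (modelOp Λ K₁ i) * modelOp Λ K₁ i = 1 := by
  rw [modelOp_apply, star_mul, mul_assoc, ← mul_assoc (star (functionOp _ _ _)), star_functionOp,
    ← functionOp_mul, ← charFun_inv, ← _root_.map_mul charFun, inv_mul_cancel,
    _root_.map_one charFun, functionOp_one, one_mul, star_groupUnitary, ← groupUnitary_mul,
    inv_mul_cancel, groupUnitary_one]

/-- The characters of `K` already separate points, and their restrictions are characters of the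
discrete group `Λ ∩ K₁`. -/
theorem evalDual_eq_one_iff (s : ↥(Λ ⊓ K₁)) : evalDual s = 1 ↔ s = 1 := by
  constructor
  · intro h
    by_contra hs
    have hs' : (s : K) ≠ 1 := fun h' => hs (Subtype.ext h')
    obtain ⟨ω, hω⟩ := exists_character_ne_one hs'
    let χ : DiscreteDual ↥(Λ ⊓ K₁) := show Discr ↥(Λ ⊓ K₁) →ₜ* Circle from
      { toMonoidHom := (ω : K →ₜ* Circle).toMonoidHom.comp (Λ ⊓ K₁).subtype
        continuous_toFun := continuous_of_discreteTopology }
    exact hω congr($h χ)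
  · rintro rfl
    exact PontryaginDual.ext fun χ => _root_.map_one χ

/-- Both sides are `1` at the trivial index and `0` elsewhere: the left by orthonormality of the
Fourier basis, the right by orthogonality of characters on each factor. -/
theorem moment_modelOp (i : ModelIndex (Γ := Γ) Λ K₁) :
    inner ℂ (traceVector (Γ × Λ) (Γ → K) (measX Γ K))
      (modelOp Λ K₁ i (traceVector (Γ × Λ) (Γ → K) (measX Γ K))) =
      ∫ z, (modelChar Λ K₁ i).1 z ∂(measBase Γ Λ K₁) := by
  classical
  have h1 := (orthonormal_iff_ite.1 (orthonormal_fourierVec (Γ := Γ) Λ)) (1, 1)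
    (inclG Λ K₁ i.2, pullbackChar K₁ i.1)
  rw [fourierVec_one_one] at h1
  rw [modelOp_traceVector, h1]
  have h2 : ∫ z, (modelChar Λ K₁ i).1 z ∂(measBase Γ Λ K₁) =
      (∫ y, (charFun i.1).1 y ∂(measQuot K₁)) *
        ∫ χ, (charFun (evalDual i.2)).1 χ ∂(haarProb (DiscreteDual ↥(Λ ⊓ K₁))) :=
    integral_prod_mul (charFun i.1).1 (charFun (evalDual i.2)).1
  rw [h2, integral_charFun _ (measurePreserving_mul_measQuot K₁),
    integral_charFun _ measurePreserving_mul_haarProb]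
  have h3 : (1 : Γ × Λ) = inclG Λ K₁ i.2 ↔ i.2 = 1 := by
    constructor
    · intro h
      exact Subtype.ext congr((($h).2 : K)).symm
    · intro h
      rw [h]
      rfl
  have h4 : 1 = pullbackChar K₁ i.1 ↔ i.1 = 1 := by
    rw [eq_comm]
    exact (pullbackChar_injective K₁).eq_iff' rfl
  simp only [Prod.mk.injEq, h3, h4, evalDual_eq_one_iff]
  by_cases h5 : i.1 = 1 <;> by_cases h6 : i.2 = 1 <;> simp [h5, h6]

variable [T2Space (QuotX Γ K₁)]

theorem dense_span_modelChar :
    Dense (Submodule.span ℂ (Set.range fun i => toL2 (measBase Γ Λ K₁) (modelChar Λ K₁ i)) :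
      Set (Lp ℂ 2 (measBase Γ Λ K₁))) := by
  refine dense_span_toL2 (measBase Γ Λ K₁) (modelChar Λ K₁) (fun i => ?_) (fun i => ?_) ?_
  · exact ((continuous_charFun i.1).comp continuous_fst).mul
      ((continuous_evalChar i.2).comp continuous_snd)
  · refine Subtype.ext (funext fun z => ?_)
    change (charFun i.1⁻¹).1 z.1 * (evalFun i.2⁻¹).1 z.2 =
      star ((charFun i.1).1 z.1 * (evalFun i.2).1 z.2)
    rw [charFun_inv, evalFun_inv, star_mul']
    rfl
  · rintro ⟨y, χ⟩ ⟨y', χ'⟩ h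
    by_cases hy : y = y'
    · have hχ : χ ≠ χ' := fun h' => h (by rw [hy, h'])
      obtain ⟨s, hs⟩ : ∃ s, χ s ≠ χ' s := by
        by_contra! hcon
        exact hχ (PontryaginDual.ext hcon)
      refine ⟨(1, s), fun hcon => hs (Subtype.ext ?_)⟩
      rw [modelChar_val, modelChar_val] at hcon
      rw [← hy] at hcon
      exact mul_left_cancel₀ (Circle.coe_ne_zero ((1 : PontryaginDual (QuotX Γ K₁)) y)) hcon
    · obtain ⟨ω, hω⟩ := exists_character_ne_one (k := y * y'⁻¹) (by rwa [Ne, mul_inv_eq_one])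
      refine ⟨(ω, 1), fun hcon => hω ?_⟩
      rw [modelChar_val, modelChar_val] at hcon
      have h1 : ∀ χ, evalChar (1 : ↥(Λ ⊓ K₁)) χ = 1 := fun χ => congr(($evalFun_one).1 χ)
      rw [h1, h1, mul_one, mul_one] at hcon
      have : ω y = ω y' := Subtype.ext hcon
      rw [_root_.map_mul, _root_.map_inv, this, mul_inv_cancel]

/-- The commutant of `M` is contained in that of `C(K₁)` and already produces every Fourier vector
from the trace vector. -/
theorem dense_commutant_algC :
    Dense {ξ | ∃ y ∈ (algC Γ Λ K₁).commutant, ξ = y (traceVector (Γ × Λ) (Γ → K) (measX Γ K))} := by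
  let S : Submodule ℂ (RegularSpace (Γ × Λ) (Γ → K) (measX Γ K)) :=
    (algC Γ Λ K₁).commutant.toStarSubalgebra.toSubalgebra.toSubmodule.map
      (ContinuousLinearMap.apply ℂ _ (traceVector (Γ × Λ) (Γ → K) (measX Γ K))).toLinearMap
  have hS : (Submodule.span ℂ (Set.range (fourierVec (Γ := Γ) Λ))) ≤ S := by
    rw [Submodule.span_le]
    rintro _ ⟨p, rfl⟩
    refine ⟨rightUnitary (measX Γ K) p.1⁻¹ * twistedFunctionOp (Γ × Λ) (measX Γ K) (charFun p.2),
      ?_, (tensor_traceVector (measX Γ K) p.1 (charFun p.2)).symm⟩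
    change _ ∈ (algC Γ Λ K₁).commutant
    have := mul_mem (rightUnitary_mem (X := Γ → K) (measX Γ K) p.1⁻¹)
      (twistedFunctionOp_mem (G := Γ × Λ) (measX Γ K) (charFun p.2))
    rw [VonNeumannAlgebra.mem_commutant_iff] at this ⊢
    exact fun g hg => this g (algC_le_algM Λ K₁ hg)
  refine ((dense_span_fourierVec Λ).mono hS).mono ?_
  rintro _ ⟨y, hy, rfl⟩
  exact ⟨y, hy, rfl⟩

theorem isAbelianModel :
    IsAbelianModel (algC Γ Λ K₁) (traceVector (Γ × Λ) (Γ → K) (measX Γ K)) (measBase Γ Λ K₁)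
      (modelChar Λ K₁) (modelOp Λ K₁) where
  comm _ hx _ hy := commute_algC Λ K₁ hx hy
  cyclic := dense_commutant_algC Λ K₁
  total := dense_span_modelChar Λ K₁
  star_e i := by
    refine Subtype.ext (funext fun z => ?_)
    change (charFun i.1⁻¹).1 z.1 * (evalFun i.2⁻¹).1 z.2 =
      star ((charFun i.1).1 z.1 * (evalFun i.2).1 z.2)
    rw [charFun_inv, evalFun_inv, star_mul']
    rfl
  star_W i := (left_inv_eq_right_inv (modelOp_unitary Λ K₁ i)
    (by rw [← _root_.map_mul, mul_inv_cancel, _root_.map_one])).symm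
  mem := modelOp_mem Λ K₁
  moment := moment_modelOp Λ K₁

/-- The canonical identification of `L^∞(X/K₁ × Λ̂₁)` with `C(K₁)`. -/
def canonicalIso : BddMeas (BaseSpace Γ Λ K₁) →⋆ₐ[ℂ]
    (RegularSpace (Γ × Λ) (Γ → K) (measX Γ K) →L[ℂ] RegularSpace (Γ × Λ) (Γ → K) (measX Γ K)) :=
  (isAbelianModel Λ K₁).repr

theorem canonicalIso_mem (F : BddMeas (BaseSpace Γ Λ K₁)) :
    canonicalIso Λ K₁ F ∈ algC Γ Λ K₁ := (isAbelianModel Λ K₁).repr_mem F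

theorem canonicalIso_modelChar (i : ModelIndex (Γ := Γ) Λ K₁) :
    canonicalIso Λ K₁ (modelChar Λ K₁ i) = modelOp Λ K₁ i := (isAbelianModel Λ K₁).repr_e i

theorem norm_canonicalIso_apply (F : BddMeas (BaseSpace Γ Λ K₁)) :
    ‖canonicalIso Λ K₁ F (traceVector (Γ × Λ) (Γ → K) (measX Γ K))‖ =
      ‖toL2 (measBase Γ Λ K₁) F‖ := by
  have := (isAbelianModel Λ K₁).repr_vec F
  rw [canonicalIso, this, LinearIsometry.norm_map]

/-- Applied to the trace vector, both sides are linear in `f` and have norm `‖f‖₂`, so their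
difference is `L²` bounded with constant `2`; on characters of `X/K₁` they agree by construction. -/
theorem canonicalIso_function (f : BddMeas (QuotX Γ K₁)) :
    canonicalIso Λ K₁ (compMap f Prod.fst measurable_fst) =
      functionOp (Γ × Λ) (measX Γ K) (pullback K₁ f) := by
  refine (isAbelianModel Λ K₁).eq_of_apply (canonicalIso_mem Λ K₁ _)
    (functionOp_pullback_mem Λ K₁ f) (sub_eq_zero.1 ?_)
  let Φ : BddMeas (QuotX Γ K₁) →ₗ[ℂ] RegularSpace (Γ × Λ) (Γ → K) (measX Γ K) :=
    { toFun := fun f =>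
        canonicalIso Λ K₁ (compMap f Prod.fst measurable_fst)
          (traceVector (Γ × Λ) (Γ → K) (measX Γ K)) -
        functionOp (Γ × Λ) (measX Γ K) (pullback K₁ f) (traceVector (Γ × Λ) (Γ → K) (measX Γ K))
      map_add' := fun f g => by
        have h1 : compMap (f + g) (Prod.fst : BaseSpace Γ Λ K₁ → _) measurable_fst =
          compMap f Prod.fst measurable_fst + compMap g Prod.fst measurable_fst := rfl
        have h2 : pullback K₁ (f + g) = pullback K₁ f + pullback K₁ g := rfl
        rw [h1, h2, map_add, functionOp_add, add_apply, add_apply]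
        abel
      map_smul' := fun c f => by
        have h1 : compMap (c • f) (Prod.fst : BaseSpace Γ Λ K₁ → _) measurable_fst =
          c • compMap f Prod.fst measurable_fst := rfl
        have h2 : pullback K₁ (c • f) = c • pullback K₁ f := rfl
        rw [h1, h2, map_smul, functionOp_smul, smul_apply, smul_apply, smul_sub]
        rfl }
  refine eq_zero_of_norm_le_toL2 (η := measQuot K₁) (dense_span_charFun_top (measQuot K₁)) Φ 2
    (fun f => ?_) (fun χ => ?_) f
  · refine (norm_sub_le _ _).trans ?_
    rw [norm_canonicalIso_apply, functionOp_traceVector, norm_tensorVec, two_mul]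
    exact (congrArg₂ _ (norm_toL2_compMap (measurePreserving_fst_measBase Λ K₁) f)
      (norm_toL2_compMap (measurePreserving_mk K₁) f)).le
  · have h1 : compMap (charFun χ) (Prod.fst : BaseSpace Γ Λ K₁ → _) measurable_fst =
        modelChar Λ K₁ (χ, 1) := by
      refine Subtype.ext (funext fun z => ?_)
      rw [modelChar_val, show evalChar (1 : ↥(Λ ⊓ K₁)) z.2 = 1 from congr(($evalFun_one).1 z.2),
        mul_one]
      rfl
    change canonicalIso Λ K₁ (compMap (charFun χ) Prod.fst measurable_fst) _ - _ = 0
    rw [h1, canonicalIso_modelChar]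
    have h2 : modelOp Λ K₁ (χ, 1) =
        functionOp (Γ × Λ) (measX Γ K) (pullback K₁ (charFun χ)) * 1 :=
      congrArg (functionOp (Γ × Λ) (measX Γ K) (pullback K₁ (charFun χ)) * ·) (groupUnitary_one _)
    rw [h2, mul_one, sub_self]

theorem canonicalIso_character (s : ↥(Λ ⊓ K₁)) :
    canonicalIso Λ K₁ (compMap (evalFun s) Prod.snd measurable_snd) =
      groupUnitary (measX Γ K) ((1, Subgroup.inclusion inf_le_left s) : Γ × Λ) := by
  have h1 : compMap (evalFun s) (Prod.snd : BaseSpace Γ Λ K₁ → _) measurable_snd =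
      modelChar Λ K₁ (1, s) := (one_mul _).symm
  rw [h1, canonicalIso_modelChar]
  exact (congrArg (· * _) (functionOp_one _)).trans (one_mul _)

end Model

/-! ### The relative commutant and maximality -/

section Commutants

variable {Γ : Type*} [Group Γ] [Countable Γ] [MeasurableSpace Γ] [DiscreteMeasurableSpace Γ]
  {K : Type*} [CommGroup K] [TopologicalSpace K] [IsTopologicalGroup K] [CompactSpace K]
  [T2Space K] [SecondCountableTopology K] [MeasurableSpace K] [BorelSpace K]
  {Λ : Subgroup K} [Countable Λ] {K₁ : Subgroup K}
  {x : RegularSpace (Γ × Λ) (Γ → K) (measX Γ K) →L[ℂ] RegularSpace (Γ × Λ) (Γ → K) (measX Γ K)}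

theorem isTracialVector_algM : IsTracialVector (algM Γ Λ) (traceVector (Γ × Λ) (Γ → K) (measX Γ K)) := isTracialVector_traceVector _

theorem closure_inf_le (hK₁ : IsClosed (K₁ : Set K)) : (Λ ⊓ K₁).topologicalClosure ≤ K₁ :=
  Subgroup.topologicalClosure_minimal _ inf_le_right hK₁

theorem diagChar_eq_one_of_mem_closure {D : Subgroup K} {χ : PontryaginDual (Γ → K)}
    (h : ∀ s ∈ D, diagChar χ s = 1) {k : K} (hk : k ∈ D.topologicalClosure) :
    diagChar χ k = 1 :=
  closure_minimal (t := {k | diagChar χ k = 1}) h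
    (isClosed_eq (map_continuous (diagChar χ)) continuous_const) hk

theorem mem_commutant_of_commute
    (h1 : ∀ f : BddMeas (QuotX Γ K₁), functionOp (Γ × Λ) (measX Γ K) (pullback K₁ f) * x =
      x * functionOp (Γ × Λ) (measX Γ K) (pullback K₁ f))
    (h2 : ∀ s : Λ, (s : K) ∈ K₁ → groupUnitary (measX Γ K) ((1, s) : Γ × Λ) * x =
      x * groupUnitary (measX Γ K) ((1, s) : Γ × Λ)) :
    ∀ a ∈ algC Γ Λ K₁, a * x = x * a := by
  intro a ha
  refine (mem_generatedBy_iff.1 ha x ?_ ?_).symm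
  · rintro _ (⟨f, rfl⟩ | ⟨s, hs, rfl⟩)
    · exact h1 f
    · exact h2 s hs
  · rintro _ (⟨f, rfl⟩ | ⟨s, hs, rfl⟩)
    · simp only [star_pullback]
      exact h1 _
    · rw [star_groupUnitary_one]
      exact h2 _ (inv_mem hs)

/-- The Fourier support of an element of the relative commutant of `C(K₁)`. -/
theorem apply_mem_closure_span {K₂ : Subgroup K} [BorelSpace (QuotX Γ K₂)]
    (hK₂ : (Λ ⊓ K₁).topologicalClosure = K₂)
    (hΓK : (Infinite Γ ∧ Nontrivial K) ∨ Subsingleton Γ)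
    (hK₁ : IsClosed (K₁ : Set K)) (hx : x ∈ relativeCommutant (algC Γ Λ K₁) (algM Γ Λ)) :
    x (traceVector (Γ × Λ) (Γ → K) (measX Γ K)) ∈ closure (Submodule.span ℂ (Set.range fun i => modelOp Λ K₂ i (traceVector (Γ × Λ) (Γ → K) (measX Γ K))) : Set _) := by
  subst hK₂
  let S : Set ((Γ × Λ) × PontryaginDual (Γ → K)) :=
    {p | p.1.1 = 1 ∧ (p.1.2 : K) ∈ K₁ ∧ ∀ s ∈ Λ ⊓ K₁, diagChar p.2 s = 1}
  have h := mem_closure_span_of_inner_eq_zero (orthonormal_fourierVec Λ) (dense_span_fourierVec Λ)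
    S (ξ := x (traceVector (Γ × Λ) (Γ → K) (measX Γ K))) (by
      rintro ⟨p, χ⟩ hp
      by_contra hne
      have h1 := fst_eq_one_of_inner_ne_zero Λ hΓK hx hne
      refine hp ⟨h1, snd_mem_of_inner_ne_zero Λ hK₁ hx h1 hne, fun s hs => ?_⟩
      exact diagChar_eq_one_of_inner_ne_zero Λ hx.1 (s := ⟨s, hs.1⟩)
        (hx.2 _ (groupUnitary_mem_algC Λ K₁ (s := ⟨s, hs.1⟩) hs.2)) hne)
  refine closure_mono (Submodule.span_mono ?_) h
  rintro _ ⟨⟨⟨g, s⟩, χ⟩, ⟨h1, h2, h3⟩, rfl⟩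
  -- Triviality on `Λ ∩ K₁` passes to the closure by continuity, so `χ` descends to the quotient by
  -- the closure: the surviving indices are exactly those of its model.
  obtain ⟨ψ, hψ⟩ := exists_pullbackChar_eq (Γ := Γ) (Λ ⊓ K₁).topologicalClosure (χ := χ)
    fun k hk => diagChar_eq_one_of_mem_closure h3 hk
  refine ⟨(ψ, ⟨s, s.2, Subgroup.le_topologicalClosure _ ⟨s.2, h2⟩⟩), ?_⟩
  simp only [modelOp_traceVector]
  change g = 1 at h1
  rw [hψ, h1]
  rfl

/-- The algebra for the closure contains more functions, and commutation with these is not assumed.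
It follows from the Fourier support: on the vectors `δ_s ⊗ χ` with `s ∈ Λ ∩ K₁`, left and right
multiplication by a function invariant under the closure coincide. -/
theorem commute_closure (hK₁ : IsClosed (K₁ : Set K))
    [BorelSpace (QuotX Γ (Λ ⊓ K₁).topologicalClosure)]
    (hΓK : (Infinite Γ ∧ Nontrivial K) ∨ Subsingleton Γ)
    (hx : x ∈ relativeCommutant (algC Γ Λ K₁) (algM Γ Λ)) :
    ∀ a ∈ algC Γ Λ (Λ ⊓ K₁).topologicalClosure, a * x = x * a := by
  refine mem_commutant_of_commute (fun f => ?_) fun s hs =>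
    hx.2 _ (groupUnitary_mem_algC Λ K₁ (closure_inf_le hK₁ hs))
  refine isTracialVector_algM.eq_of_apply (mul_mem (functionOp_mem_algM Λ _) hx.1)
    (mul_mem hx.1 (functionOp_mem_algM Λ _)) ?_
  rw [mul_apply_eq_comp, mul_apply_eq_comp, ← twistedFunctionOp_traceVector,
    commutant_apply Λ (twistedFunctionOp_mem _ _) hx.1]
  refine ContinuousLinearMap.eqOn_closure_span (s := Set.range fun i =>
    modelOp Λ (Λ ⊓ K₁).topologicalClosure i (traceVector (Γ × Λ) (Γ → K) (measX Γ K))) ?_ (apply_mem_closure_span rfl hΓK hK₁ hx)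
  rintro _ ⟨i, rfl⟩
  simp only [modelOp_traceVector, fourierVec]
  rw [functionOp_tensorVec, twistedFunctionOp_tensorVec, mul_comm]
  congr 2
  exact (compMap_pullback_smul_one Λ (Λ ⊓ K₁).topologicalClosure
    (s := Subgroup.inclusion inf_le_left i.2) i.2.2.2 f).symm

/-- An element of the relative commutant commutes with the larger abelian algebra for the closure,
and its vector lies in the closed subspace generated by that algebra. It is therefore a bounded
function in its model, and the separating trace vector identifies the operators. Conversely, the
larger algebra is abelian and contains `C(K₁)`. -/
theorem relativeCommutant_algC (hΓK : (Infinite Γ ∧ Nontrivial K) ∨ Subsingleton Γ)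
    (hK₁ : IsClosed (K₁ : Set K)) :
    relativeCommutant (algC Γ Λ K₁) (algM Γ Λ) = algC Γ Λ (Λ ⊓ K₁).topologicalClosure := by
  have hK₂ := Subgroup.isClosed_topologicalClosure (Λ ⊓ K₁)
  have := borelSpace_quotX Γ hK₂
  haveI := t2Space_quotX Γ hK₂
  refine Set.Subset.antisymm (fun x hx => ?_) fun x hx => ?_
  · obtain ⟨F, hF⟩ := (isAbelianModel Λ (Λ ⊓ K₁).topologicalClosure).exists_repr_vec_eq
      (commute_closure hK₁ hΓK hx) (apply_mem_closure_span rfl hΓK hK₁ hx)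
    have hm := (isAbelianModel (Γ := Γ) Λ (Λ ⊓ K₁).topologicalClosure).repr_mem F
    rw [SetLike.mem_coe, ← isTracialVector_algM.eq_of_apply (algC_le_algM Λ _ hm) hx.1 hF]
    exact hm
  · exact ⟨algC_le_algM Λ _ hx, fun a ha => commute_algC Λ _
      (algC_le_of_le Λ (closure_inf_le hK₁) (Subgroup.le_topologicalClosure _) ha) hx⟩

theorem isMaximalAbelian_of_dense (hΓK : (Infinite Γ ∧ Nontrivial K) ∨ Subsingleton Γ)
    (hK₁ : IsClosed (K₁ : Set K)) (h : (Λ ⊓ K₁).topologicalClosure = K₁) :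
    IsMaximalAbelian (algC Γ Λ K₁) (algM Γ Λ) := by
  refine ⟨⟨algC_le_algM Λ K₁, fun x hx y hy => commute_algC Λ K₁ hx hy⟩, ?_⟩
  rintro B ⟨hB1, hB2⟩ hB x hx
  have h1 := relativeCommutant_algC (Λ := Λ) hΓK hK₁
  rw [h] at h1
  rw [← SetLike.mem_coe, ← h1]
  exact ⟨hB1 hx, fun a ha => hB2 a (hB ha) x hx⟩

/-- The unitary `(V_k ξ)(h, x) = ξ(h, k x)`, for `k ∈ K` acting diagonally. -/
def diagTranslation (Λ : Subgroup K) [Countable Λ] (k : K) :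
    RegularSpace (Γ × Λ) (Γ → K) (measX Γ K) →L[ℂ] RegularSpace (Γ × Λ) (Γ → K) (measX Γ K) :=
  (Lp.compMeasurePreservingₗᵢ ℂ (fun p : (Γ × Λ) × (Γ → K) => (p.1, diagHom Γ k * p.2))
    ((MeasurePreserving.id _).prod (measurePreserving_mul_measX (diagHom Γ k)))).toContinuousLinearMap

theorem coeFn_diagTranslation (k : K) (ξ : RegularSpace (Γ × Λ) (Γ → K) (measX Γ K)) :
    diagTranslation Λ k ξ =ᵐ[(Measure.count : Measure (Γ × Λ)).prod (measX Γ K)]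
      fun p => ξ (p.1, diagHom Γ k * p.2) :=
  Lp.coeFn_compMeasurePreserving ξ _

theorem ae_diagTranslation (k : K) {Q : (Γ × Λ) × (Γ → K) → Prop}
    (h : ∀ᵐ p ∂((Measure.count : Measure (Γ × Λ)).prod (measX Γ K)), Q p) :
    ∀ᵐ p ∂((Measure.count : Measure (Γ × Λ)).prod (measX Γ K)), Q (p.1, diagHom Γ k * p.2) :=
  ((MeasurePreserving.id (Measure.count : Measure (Γ × Λ))).prod
    (measurePreserving_mul_measX (diagHom Γ k))).quasiMeasurePreserving.ae h

theorem diagTranslation_mul_functionOp (k : K) (f : BddMeas (Γ → K)) :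
    diagTranslation Λ k * functionOp (Γ × Λ) (measX Γ K) f =
      functionOp (Γ × Λ) (measX Γ K)
        (compMap f (fun x => diagHom Γ k * x) (measurable_const_mul _)) * diagTranslation Λ k := by
  ext1 ξ
  refine Lp.ext ?_
  filter_upwards [coeFn_diagTranslation k (functionOp (Γ × Λ) (measX Γ K) f ξ),
    ae_diagTranslation k (coeFn_functionOp (measX Γ K) f ξ),
    coeFn_functionOp (measX Γ K) (compMap f (fun x => diagHom Γ k * x) (measurable_const_mul _))
      (diagTranslation Λ k ξ), coeFn_diagTranslation k ξ] with p h1 h2 h3 h4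
  rw [mul_apply_eq_comp, mul_apply_eq_comp, h1, h2, h3, h4]
  rfl

theorem smul_diagHom_mul (g : Γ × Λ) (k : K) (x : Γ → K) :
    g⁻¹ • (diagHom Γ k * x) = diagHom Γ k * (g⁻¹ • x) := by
  rw [smul_eq_shift, smul_eq_shift, _root_.map_mul, mul_left_comm]
  rfl

theorem diagTranslation_mul_groupUnitary (k : K) (g : Γ × Λ) :
    diagTranslation Λ k * groupUnitary (measX Γ K) g =
      groupUnitary (measX Γ K) g * diagTranslation Λ k := by
  ext1 ξ
  refine Lp.ext ?_
  filter_upwards [coeFn_diagTranslation k (groupUnitary (measX Γ K) g ξ),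
    ae_diagTranslation k (coeFn_groupUnitary (measX Γ K) g ξ),
    coeFn_groupUnitary (measX Γ K) g (diagTranslation Λ k ξ),
    ae_groupUnitary (measX Γ K) (coeFn_diagTranslation k ξ) g] with p h1 h2 h3 h4
  rw [mul_apply_eq_comp, mul_apply_eq_comp, h1, h2, h3, h4, smul_diagHom_mul]

theorem compMap_charFun_diagHom (k : K) (χ : PontryaginDual (Γ → K)) :
    compMap (charFun χ) (fun x => diagHom Γ k * x) (measurable_const_mul _) =
      (diagChar χ k : ℂ) • charFun χ := by
  refine Subtype.ext (funext fun x => ?_)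
  change ((χ (diagHom Γ k * x) : Circle) : ℂ) = (diagChar χ k : ℂ) * (χ x : ℂ)
  rw [_root_.map_mul, Circle.coe_mul]
  rfl

/-- For `k ∈ K₁` the translation `V_k` commutes with the generators of `C(K₁)`, hence with `χ`; but
conjugation by `V_k` multiplies `χ` by its value on the diagonal element `k`. -/
theorem diagChar_eq_one_of_mem_algC {χ : PontryaginDual (Γ → K)}
    (hχ : functionOp (Γ × Λ) (measX Γ K) (charFun χ) ∈ algC Γ Λ K₁) {k : K} (hk : k ∈ K₁) :
    diagChar χ k = 1 := by
  have h1 := mem_commutant_of_commute (x := diagTranslation Λ k) (K₁ := K₁) (fun f => by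
      rw [diagTranslation_mul_functionOp]
      congr 2
      exact Subtype.ext (funext fun x => (pullback_invariant K₁ f hk x).symm))
    (fun s _ => (diagTranslation_mul_groupUnitary k _).symm) _ hχ
  rw [diagTranslation_mul_functionOp, compMap_charFun_diagHom, functionOp_smul, smul_mul_assoc]
    at h1
  have h2 : star (functionOp (Γ × Λ) (measX Γ K) (charFun χ)) *
      functionOp (Γ × Λ) (measX Γ K) (charFun χ) = 1 := by
    rw [star_functionOp, ← functionOp_mul, ← charFun_inv, ← _root_.map_mul charFun,
      inv_mul_cancel, _root_.map_one charFun, functionOp_one]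
  have h3 := congr(star (functionOp (Γ × Λ) (measX Γ K) (charFun χ)) * $h1)
  rw [mul_smul_comm, ← mul_assoc, h2, one_mul] at h3
  have h4 : diagTranslation Λ k (traceVector (Γ × Λ) (Γ → K) (measX Γ K)) ≠ 0 := by
    rw [Ne, ← norm_eq_zero]
    have : ‖diagTranslation Λ k (traceVector (Γ × Λ) (Γ → K) (measX Γ K))‖ = ‖(traceVector (Γ × Λ) (Γ → K) (measX Γ K))‖ := LinearIsometry.norm_map _ _
    rw [this, ← fourierVec_one_one, (orthonormal_fourierVec Λ).1]
    exact one_ne_zero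
  have h5 := congr($h3 (traceVector (Γ × Λ) (Γ → K) (measX Γ K)))
  rw [smul_apply] at h5
  refine Circle.ext ?_
  have h6 : (1 : ℂ) • diagTranslation Λ k (traceVector (Γ × Λ) (Γ → K) (measX Γ K)) = (diagChar χ k : ℂ) • diagTranslation Λ k (traceVector (Γ × Λ) (Γ → K) (measX Γ K)) := by
    rw [← h5, one_smul]
  exact (smul_left_injective ℂ h4 h6).symm

/-- Maximality forces the abelian algebra for the closure into `C(K₁)`. A character of `K` trivial
on the closure but not at some `k ∈ K₁` gives an element of the former that is not in the latter. -/
theorem dense_of_isMaximalAbelian (hK₁ : IsClosed (K₁ : Set K))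
    (h : IsMaximalAbelian (algC Γ Λ K₁) (algM Γ Λ)) : (Λ ⊓ K₁).topologicalClosure = K₁ := by
  have hle : algC Γ Λ (Λ ⊓ K₁).topologicalClosure ≤ algC Γ Λ K₁ :=
    h.2 ⟨algC_le_algM Λ _, fun x hx y hy => commute_algC Λ _ hx hy⟩
      (algC_le_of_le Λ (closure_inf_le hK₁) (Subgroup.le_topologicalClosure _))
  refine le_antisymm (closure_inf_le hK₁) fun k hk => ?_
  by_contra hk'
  obtain ⟨ω, h1, h2⟩ := exists_character_of_notMem _
    (Subgroup.isClosed_topologicalClosure (Λ ⊓ K₁)) hk'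
  refine h2 ?_
  have := diagChar_eq_one_of_mem_algC (χ := coordChar (1 : Γ) ω)
    (hle (functionOp_charFun_mem_algC Λ _ fun k hk => h1 k hk)) hk
  exact this

end Commutants

/-! ### `M` is a II₁ factor -/

section Factor

variable {Γ : Type*} [Group Γ] [Countable Γ] [MeasurableSpace Γ] [DiscreteMeasurableSpace Γ]
  {K : Type*} [CommGroup K] [TopologicalSpace K] [IsTopologicalGroup K] [CompactSpace K]
  [T2Space K] [SecondCountableTopology K] [MeasurableSpace K] [BorelSpace K]
  {Λ : Subgroup K} [Countable Λ]

/-- The projection `1 - v v*` has the same trace as `1 - v* v = 0`, so it kills the separating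
vector. -/
theorem IsTracialVector.mul_star_eq_one {H : Type*} [NormedAddCommGroup H] [InnerProductSpace ℂ H]
    [CompleteSpace H] {M : VonNeumannAlgebra H} {Ω : H} (h : IsTracialVector M Ω) {v : H →L[ℂ] H}
    (hv : v ∈ M) (hv1 : star v * v = 1) : v * star v = 1 := by
  have hmem : 1 - v * star v ∈ M := sub_mem (one_mem _) (mul_mem hv (star_mem hv))
  have hproj : star (1 - v * star v) * (1 - v * star v) = 1 - v * star v := by
    rw [star_sub, star_one, star_mul, star_star, mul_sub, mul_one, sub_mul, one_mul, sub_eq_self,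
      sub_eq_zero]
    rw [mul_assoc, ← mul_assoc (star v), hv1, one_mul]
  refine (sub_eq_zero.1 (h.separating _ hmem ?_)).symm
  have h1 : inner ℂ ((1 - v * star v) Ω) ((1 - v * star v) Ω) = 0 := by
    rw [inner_apply_eq_star (1 - v * star v), ← mul_apply_eq_comp, ← star_star (_ * _),
      ← inner_apply_eq_star, star_mul, star_star, hproj, sub_apply, one_apply_eq_self,
      inner_sub_right, mul_apply_eq_comp, h.tracial v hv _ (star_mem hv), ← mul_apply_eq_comp, hv1,
      one_apply_eq_self, sub_self]
  exact inner_self_eq_zero.1 h1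

/-- A central element commutes with `C({1})`, which confines its support to `p = 1`. If `Γ` is
infinite, commuting with `u_γ` makes the modulus of the coefficients constant along the shift orbit
of `χ`, which is infinite unless `χ = 1`. If `Γ` is trivial, commuting with `u_s` makes `χ` trivial
on the dense subgroup `Λ`. -/
theorem eq_one_of_inner_ne_zero (hΛ : Dense (Λ : Set K))
    (hΓK : (Infinite Γ ∧ Nontrivial K) ∨ Subsingleton Γ)
    {z : RegularSpace (Γ × Λ) (Γ → K) (measX Γ K) →L[ℂ] RegularSpace (Γ × Λ) (Γ → K) (measX Γ K)}
    (hz : z ∈ algM Γ Λ) (hc : ∀ x ∈ algM Γ Λ, x * z = z * x)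
    {p : Γ × Λ} {χ : PontryaginDual (Γ → K)} (hne : inner ℂ (fourierVec Λ (p, χ)) (z (traceVector (Γ × Λ) (Γ → K) (measX Γ K))) ≠ 0) :
    p = 1 ∧ χ = 1 := by
  have hrel : z ∈ relativeCommutant (algC Γ Λ (⊥ : Subgroup K)) (algM Γ Λ) :=
    ⟨hz, fun a ha => hc a (algC_le_algM Λ _ ha)⟩
  have h1 := fst_eq_one_of_inner_ne_zero Λ hΓK hrel hne
  have h2 := snd_mem_of_inner_ne_zero Λ (by simp) hrel h1 hne
  have hp : p = 1 := Prod.ext h1 (Subtype.ext (Subgroup.mem_bot.1 h2))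
  refine ⟨hp, ?_⟩
  rcases hΓK with ⟨hΓ, -⟩ | hΓ
  · by_contra hχ
    let c : PontryaginDual (Γ → K) → ℂ := fun ψ => inner ℂ (fourierVec Λ (1, ψ)) (z (traceVector (Γ × Λ) (Γ → K) (measX Γ K)))
    have hcne : c χ ≠ 0 := by rwa [hp] at hne
    have hfin : {ψ | ‖c χ‖ ≤ ‖c ψ‖}.Finite :=
      finite_setOf_le_norm_inner ((orthonormal_fourierVec Λ).comp (fun ψ => (1, ψ))
        (Prod.mk_right_injective (1 : Γ × Λ))) (z (traceVector (Γ × Λ) (Γ → K) (measX Γ K))) (norm_pos_iff.2 hcne)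
    have hF : (fun γ : Γ => shiftChar γ χ) ⁻¹' {ψ | ‖c χ‖ ≤ ‖c ψ‖} = univ := by
      refine eq_univ_of_forall fun γ => ?_
      have e := inner_fourierVec_conj Λ hz (hc _ (groupUnitary_mem_algM Λ (γ⁻¹, 1))) (γ⁻¹, 1) χ
      rw [mul_inv_cancel, inv_mul_cancel] at e
      have e2 : shiftChar ((γ⁻¹, 1) : Γ × Λ)⁻¹.1 χ = shiftChar γ χ := by
        change shiftChar γ⁻¹⁻¹ χ = _
        rw [inv_inv]
      rw [e2] at e
      change ‖c χ‖ ≤ ‖c (shiftChar γ χ)‖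
      change c χ = _ * c (shiftChar γ χ) at e
      rw [e, norm_mul, Circle.norm_coe, one_mul]
    have := hfin.preimage' (f := fun γ : Γ => shiftChar γ χ)
      fun ψ _ => finite_setOf_shiftChar_eq hχ ψ
    rw [hF] at this
    exact infinite_univ this
  · refine PontryaginDual.ext fun x => ?_
    have h3 : ∀ k, diagChar χ k = 1 := fun k => by
      refine diagChar_eq_one_of_mem_closure (D := Λ) (fun s hs => ?_) (hΛ k)
      exact diagChar_eq_one_of_inner_ne_zero Λ hz (s := ⟨s, hs⟩)
        (hc _ (groupUnitary_mem_algM Λ _)) hne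
    -- For trivial `Γ` every point of `K^Γ` is diagonal.
    have h4 : x = diagHom Γ (x 1) := funext fun a => congrArg x (Subsingleton.elim _ _)
    rw [h4]
    exact h3 _

theorem infinite_of_dense (hΛ : Dense (Λ : Set K))
    (hΓK : (Infinite Γ ∧ Nontrivial K) ∨ (Subsingleton Γ ∧ Infinite K)) : Infinite (Γ × Λ) := by
  rcases hΓK with ⟨hΓ, -⟩ | ⟨-, hK⟩
  · exact inferInstance
  · haveI : Infinite Λ := by
      by_contra hfin
      rw [not_infinite_iff_finite] at hfin
      have h1 : (Λ : Set K).Finite := Set.toFinite _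
      have h2 : (Λ : Set K) = univ := by rw [← h1.isClosed.closure_eq, hΛ.closure_eq]
      rw [h2] at h1
      exact infinite_univ h1
    exact inferInstance

theorem isTypeIIOneFactor_algM (hΛ : Dense (Λ : Set K))
    (hΓK : (Infinite Γ ∧ Nontrivial K) ∨ (Subsingleton Γ ∧ Infinite K)) :
    IsTypeIIOneFactor (algM Γ Λ) where
  center_trivial z hz hc := by
    have h := mem_closure_span_of_inner_eq_zero (orthonormal_fourierVec Λ)
      (dense_span_fourierVec Λ) {((1 : Γ × Λ), (1 : PontryaginDual (Γ → K)))} (ξ := z (traceVector (Γ × Λ) (Γ → K) (measX Γ K))) (by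
        rintro ⟨p, χ⟩ hp
        by_contra hne
        obtain ⟨h1, h2⟩ := eq_one_of_inner_ne_zero hΛ (hΓK.imp id And.left) hz hc hne
        exact hp (by rw [h1, h2]; rfl))
    rw [image_singleton, fourierVec_one_one,
      (Submodule.closed_of_finiteDimensional _).closure_eq] at h
    obtain ⟨c, hcz⟩ := Submodule.mem_span_singleton.1 h
    refine ⟨c, isTracialVector_algM.eq_of_apply hz 
      ((algM Γ Λ).toStarSubalgebra.smul_mem (one_mem _) c) ?_⟩
    rw [smul_apply, one_apply_eq_self, hcz]
  infinite_dimensional hfin := by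
    haveI := infinite_of_dense hΛ hΓK
    let L : (algM Γ Λ).toStarSubalgebra →ₗ[ℂ] RegularSpace (Γ × Λ) (Γ → K) (measX Γ K) :=
      { toFun := fun y => (y : _ →L[ℂ] _) (traceVector (Γ × Λ) (Γ → K) (measX Γ K))
        map_add' := fun _ _ => rfl
        map_smul' := fun _ _ => rfl }
    let v : Γ × Λ → (algM Γ Λ).toStarSubalgebra :=
      fun g => ⟨groupUnitary (measX Γ K) g, groupUnitary_mem_algM Λ g⟩
    have hv : ∀ g, L (v g) = fourierVec Λ (g, 1) := fun g => by
      rw [fourierVec, tensorVec, _root_.map_one charFun, functionOp_one, one_apply_eq_self]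
      rfl
    -- The unitaries `u_g` send the trace vector to the orthonormal vectors `δ_g ⊗ 1`.
    have hli : LinearIndependent ℂ v := by
      refine LinearIndependent.of_comp L ?_
      have : L ∘ v = fourierVec Λ ∘ fun g => (g, 1) := funext hv
      rw [this]
      exact ((orthonormal_fourierVec Λ).comp _
        (Prod.mk_left_injective (1 : PontryaginDual (Γ → K)))).linearIndependent
    exact not_finite_iff_infinite.2 this hli.finite
  finite v hv hv1 := isTracialVector_algM.mul_star_eq_one hv hv1

end Factor

theorem IsTracialVector.norm_apply_unitary {H : Type*} [NormedAddCommGroup H]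
    [InnerProductSpace ℂ H] [CompleteSpace H] {M : VonNeumannAlgebra H} {Ω : H}
    (h : IsTracialVector M Ω) {y w : H →L[ℂ] H} (hy : y ∈ M) (hw : w ∈ M)
    (hw1 : w * star w = 1) : ‖y (w Ω)‖ = ‖y Ω‖ := by
  have h1 : inner ℂ (y (w Ω)) (y (w Ω)) = inner ℂ (y Ω) (y Ω) := by
    have e1 : inner ℂ (y (w Ω)) (y (w Ω)) = inner ℂ Ω ((star w) ((star y * y * w) Ω)) := by
      rw [inner_apply_eq_star (star w), star_star, mul_apply_eq_comp, mul_apply_eq_comp,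
        inner_apply_eq_star (star y), star_star]
    rw [e1, h.tracial _ (star_mem hw) _ (mul_mem (mul_mem (star_mem hy) hy) hw),
      ← mul_apply_eq_comp, mul_assoc, hw1, mul_one, mul_apply_eq_comp,
      inner_apply_eq_star (star y), star_star]
  rw [inner_self_eq_norm_sq_to_K, inner_self_eq_norm_sq_to_K] at h1
  have h2 : ‖y (w Ω)‖ ^ 2 = ‖y Ω‖ ^ 2 := by exact_mod_cast h1
  exact (sq_eq_sq₀ (norm_nonneg _) (norm_nonneg _)).1 h2

/-! ### The action implemented by the unitaries `χ u_g` -/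

section Action

variable {Γ : Type*} [Group Γ] [Countable Γ] [MeasurableSpace Γ] [DiscreteMeasurableSpace Γ]
  {K : Type*} [CommGroup K] [TopologicalSpace K] [IsTopologicalGroup K] [CompactSpace K]
  [T2Space K] [SecondCountableTopology K] [MeasurableSpace K] [BorelSpace K]
  (Λ : Subgroup K) [Countable Λ] (K₁ : Subgroup K)

/-- The quotient map from `Λ` onto `ΛK₁/K₁`. -/
def toQuotΛ : Λ →* quotΛ Λ K₁ :=
  ((QuotientGroup.mk' K₁).comp Λ.subtype).codRestrict (quotΛ Λ K₁)
    fun s => ⟨s, Subgroup.mem_sup_left s.2, rfl⟩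

theorem toQuotΛ_surjective : Function.Surjective (toQuotΛ Λ K₁) := by
  rintro ⟨_, k, hk, rfl⟩
  obtain ⟨s, hs, k', hk', rfl⟩ := Subgroup.mem_sup.1 hk
  refine ⟨⟨s, hs⟩, Subtype.ext ?_⟩
  exact QuotientGroup.eq.2 (by simpa using hk')

instance : Countable (quotΛ Λ K₁) := (toQuotΛ_surjective Λ K₁).countable

theorem smul_mk (g : Γ × Λ) (x : Γ → K) :
    ((g.1, toQuotΛ Λ K₁ g.2) : Γ × quotΛ Λ K₁) • (x : QuotX Γ K₁) = ((g • x : Γ → K) : QuotX Γ K₁) :=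
  rfl

theorem measurePreserving_smul_quotX (q : Γ × quotΛ Λ K₁) :
    MeasurePreserving (fun y : QuotX Γ K₁ => q • y) (measQuot K₁) (measQuot K₁) := by
  obtain ⟨γ, s⟩ := q
  obtain ⟨s, rfl⟩ := toQuotΛ_surjective Λ K₁ s
  have h1 := (measurePreserving_mk (Γ := Γ) K₁).comp
    (measurePreserving_smul ((γ, s) : Γ × Λ) (measX Γ K))
  have hm : Measurable fun y : QuotX Γ K₁ => ((γ, toQuotΛ Λ K₁ s) : Γ × quotΛ Λ K₁) • y :=
    measurable_from_quotient.2 h1.measurable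
  refine ⟨hm, ?_⟩
  rw [Measure.map_map hm QuotientGroup.measurable_coe]
  exact h1.map_eq

theorem measurePreserving_smul_base (q : (Γ × quotΛ Λ K₁) × PontryaginDual K₁) :
    MeasurePreserving (fun z : BaseSpace Γ Λ K₁ => q • z) (measBase Γ Λ K₁) (measBase Γ Λ K₁) :=
  (measurePreserving_smul_quotX Λ K₁ q.1).prod
    (measurePreserving_mul_haarProb (PontryaginDual.map (inclHom Λ K₁) q.2))

instance : MeasurableConstSMul ((Γ × quotΛ Λ K₁) × PontryaginDual K₁) (BaseSpace Γ Λ K₁) :=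
  ⟨fun q => (measurePreserving_smul_base Λ K₁ q).measurable⟩

instance : SMulInvariantMeasure ((Γ × quotΛ Λ K₁) × PontryaginDual K₁) (BaseSpace Γ Λ K₁)
    (measBase Γ Λ K₁) :=
  ⟨fun q _ hs => (measurePreserving_smul_base Λ K₁ q).measure_preimage hs.nullMeasurableSet⟩

theorem countable_dual_subgroup (hK₁ : IsClosed (K₁ : Set K)) : Countable (PontryaginDual K₁) := by
  haveI : CompactSpace K₁ := isCompact_iff_compactSpace.1 hK₁.isCompact
  haveI : SecondCountableTopology K₁ := TopologicalSpace.Subtype.secondCountableTopology _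
  exact inferInstance

/-- The restriction of characters to a subgroup. -/
def restrictChar (χ : PontryaginDual K) : PontryaginDual K₁ :=
  PontryaginDual.map ⟨K₁.subtype, continuous_subtype_val⟩ χ

/-- The element of `(Γ × ΛK₁/K₁) × K̂₁` by which the unitary `χ u_g` acts on `X/K₁ × Λ̂₁`. -/
def implementer (j : (Γ × Λ) × PontryaginDual (Γ → K)) :
    (Γ × quotΛ Λ K₁) × PontryaginDual K₁ :=
  ((j.1.1, toQuotΛ Λ K₁ j.1.2), (restrictChar K₁ (diagChar j.2))⁻¹)

/-- A character of the closed subgroup `K₁` extends to `K`; read at the coordinate `1`, the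
extension is a character of `X` with the prescribed restriction to the diagonal. -/
theorem implementer_surjective (hK₁ : IsClosed (K₁ : Set K)) :
    Function.Surjective (implementer (Γ := Γ) Λ K₁) := by
  rintro ⟨⟨γ, s⟩, ω⟩
  obtain ⟨s, rfl⟩ := toQuotΛ_surjective Λ K₁ s
  obtain ⟨χ, hχ⟩ := exists_character_extension K₁ hK₁ ω⁻¹
  refine ⟨((γ, s), coordChar 1 χ), Prod.ext rfl ?_⟩
  change (restrictChar K₁ (diagChar (coordChar (1 : Γ) χ)))⁻¹ = ω
  rw [inv_eq_iff_eq_inv]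
  exact PontryaginDual.ext hχ

/-- The unitaries `χ u_g`. -/
def fourierOp (j : (Γ × Λ) × PontryaginDual (Γ → K)) :
    RegularSpace (Γ × Λ) (Γ → K) (measX Γ K) →L[ℂ] RegularSpace (Γ × Λ) (Γ → K) (measX Γ K) :=
  functionOp (Γ × Λ) (measX Γ K) (charFun j.2) * groupUnitary (measX Γ K) j.1

theorem fourierOp_mem (j : (Γ × Λ) × PontryaginDual (Γ → K)) : fourierOp Λ j ∈ algM Γ Λ :=
  mul_mem (functionOp_mem_algM Λ _) (groupUnitary_mem_algM Λ _)

theorem functionOp_charFun_mem_unitary (χ : PontryaginDual (Γ → K)) :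
    functionOp (Γ × Λ) (measX Γ K) (charFun χ) ∈
      unitary (RegularSpace (Γ × Λ) (Γ → K) (measX Γ K) →L[ℂ]
        RegularSpace (Γ × Λ) (Γ → K) (measX Γ K)) := by
  rw [Unitary.mem_iff, star_functionOp, ← functionOp_mul, ← functionOp_mul, ← charFun_inv,
    ← _root_.map_mul charFun, ← _root_.map_mul charFun, inv_mul_cancel, mul_inv_cancel,
    _root_.map_one charFun, functionOp_one]
  exact ⟨rfl, rfl⟩

theorem groupUnitary_mem_unitary (g : Γ × Λ) :
    groupUnitary (measX Γ K) g ∈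
      unitary (RegularSpace (Γ × Λ) (Γ → K) (measX Γ K) →L[ℂ]
        RegularSpace (Γ × Λ) (Γ → K) (measX Γ K)) := by
  rw [Unitary.mem_iff, star_groupUnitary, ← groupUnitary_mul, ← groupUnitary_mul, inv_mul_cancel,
    mul_inv_cancel, groupUnitary_one]
  exact ⟨rfl, rfl⟩

theorem fourierOp_mem_unitary (j : (Γ × Λ) × PontryaginDual (Γ → K)) :
    fourierOp Λ j ∈ unitary (RegularSpace (Γ × Λ) (Γ → K) (measX Γ K) →L[ℂ]
        RegularSpace (Γ × Λ) (Γ → K) (measX Γ K)) :=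
  mul_mem (functionOp_charFun_mem_unitary Λ _) (groupUnitary_mem_unitary Λ _)

theorem groupUnitary_mul_charFun (g : Γ × Λ) (χ : PontryaginDual (Γ → K)) :
    groupUnitary (measX Γ K) g * functionOp (Γ × Λ) (measX Γ K) (charFun χ) =
      conj (diagChar χ g.2 : ℂ) • (functionOp (Γ × Λ) (measX Γ K) (charFun (shiftChar g.1 χ)) *
        groupUnitary (measX Γ K) g) := by
  rw [groupUnitary_mul_functionOp, compMap_charFun_smul, functionOp_smul, smul_mul_assoc]

theorem coe_circle_mul_conj (z : Circle) : (z : ℂ) * conj (z : ℂ) = 1 := by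
  rw [← Circle.coe_inv_eq_conj, ← Circle.coe_mul, mul_inv_cancel, Circle.coe_one]

variable [BorelSpace (QuotX Γ K₁)]

/-- Two commutations produce the scalar: moving `u_g` past the invariant character, and moving the
character `j.2` past `u_s` with `s ∈ Λ ∩ K₁`. The latter is what `K̂₁` records. -/
theorem fourierOp_mul_modelOp (j : (Γ × Λ) × PontryaginDual (Γ → K)) (i : ModelIndex (Γ := Γ) Λ K₁)
    {ψ : PontryaginDual (QuotX Γ K₁)}
    (hψ : pullbackChar K₁ ψ = shiftChar j.1.1 (pullbackChar K₁ i.1)) :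
    fourierOp Λ j * modelOp Λ K₁ i * star (fourierOp Λ j) =
      (conj (diagChar (pullbackChar K₁ i.1) j.1.2 : ℂ) * (diagChar j.2 i.2 : ℂ)) •
        modelOp Λ K₁ (ψ, i.2) := by
  have key : fourierOp Λ j * modelOp Λ K₁ i =
      ((conj (diagChar (pullbackChar K₁ i.1) j.1.2 : ℂ) * (diagChar j.2 i.2 : ℂ)) •
        modelOp Λ K₁ (ψ, i.2)) * fourierOp Λ j := by
    have h1 : groupUnitary (measX Γ K) (inclG Λ K₁ i.2) *
        functionOp (Γ × Λ) (measX Γ K) (charFun j.2) = conj (diagChar j.2 i.2 : ℂ) •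
          (functionOp (Γ × Λ) (measX Γ K) (charFun j.2) *
            groupUnitary (measX Γ K) (inclG Λ K₁ i.2)) := by
      rw [groupUnitary_mul_charFun]
      congr 3
      exact congrArg charFun (shiftChar_one j.2)
    have h2 : groupUnitary (X := Γ → K) (measX Γ K) j.1 *
        groupUnitary (measX Γ K) (inclG Λ K₁ i.2) =
        groupUnitary (measX Γ K) (inclG Λ K₁ i.2) * groupUnitary (measX Γ K) j.1 :=
      (groupUnitary_one_commute Λ _ _).symm
    calc fourierOp Λ j * modelOp Λ K₁ i
        = functionOp (Γ × Λ) (measX Γ K) (charFun j.2) *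
          (groupUnitary (measX Γ K) j.1 *
            functionOp (Γ × Λ) (measX Γ K) (charFun (pullbackChar K₁ i.1))) *
          groupUnitary (measX Γ K) (inclG Λ K₁ i.2) := by
          rw [fourierOp, modelOp_apply]
          simp only [mul_assoc]
      _ = conj (diagChar (pullbackChar K₁ i.1) j.1.2 : ℂ) •
          ((functionOp (Γ × Λ) (measX Γ K) (charFun j.2) *
            functionOp (Γ × Λ) (measX Γ K) (charFun (pullbackChar K₁ ψ))) *
          (groupUnitary (measX Γ K) j.1 * groupUnitary (measX Γ K) (inclG Λ K₁ i.2))) := by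
          rw [groupUnitary_mul_charFun, ← hψ, mul_smul_comm, smul_mul_assoc]
          simp only [mul_assoc]
      _ = conj (diagChar (pullbackChar K₁ i.1) j.1.2 : ℂ) •
          (functionOp (Γ × Λ) (measX Γ K) (charFun (pullbackChar K₁ ψ)) *
            (functionOp (Γ × Λ) (measX Γ K) (charFun j.2) *
              groupUnitary (measX Γ K) (inclG Λ K₁ i.2)) * groupUnitary (measX Γ K) j.1) := by
          rw [h2, functionOp_commute]
          simp only [mul_assoc]
      _ = (conj (diagChar (pullbackChar K₁ i.1) j.1.2 : ℂ) * (diagChar j.2 i.2 : ℂ)) •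
          (functionOp (Γ × Λ) (measX Γ K) (charFun (pullbackChar K₁ ψ)) *
            (groupUnitary (measX Γ K) (inclG Λ K₁ i.2) *
              functionOp (Γ × Λ) (measX Γ K) (charFun j.2)) * groupUnitary (measX Γ K) j.1) := by
          have hc : (conj (diagChar (pullbackChar K₁ i.1) j.1.2 : ℂ) * (diagChar j.2 i.2 : ℂ)) *
              conj (diagChar j.2 i.2 : ℂ) = conj (diagChar (pullbackChar K₁ i.1) j.1.2 : ℂ) := by
            rw [mul_assoc, coe_circle_mul_conj, mul_one]
          rw [h1, mul_smul_comm, smul_mul_assoc, smul_smul, hc]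
      _ = _ := by
          rw [smul_mul_assoc, fourierOp, modelOp_apply]
          simp only [mul_assoc]
  rw [key, mul_assoc, (Unitary.mem_iff.1 (fourierOp_mem_unitary Λ j)).2, mul_one]

/-- The counterpart on functions of the conjugation formula for `fourierOp`. The inverse built into
`implementer` cancels the one in the composition, so that the factor from `K̂₁` appears
unconjugated, as it does for operators. -/
theorem compMap_modelChar_implementer (j : (Γ × Λ) × PontryaginDual (Γ → K))
    (i : ModelIndex (Γ := Γ) Λ K₁) {ψ : PontryaginDual (QuotX Γ K₁)}
    (hψ : pullbackChar K₁ ψ = shiftChar j.1.1 (pullbackChar K₁ i.1)) :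
    compMap (modelChar Λ K₁ i) (fun z => (implementer Λ K₁ j)⁻¹ • z) (measurable_const_smul _) =
      (conj (diagChar (pullbackChar K₁ i.1) j.1.2 : ℂ) * (diagChar j.2 i.2 : ℂ)) •
        modelChar Λ K₁ (ψ, i.2) := by
  refine Subtype.ext (funext fun z => ?_)
  obtain ⟨y, ω⟩ := z
  obtain ⟨x, rfl⟩ := QuotientGroup.mk_surjective y
  have h1 : (charFun i.1).1 (((j.1⁻¹).1, toQuotΛ Λ K₁ (j.1⁻¹).2) • (x : QuotX Γ K₁)) =
      conj (diagChar (pullbackChar K₁ i.1) j.1.2 : ℂ) * (charFun ψ).1 (x : QuotX Γ K₁) := by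
    rw [smul_mk]
    have := congr(($(compMap_charFun_smul Λ j.1 (pullbackChar K₁ i.1))).1 x)
    rw [← hψ] at this
    exact this
  have h2 : (evalFun i.2).1 (PontryaginDual.map (inclHom Λ K₁) (implementer Λ K₁ j)⁻¹.2 * ω) =
      (diagChar j.2 i.2 : ℂ) * (evalFun i.2).1 ω := by
    change (evalFun i.2).1 (PontryaginDual.map (inclHom Λ K₁)
      (restrictChar K₁ (diagChar j.2))⁻¹⁻¹ * ω) = _
    rw [inv_inv]
    rfl
  have h3 : (((implementer Λ K₁ j)⁻¹).1 : Γ × quotΛ Λ K₁) =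
      ((j.1⁻¹).1, toQuotΛ Λ K₁ (j.1⁻¹).2) :=
    Prod.ext rfl (_root_.map_inv (toQuotΛ Λ K₁) j.1.2).symm
  change (charFun i.1).1 (((implementer Λ K₁ j)⁻¹).1 • (x : QuotX Γ K₁)) *
    (evalFun i.2).1 (PontryaginDual.map (inclHom Λ K₁) (implementer Λ K₁ j)⁻¹.2 * ω) =
    (conj (diagChar (pullbackChar K₁ i.1) j.1.2 : ℂ) * (diagChar j.2 i.2 : ℂ)) *
      ((charFun ψ).1 (x : QuotX Γ K₁) * (evalFun i.2).1 ω)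
  rw [h3, h1, h2, mul_mul_mul_comm]

variable [T2Space (QuotX Γ K₁)]

/-- Applied to the trace vector, each side has norm `‖f‖₂`: the left by traciality, the right by
invariance of the measure. Their difference is thus `L²` bounded, and it vanishes on characters by
the two preceding computations. -/
theorem fourierOp_mul_canonicalIso (j : (Γ × Λ) × PontryaginDual (Γ → K))
    (f : BddMeas (BaseSpace Γ Λ K₁)) :
    fourierOp Λ j * canonicalIso Λ K₁ f * star (fourierOp Λ j) =
      canonicalIso Λ K₁ (compMap f (fun z => (implementer Λ K₁ j)⁻¹ • z)
        (measurable_const_smul _)) := by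
  have hM : ∀ F, canonicalIso Λ K₁ F ∈ algM Γ Λ := fun F =>
    algC_le_algM Λ K₁ (canonicalIso_mem Λ K₁ F)
  have hu := Unitary.mem_iff.1 (fourierOp_mem_unitary Λ j)
  refine isTracialVector_algM.eq_of_apply
    (mul_mem (mul_mem (fourierOp_mem Λ j) (hM _)) (star_mem (fourierOp_mem Λ j))) (hM _)
    (sub_eq_zero.1 ?_)
  let Φ : BddMeas (BaseSpace Γ Λ K₁) →ₗ[ℂ] RegularSpace (Γ × Λ) (Γ → K) (measX Γ K) :=
    { toFun := fun f =>
        (fourierOp Λ j * canonicalIso Λ K₁ f * star (fourierOp Λ j))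
          (traceVector (Γ × Λ) (Γ → K) (measX Γ K)) -
        canonicalIso Λ K₁ (compMap f (fun z => (implementer Λ K₁ j)⁻¹ • z)
          (measurable_const_smul _)) (traceVector (Γ × Λ) (Γ → K) (measX Γ K))
      map_add' := fun f g => by
        have h1 : compMap (f + g) (fun z => (implementer Λ K₁ j)⁻¹ • z)
            (measurable_const_smul _) =
          compMap f (fun z => (implementer Λ K₁ j)⁻¹ • z) (measurable_const_smul _) +
          compMap g (fun z => (implementer Λ K₁ j)⁻¹ • z) (measurable_const_smul _) := rfl
        rw [h1, map_add, map_add, mul_add, add_mul, add_apply, add_apply]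
        abel
      map_smul' := fun c f => by
        have h1 : compMap (c • f) (fun z => (implementer Λ K₁ j)⁻¹ • z)
            (measurable_const_smul _) =
          c • compMap f (fun z => (implementer Λ K₁ j)⁻¹ • z) (measurable_const_smul _) := rfl
        rw [h1, map_smul, map_smul, mul_smul_comm, smul_mul_assoc, smul_apply, smul_apply,
          smul_sub]
        rfl }
  refine eq_zero_of_norm_le_toL2 (dense_span_modelChar Λ K₁) Φ 2 (fun F => ?_) (fun i => ?_) f
  · refine (norm_sub_le _ _).trans ?_
    rw [norm_canonicalIso_apply, two_mul, mul_assoc, mul_apply_eq_comp, mul_apply_eq_comp]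
    refine add_le_add (le_of_eq ?_) (le_of_eq ?_)
    · have h1 := norm_star_unitary_apply (Unitary.star_mem (fourierOp_mem_unitary Λ j))
        (canonicalIso Λ K₁ F (star (fourierOp Λ j) (traceVector (Γ × Λ) (Γ → K) (measX Γ K))))
      rw [star_star] at h1
      rw [h1, isTracialVector_algM.norm_apply_unitary (hM F) (star_mem (fourierOp_mem Λ j))
        (by rw [star_star]; exact hu.1), norm_canonicalIso_apply]
    · exact norm_toL2_compMap (measurePreserving_smul_base Λ K₁ _) F
  · obtain ⟨ψ, hψ⟩ := exists_pullbackChar_eq K₁ (χ := shiftChar j.1.1 (pullbackChar K₁ i.1))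
      fun k hk => diagChar_pullbackChar K₁ i.1 hk
    change (fourierOp Λ j * canonicalIso Λ K₁ (modelChar Λ K₁ i) * star (fourierOp Λ j)) _ -
      canonicalIso Λ K₁ (compMap (modelChar Λ K₁ i) (fun z => (implementer Λ K₁ j)⁻¹ • z)
        (measurable_const_smul _)) _ = 0
    rw [compMap_modelChar_implementer Λ K₁ j i hψ, map_smul, canonicalIso_modelChar,
      canonicalIso_modelChar, fourierOp_mul_modelOp Λ K₁ j i hψ, sub_self]

end Action

/-! ### Regularity and the orbit relation -/

section Cartan

variable {Γ : Type*} [Group Γ] [Countable Γ] [MeasurableSpace Γ] [DiscreteMeasurableSpace Γ]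
  {K : Type*} [CommGroup K] [TopologicalSpace K] [IsTopologicalGroup K] [CompactSpace K]
  [T2Space K] [SecondCountableTopology K] [MeasurableSpace K] [BorelSpace K]
  {Λ : Subgroup K} [Countable Λ] {K₁ : Subgroup K}

theorem norm_functionOp_fourierVec (f : BddMeas (Γ → K))
    (p : (Γ × Λ) × PontryaginDual (Γ → K)) :
    ‖functionOp (Γ × Λ) (measX Γ K) f (fourierVec Λ p)‖ = ‖toL2 (measX Γ K) f‖ := by
  rw [fourierVec, functionOp_tensorVec, norm_tensorVec]
  refine (sq_eq_sq₀ (norm_nonneg _) (norm_nonneg _)).1 ?_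
  rw [norm_toL2_sq, norm_toL2_sq]
  refine integral_congr_ae (Filter.Eventually.of_forall fun x => ?_)
  change ‖f.1 x * (p.2 x : ℂ)‖ ^ 2 = ‖f.1 x‖ ^ 2
  rw [norm_mul, Circle.norm_coe, mul_one]

/-- An operator that commutes with the characters of `X` commutes with `L^∞(X)`. -/
theorem commute_functionOp
    {T : RegularSpace (Γ × Λ) (Γ → K) (measX Γ K) →L[ℂ] RegularSpace (Γ × Λ) (Γ → K) (measX Γ K)}
    (hT : ∀ χ, functionOp (Γ × Λ) (measX Γ K) (charFun χ) * T =
      T * functionOp (Γ × Λ) (measX Γ K) (charFun χ)) (f : BddMeas (Γ → K)) :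
    functionOp (Γ × Λ) (measX Γ K) f * T = T * functionOp (Γ × Λ) (measX Γ K) f := by
  refine ContinuousLinearMap.ext_on (dense_span_fourierVec Λ) ?_
  rintro _ ⟨q, rfl⟩
  refine sub_eq_zero.1 (Dense.eq_zero_of_inner_right ℂ (dense_span_fourierVec Λ) ?_)
  intro v hv
  induction hv using Submodule.span_induction with
  | zero => exact inner_zero_left _
  | add a b _ _ ha hb => rw [inner_add_left, ha, hb, add_zero]
  | smul c a _ ha => rw [inner_smul_left, ha, mul_zero]
  | mem v hv =>
    obtain ⟨p, rfl⟩ := hv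
    let Φ : BddMeas (Γ → K) →ₗ[ℂ] ℂ :=
      { toFun := fun f => inner ℂ (fourierVec Λ p)
          ((functionOp (Γ × Λ) (measX Γ K) f * T) (fourierVec Λ q) -
            (T * functionOp (Γ × Λ) (measX Γ K) f) (fourierVec Λ q))
        map_add' := fun f g => by
          rw [functionOp_add, add_mul, mul_add, add_apply, add_apply, ← inner_add_right]
          congr 1
          abel
        map_smul' := fun c f => by
          rw [functionOp_smul, smul_mul_assoc, mul_smul_comm, smul_apply, smul_apply, ← smul_sub,
            inner_smul_right]
          rfl }
    -- Fourier vectors have modulus one on their fibre, so `f` maps them to vectors of norm `‖f‖₂`;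
    -- tested between two of them, the commutator with `T` is `L²` bounded in `f`.
    refine eq_zero_of_norm_le_toL2 (dense_span_charFun_top (measX Γ K)) Φ
      (‖T (fourierVec Λ q)‖ + ‖T‖) (fun F => ?_) (fun χ => ?_) f
    · change ‖inner ℂ (fourierVec Λ p) (_ - _)‖ ≤ _
      rw [inner_sub_right, mul_apply_eq_comp, mul_apply_eq_comp,
        inner_apply_eq_star (functionOp _ _ _), star_functionOp, add_mul]
      refine (norm_sub_le _ _).trans (add_le_add ?_ ?_)
      · refine (norm_inner_le_norm _ _).trans ?_
        rw [norm_functionOp_fourierVec, norm_toL2_star, mul_comm]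
      · refine (norm_inner_le_norm _ _).trans ?_
        rw [(orthonormal_fourierVec Λ).1, one_mul]
        refine (T.le_opNorm _).trans ?_
        rw [norm_functionOp_fourierVec]
    · change inner ℂ (fourierVec Λ p) (_ - _) = 0
      rw [hT, sub_self, inner_zero_right]

variable [BorelSpace (QuotX Γ K₁)] [T2Space (QuotX Γ K₁)]

/-- For surjectivity, an element of the abelian algebra `C(K₁)` lies in its own relative commutant;
since the closure of `Λ ∩ K₁` is `K₁`, the description of the Fourier support makes it a bounded
function in the model. -/
theorem isLinftyIso_canonicalIso (hΓK : (Infinite Γ ∧ Nontrivial K) ∨ Subsingleton Γ)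
    (hK₁ : IsClosed (K₁ : Set K)) (h : (Λ ⊓ K₁).topologicalClosure = K₁) :
    IsLinftyIso (algC Γ Λ K₁) (measBase Γ Λ K₁) (canonicalIso Λ K₁) := by
  refine ⟨(isAbelianModel Λ K₁).repr_eq_zero_iff, Set.Subset.antisymm ?_ fun x hx => ?_⟩
  · rintro _ ⟨F, rfl⟩
    exact canonicalIso_mem Λ K₁ F
  · have hrel : x ∈ relativeCommutant (algC Γ Λ K₁) (algM Γ Λ) :=
      ⟨algC_le_algM Λ K₁ hx, fun a ha => commute_algC Λ K₁ ha hx⟩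
    obtain ⟨F, hF⟩ := (isAbelianModel Λ K₁).exists_repr_vec_eq hrel.2
      (apply_mem_closure_span h hΓK hK₁ hrel)
    exact ⟨F, (isAbelianModel Λ K₁).eq_of_apply ((isAbelianModel Λ K₁).repr_mem F) hx hF⟩

theorem isCanonicalIso_canonicalIso (hΓK : (Infinite Γ ∧ Nontrivial K) ∨ Subsingleton Γ)
    (hK₁ : IsClosed (K₁ : Set K)) (h : (Λ ⊓ K₁).topologicalClosure = K₁) :
    IsCanonicalIso Λ K₁ (canonicalIso (Γ := Γ) Λ K₁) where
  iso := isLinftyIso_canonicalIso hΓK hK₁ h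
  map_function := canonicalIso_function Λ K₁
  map_character := canonicalIso_character Λ K₁
  trace := (isAbelianModel Λ K₁).inner_repr

theorem isImplementing_fourierOp (hΓK : (Infinite Γ ∧ Nontrivial K) ∨ Subsingleton Γ)
    (hK₁ : IsClosed (K₁ : Set K)) (h : (Λ ⊓ K₁).topologicalClosure = K₁) :
    IsImplementing (algC Γ Λ K₁) (algM Γ Λ) (traceVector (Γ × Λ) (Γ → K) (measX Γ K))
      (measBase Γ Λ K₁) (canonicalIso Λ K₁) ((Γ × quotΛ Λ K₁) × PontryaginDual K₁)
      (fourierOp Λ) (implementer Λ K₁) where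
  tracial := isTracialVector_algM
  le := algC_le_algM Λ K₁
  iso := isLinftyIso_canonicalIso hΓK hK₁ h
  trace := (isAbelianModel Λ K₁).inner_repr
  mem := fourierOp_mem Λ
  unitary := fourierOp_mem_unitary Λ
  total := dense_span_fourierVec Λ
  implements := fourierOp_mul_canonicalIso Λ K₁
  surjective := implementer_surjective Λ K₁ hK₁

theorem fourierOp_mem_normalizer (hΓK : (Infinite Γ ∧ Nontrivial K) ∨ Subsingleton Γ)
    (hK₁ : IsClosed (K₁ : Set K)) (h : (Λ ⊓ K₁).topologicalClosure = K₁)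
    (j : (Γ × Λ) × PontryaginDual (Γ → K)) :
    fourierOp Λ j ∈ normalizer (algC Γ Λ K₁) (algM Γ Λ) := by
  have hiso := (isLinftyIso_canonicalIso (Γ := Γ) hΓK hK₁ h).2
  refine ⟨fourierOp_mem Λ j, fourierOp_mem_unitary Λ j, ?_⟩
  rw [← hiso]
  refine Set.Subset.antisymm ?_ ?_
  · rintro _ ⟨_, ⟨f, rfl⟩, rfl⟩
    exact ⟨_, (fourierOp_mul_canonicalIso Λ K₁ j f).symm⟩
  · rintro _ ⟨f, rfl⟩
    refine ⟨_, ⟨compMap f (fun z => implementer Λ K₁ j • z) (measurable_const_smul _), rfl⟩, ?_⟩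
    change fourierOp Λ j * _ * star (fourierOp Λ j) = _
    rw [fourierOp_mul_canonicalIso]
    congr 1
    refine Subtype.ext (funext fun z => ?_)
    change f.1 (implementer Λ K₁ j • (implementer Λ K₁ j)⁻¹ • z) = f.1 z
    rw [smul_inv_smul]

/-- All `χ u_g` are in the normalizer, in particular all characters of `X` and all `u_g`. An
operator commuting with the characters commutes with `L^∞(X)`, so the double commutant contains
every generator of `M`. -/
theorem generatedBy_normalizer (hΓK : (Infinite Γ ∧ Nontrivial K) ∨ Subsingleton Γ)
    (hK₁ : IsClosed (K₁ : Set K)) (h : (Λ ⊓ K₁).topologicalClosure = K₁) :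
    generatedBy (normalizer (algC Γ Λ K₁) (algM Γ Λ)) = algM Γ Λ := by
  refine le_antisymm (generatedBy_le fun u hu => hu.1) (generatedBy_le ?_)
  have hN := fourierOp_mem_normalizer (Γ := Γ) (Λ := Λ) hΓK hK₁ h
  rintro _ (⟨f, rfl⟩ | ⟨g, rfl⟩)
  · refine mem_generatedBy_iff.2 fun T hT _ => (commute_functionOp (fun χ => ?_) f).symm
    have e := hT _ (hN (1, χ))
    rwa [fourierOp, groupUnitary_one, mul_one] at e
  · have e := subset_generatedBy _ (hN (g, 1))
    rwa [fourierOp, _root_.map_one charFun, functionOp_one, one_mul] at e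

theorem isInducedRelation_orbitRelation (hΓK : (Infinite Γ ∧ Nontrivial K) ∨ Subsingleton Γ)
    (hK₁ : IsClosed (K₁ : Set K)) (h : (Λ ⊓ K₁).topologicalClosure = K₁) :
    IsInducedRelation (algC Γ Λ K₁) (algM Γ Λ) (measBase Γ Λ K₁) (canonicalIso Λ K₁)
      (orbitRelation Γ Λ K₁) := by
  haveI := countable_dual_subgroup K₁ hK₁
  exact (isImplementing_fourierOp hΓK hK₁ h).isInducedRelation

end Cartan

theorem topologicalClosure_eq_iff {K : Type*} [CommGroup K] [TopologicalSpace K]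
    [IsTopologicalGroup K] {Λ K₁ : Subgroup K} (hK₁ : IsClosed (K₁ : Set K)) :
    (Λ ⊓ K₁).topologicalClosure = K₁ ↔
      (K₁ : Set K) ⊆ closure ((Λ : Set K) ∩ (K₁ : Set K)) :=
  ⟨fun h => (SetLike.coe_subset_coe.2 h.ge), fun h =>
    le_antisymm (Subgroup.topologicalClosure_minimal _ inf_le_right hK₁) h⟩

end CompactBernoulli

end

open CompactBernoulli in
theorem lemma2p2
    {Γ : Type*} [Group Γ] [Countable Γ] [MeasurableSpace Γ] [DiscreteMeasurableSpace Γ]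
    {K : Type*} [CommGroup K] [TopologicalSpace K] [IsTopologicalGroup K] [CompactSpace K]
    [T2Space K] [SecondCountableTopology K] [MeasurableSpace K] [BorelSpace K]
    (Λ : Subgroup K) [Countable Λ] (hΛ : Dense (Λ : Set K))
    (hΓK : (Infinite Γ ∧ Nontrivial K) ∨ (Subsingleton Γ ∧ Infinite K))
    (K₁ : Subgroup K) (hK₁ : IsClosed (K₁ : Set K)) :
    relativeCommutant (algC Γ Λ K₁) (algM Γ Λ) = algC Γ Λ (Λ ⊓ K₁).topologicalClosure ∧
    (IsMaximalAbelian (algC Γ Λ K₁) (algM Γ Λ) ↔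
      (K₁ : Set K) ⊆ closure ((Λ : Set K) ∩ (K₁ : Set K))) ∧
    ((K₁ : Set K) ⊆ closure ((Λ : Set K) ∩ (K₁ : Set K)) →
      IsCartan (algC Γ Λ K₁) (algM Γ Λ) ∧
      ∃ θ, IsCanonicalIso Λ K₁ θ ∧
        IsInducedRelation (algC Γ Λ K₁) (algM Γ Λ) (measBase Γ Λ K₁) θ
          (orbitRelation Γ Λ K₁)) := by
  have hΓK' : (Infinite Γ ∧ Nontrivial K) ∨ Subsingleton Γ := hΓK.imp id And.left
  have := borelSpace_quotX Γ hK₁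
  have := t2Space_quotX Γ hK₁
  rw [← topologicalClosure_eq_iff hK₁]
  have hmax := isMaximalAbelian_of_dense (Λ := Λ) hΓK' hK₁
  refine ⟨relativeCommutant_algC hΓK' hK₁, ⟨dense_of_isMaximalAbelian hK₁, hmax⟩, fun h => ?_⟩
  exact ⟨⟨isTypeIIOneFactor_algM hΛ hΓK, hmax h, generatedBy_normalizer hΓK' hK₁ h⟩,
    canonicalIso Λ K₁, isCanonicalIso_canonicalIso hΓK' hK₁ h,
    isInducedRelation_orbitRelation hΓK' hK₁ h⟩
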